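/- An instance of the directed shallow-light Steiner tree problem is a finite directed graph $G=(V,E)$ with edge costs $c\colon E\to\mathbb{N}$ and edge lengths $\ell\colon E\to\mathbb{N}$, a root $r\in V$, and a set $R\subseteq V$ of terminals with distance bounds $d\colon R\to\mathbb{N}$. A feasible solution is an out-tree $T\subseteq G$ rooted at $r$ such that for every $v\in R$ the distance from $r$ to $v$ in $T$ (with respect to $\ell$) is at most $d(v)$; its cost is $c(T)=\sum_{e\in T}c(e)$. Let $\mathrm{ShallowLight}(i,r,R,d,k)$, with accuracy $\varepsilon>0$, be the following recursive greedy algorithm, where $\mathrm{MinCostPath}(u,v,D)$ is a fully polynomial approximation scheme that returns a $u$-$v$ path of length at most $D$ whose cost is at most $1+\varepsilon$ times minimum. If fewer than $k$ terminals can be reached from $r$ within their bounds, it fails. For $i=1$ it returns the union of the $k$ cheapest of the paths $\mathrm{MinCostPath}(r,t,d(t))$, $t\in R$. For $i>1$ it starts with $T=\emptyset$ and, while $k>0$, considers all $v\in V$, all $1\le k'\le k$ and all length bounds $D\in\{0\}\cup\{(1+\varepsilon)^j : 0\le j\le J\}$, where $J\geq\log_{1+\varepsilon}\ell(E)$ is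 polynomially bounded and $\ell(E)$ is the total length of all edges; for each it computes $P=\mathrm{MinCostPath}(r,v,D)$ and the subgraph $T'=P\cup\mathrm{ShallowLight}(i-1,v,R,d-\ell(P)/(1+\varepsilon),k')$, which serves $k'$ terminals; it adds to $T$ the $T'$ that minimizes $c(T')/k'$, removes the terminals served by it from $R$, and decreases $k$ by $k'$. The algorithm runs $\mathrm{ShallowLight}(i,r,R,d,|R|)$ and outputs a shortest path tree from $r$ of the resulting subgraph. This algorithm is a bi-criteria $(1+\varepsilon_1,O(|R|^{\varepsilon_2}))$-approximation. That is, for every $\varepsilon_2>0$ there are a number of levels $i\ge 1$ and constants $C,A$, depending only on $\varepsilon_2$, such that for every instance and every $\varepsilon_1>0$ the algorithm with $i$ levels and accuracy $\varepsilon=1/\lceil 1/\varepsilon_1\rceil\le\varepsilon_1$ has the following properties. Its running time (in bit operations) is at most $A\,(s+1/\varepsilon_1)^{A}$, where $s$ is the input size, i.e. it is polynomial in the input size and in $1/\varepsilon_1$. If the instance has a feasible solution, then the algorithm outputs an out-tree $T$ rooted at $r$ in which every terminal $v\in R$ has distance at most $(1+\varepsilon_1)\,d(v)$ from $r$, and $c(T)\le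 C\,|R|^{\varepsilon_2}\,c(T^*)$ for every feasible solution $T^*$. -/

import Mathlib

/-! ## Step-counted computations

`Timed α` is the result of a computation together with the number of steps it took.  Sequencing adds
the step counts.  The primitives below are charged in the logarithmic (bit) cost model: arithmetic
on numbers is charged by the bit length of the operands, an operation on a subset of a finite type
(a bit vector) by the size of the type, reading an entry of a stored table costs one step, filling
a table costs what computing all its entries costs (plus one per entry), and a loop costs
what its rounds cost (plus one per round, which pays for the index that the loop runs through).  All
algorithms below are composed of these primitives, branching, pairing, list and option
constructors, and the increments `N + 1` and `B + 1` only. -/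

structure Timed (α : Type) where
  val : α
  time : ℕ

namespace Timed

instance : Monad Timed where
  pure a := ⟨a, 0⟩
  bind x f := ⟨(f x.val).val, x.time + (f x.val).time⟩

def add (a b : ℕ) : Timed ℕ := ⟨a + b, 1 + a.size + b.size⟩
def sub (a b : ℕ) : Timed ℕ := ⟨a - b, 1 + a.size + b.size⟩
def mul (a b : ℕ) : Timed ℕ := ⟨a * b, (1 + a.size) * (1 + b.size)⟩
def div (a b : ℕ) : Timed ℕ := ⟨a / b, (1 + a.size) * (1 + b.size)⟩
def lt (a b : ℕ) : Timed Bool := ⟨decide (a < b), 1 + a.size + b.size⟩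
def le (a b : ℕ) : Timed Bool := ⟨decide (a ≤ b), 1 + a.size + b.size⟩
/-- The bit length of a number. -/
def bits (a : ℕ) : Timed ℕ := ⟨a.size, 1 + a.size⟩
/-- Subtraction of a natural number from an integer. -/
def intSub (a : ℤ) (b : ℕ) : Timed ℤ := ⟨a - b, 1 + a.natAbs.size + b.size⟩
/-- The natural number that a non-negative integer is, and `none` for a negative integer. -/
def toNat? (a : ℤ) : Timed (Option ℕ) :=
  ⟨if a < 0 then none else some a.toNat, 1 + a.natAbs.size⟩
/-- Subtraction inside an index range. -/
def finSub {k : ℕ} (a : Fin k) (b : ℕ) : Timed (Fin k) :=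
  ⟨⟨a - b, lt_of_le_of_lt (Nat.sub_le a b) a.isLt⟩, 1 + a.val.size + b.size⟩

/-- Equality of two indices (vertices). -/
def eq {k : ℕ} (a b : Fin k) : Timed Bool := ⟨decide (a = b), 1 + a.val.size + b.val.size⟩

/-- Reading an entry of a stored table. -/
def get {ι α : Type} (f : ι → α) (i : ι) : Timed α := ⟨f i, 1⟩

/-- Filling a table. -/
def table {ι α : Type} [Fintype ι] (f : ι → Timed α) : Timed (ι → α) :=
  ⟨fun i => (f i).val, 1 + ∑ i, (1 + (f i).time)⟩

/-- A loop over a list, with a state. -/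
def fold {α β : Type} : List α → β → (β → α → Timed β) → Timed β
  | [], b, _ => ⟨b, 1⟩
  | a :: l, b, f => do
    let b' ← f b a
    let out ← fold l b' f
    ⟨out, 1⟩

/-- Operations on subsets of a finite type, stored as bit vectors. -/
def mem {ι : Type} [DecidableEq ι] (i : ι) (s : Finset ι) : Timed Bool := ⟨decide (i ∈ s), 1⟩
def insert {ι : Type} [Fintype ι] [DecidableEq ι] (i : ι) (s : Finset ι) : Timed (Finset ι) :=
  ⟨Insert.insert i s, 1 + Fintype.card ι⟩
def union {ι : Type} [Fintype ι] [DecidableEq ι] (s t : Finset ι) : Timed (Finset ι) :=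
  ⟨s ∪ t, 1 + Fintype.card ι⟩
def sdiff {ι : Type} [Fintype ι] [DecidableEq ι] (s t : Finset ι) : Timed (Finset ι) :=
  ⟨s \ t, 1 + Fintype.card ι⟩
def card {ι : Type} [Fintype ι] (s : Finset ι) : Timed ℕ := ⟨s.card, 1 + Fintype.card ι⟩

/-- Keeps the candidate with the smaller key (the older one in case of a tie). -/
def keepMin {α : Type} (key : α → ℕ) (best : Option α) (a : α) : Timed (Option α) :=
  match best with
  | none => pure (some a)
  | some b => do
    if ← lt (key a) (key b) then pure (some a) else pure (some b)

end Timed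

/-! ## Directed shallow-light Steiner trees -/

/-- An instance `(G, c, ℓ, r, R, d)` of the directed shallow-light Steiner tree problem.  The
vertices are `Fin n`, the edges are `Fin m` with sources `src` and targets `tgt` (so parallel edges
are allowed), and only the values of `d` on `R` matter. -/
structure SLProblem where
  n : ℕ
  m : ℕ
  src : Fin m → Fin n
  tgt : Fin m → Fin n
  cost : Fin m → ℕ
  len : Fin m → ℕ
  root : Fin n
  R : Finset (Fin n)
  d : Fin n → ℕ

namespace SLProblem

variable (I : SLProblem)

/-- The input size: numbers of vertices and edges plus the bit lengths of all numbers. -/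
def size : ℕ :=
  I.n + I.m + ∑ e, ((I.cost e).size + (I.len e).size) + ∑ v, (I.d v).size

/-- The list `p` of edges is a walk from `u` to `v` that uses only edges in `T`. -/
def IsWalk (T : Finset (Fin I.m)) : Fin I.n → Fin I.n → List (Fin I.m) → Prop
  | u, v, [] => u = v
  | u, v, e :: p => e ∈ T ∧ I.src e = u ∧ IsWalk T (I.tgt e) v p

/-- The edge set `T` forms an out-tree with root `I.root`: no edge enters the root, no two
edges enter the same vertex, and every edge of `T` is reachable from the root inside `T`.
The empty set is the tree whose only vertex is the root. -/
def IsRootedTree (T : Finset (Fin I.m)) : Prop :=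
  (∀ e ∈ T, I.tgt e ≠ I.root) ∧
  (∀ e ∈ T, ∀ f ∈ T, I.tgt e = I.tgt f → e = f) ∧
  ∀ e ∈ T, ∃ p, I.IsWalk T I.root (I.src e) p

/-- The distance from the root to `v` in `T`, with respect to `len`, is at most `x` (in particular
`v` is reachable from the root in `T`). -/
def DistLE (T : Finset (Fin I.m)) (v : Fin I.n) (x : ℝ) : Prop :=
  ∃ p, I.IsWalk T I.root v p ∧ (((p.map I.len).sum : ℕ) : ℝ) ≤ x

/-- The cost of an edge set. -/
def totalCost (T : Finset (Fin I.m)) : ℕ := ∑ e ∈ T, I.cost e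

/-- `T` is a rooted tree that meets all distance bounds up to a factor `β`. -/
def IsSolution (β : ℝ) (T : Finset (Fin I.m)) : Prop :=
  I.IsRootedTree T ∧ ∀ v ∈ I.R, I.DistLE T v (β * I.d v)

/-- `T` is a directed shallow-light Steiner tree. -/
def IsFeasible (T : Finset (Fin I.m)) : Prop := I.IsSolution 1 T

/-! ## The subroutine `MinCostPath`

A fully polynomial approximation scheme for the restricted shortest path problem: find a cheapest
walk from `u` to `v` of length at most `D`.  The bound on the length is met exactly, and the
cost is at most `1 + 1/N` times the minimum.  For each guess `c₀` of the largest edge cost on an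
optimal path, costs are scaled to `⌊cost · nN / c₀⌋`, and a table of shortest walks
with bounded scaled cost is filled. -/

/-- A path, stored as its list of edges, the last edge first, with its length and cost. -/
structure Path (I : SLProblem) where
  edges : List (Fin I.m)
  len : ℕ
  cost : ℕ

/-- The scaled cost of every edge of cost at most `c₀`; costlier edges are discarded. -/
def scaledCost (N c₀ : ℕ) : Timed (Fin I.m → Option ℕ) :=
  Timed.table fun e => do
    let c ← Timed.get I.cost e
    if ← Timed.le c c₀ then
      let K ← Timed.mul I.n N
      let cK ← Timed.mul c K
      let s ← Timed.div cK c₀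
      pure (some s)
    else pure none

/-- Entry `(x, b)` after `t` rounds: a shortest walk from `u` to `x` with at most `t` edges and scaled
cost at most `b`. -/
def walkTable (σ : Fin I.m → Option ℕ) (B : ℕ) (u : Fin I.n) :
    ℕ → Timed (Fin I.n × Fin (B + 1) → Option (Path I))
  | 0 => Timed.table fun xb => do
    if ← Timed.eq xb.1 u then pure (some ⟨[], 0, 0⟩) else pure none
  | t + 1 => do
    let f ← walkTable σ B u t
    Timed.table fun xb => do
      let old ← Timed.get f xb
      Timed.fold (List.finRange I.m) old fun best e => do
        let y ← Timed.get I.tgt e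
        if ← Timed.eq y xb.1 then
          match ← Timed.get σ e with
          | none => pure best
          | some s => do
            if ← Timed.le s xb.2.val then
              let b ← Timed.finSub xb.2 s
              let z ← Timed.get I.src e
              match ← Timed.get f (z, b) with
              | none => pure best
              | some p => do
                let le ← Timed.get I.len e
                let ce ← Timed.get I.cost e
                let l ← Timed.add p.len le
                let c ← Timed.add p.cost ce
                Timed.keepMin Path.len best ⟨e :: p.edges, l, c⟩
            else pure best
        else pure best

def minCostPath (N : ℕ) (u v : Fin I.n) (D : ℕ) : Timed (Option (Path I)) := do
  let nn ← Timed.mul I.n I.n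
  let B ← Timed.mul nn N
  let guess : Option (Path I) → ℕ → Timed (Option (Path I)) := fun best c₀ => do
    let σ ← I.scaledCost N c₀
    let f ← I.walkTable σ B u I.n
    Timed.fold (List.finRange (B + 1)) best fun best b => do
      match ← Timed.get f (v, b) with
      | none => pure best
      | some p => do
        if ← Timed.le p.len D then Timed.keepMin Path.cost best p else pure best
  let best ← guess none 0
  Timed.fold (List.finRange I.m) best fun best e => do
    let c₀ ← Timed.get I.cost e
    guess best c₀

/-! ## The algorithm `ShallowLight`

The accuracy is `ε = 1/N`.  Distance bounds that arise in the recursion are multiples of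
`1/(1+ε) · 1/N = 1/(N+1)`; they are stored multiplied by `N + 1`, as integers
`δ u = (N + 1) · d u`. -/

/-- A subgraph (its edges) with the set of terminals that it spans within their bounds. -/
structure Partial (I : SLProblem) where
  edges : Finset (Fin I.m)
  served : Finset (Fin I.n)

def addPath (E : Finset (Fin I.m)) (P : Path I) : Timed (Finset (Fin I.m)) :=
  Timed.fold P.edges E fun E e => Timed.insert e E

def costOf (E : Finset (Fin I.m)) : Timed ℕ :=
  Timed.fold (List.finRange I.m) 0 fun acc e => do
    if ← Timed.mem e E then
      let c ← Timed.get I.cost e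
      Timed.add acc c
    else pure acc

/-- The paths `P t = MinCostPath(r, t, d t)`, for all terminals `t ∈ R`. -/
def terminalPaths (N : ℕ) (r : Fin I.n) (R : Finset (Fin I.n)) (δ : Fin I.n → ℤ) :
    Timed (Fin I.n → Option (Path I)) :=
  Timed.table fun t => do
    if ← Timed.mem t R then
      let a ← Timed.get δ t
      match ← Timed.toNat? a with
      | none => pure none
      | some a => do
        let D ← Timed.div a (N + 1)
        I.minCostPath N r t D
    else pure none

/-- The number of terminals whose bound can be met. -/
def countPaths (P : Fin I.n → Option (Path I)) : Timed ℕ :=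
  Timed.fold (List.finRange I.n) 0 fun acc t => do
    match ← Timed.get P t with
    | none => pure acc
    | some _ => Timed.add acc 1

/-- Adds the `k` cheapest of the paths `P t`, `t ∉ S.served`, to `S`. -/
def addCheapest (P : Fin I.n → Option (Path I)) : ℕ → Partial I → Timed (Partial I)
  | 0, S => pure S
  | k + 1, S => do
    let best : Option (Fin I.n × Path I) ←
      Timed.fold (List.finRange I.n) none fun best t => do
        if ← Timed.mem t S.served then pure best
        else
          match ← Timed.get P t with
          | none => pure best
          | some p => Timed.keepMin (fun tp => tp.2.cost) best (t, p)
    match best with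
    | none => pure S
    | some (t, p) => do
      let E ← I.addPath S.edges p
      let U ← Timed.insert t S.served
      addCheapest P k ⟨E, U⟩

/-- The length bounds that are tried for the path from `r` to `v`: `0` and `⌊(1+ε)^j⌋` for
`0 ≤ j ≤ J`, where `J = N · bits(ℓ(E))` is at least `log_{1+ε} ℓ(E)`, because `(1+1/N)^N ≥ 2`. -/
def lengthBounds (N : ℕ) : Timed (List ℕ) := do
  let L ← Timed.fold (List.finRange I.m) 0 fun acc e => do
    let l ← Timed.get I.len e
    Timed.add acc l
  let s ← Timed.bits L
  let J ← Timed.mul N s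
  let out : List ℕ × ℕ × ℕ ←
    Timed.fold (List.range (J + 1)) ([], 1, 1) fun (acc, p, q) _ => do
      let b ← Timed.div p q
      let p' ← Timed.mul p (N + 1)
      let q' ← Timed.mul q N
      pure (b :: acc, p', q')
  pure (0 :: out.1)

/-- The type of the recursive procedure: it takes a root, a terminal set, (scaled) distance
bounds, and the number `k` of terminals to span. -/
abbrev Procedure (I : SLProblem) : Type :=
  Fin I.n → Finset (Fin I.n) → (Fin I.n → ℤ) → ℕ → Timed (Option (Partial I))

/-- A candidate for `T_best`: a subgraph, its cost, and the number of terminals spanned. -/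
structure Candidate (I : SLProblem) where
  sub : Partial I
  cost : ℕ
  count : ℕ

/-- Replaces the candidate if the new one has smaller relative cost `cost / count`. -/
def keepLighter (best : Option (Candidate I)) (a : Candidate I) : Timed (Option (Candidate I)) :=
  match best with
  | none => pure (some a)
  | some b => do
    let x ← Timed.mul a.cost b.count
    let y ← Timed.mul b.cost a.count
    if ← Timed.lt x y then pure (some a) else pure (some b)

/-- Computes `T_best`, where `rec` is the procedure for the next lower level. -/
def bestCandidate (N : ℕ) (rec : Procedure I) (r : Fin I.n) (R : Finset (Fin I.n))
    (δ : Fin I.n → ℤ) (k : ℕ) : Timed (Option (Candidate I)) := do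
  let bounds ← I.lengthBounds N
  Timed.fold (List.finRange I.n) none fun best v =>
    Timed.fold (List.range' 1 k) best fun best k' =>
      Timed.fold bounds best fun best D => do
        match ← I.minCostPath N r v D with
        | none => pure best
        | some P => do
          let shift ← Timed.mul N P.len
          let δ' ← Timed.table fun u => do
            let a ← Timed.get δ u
            Timed.intSub a shift
          match ← rec v R δ' k' with
          | none => pure best
          | some S => do
            let E ← I.addPath S.edges P
            let c ← I.costOf E
            I.keepLighter best ⟨⟨E, S.served⟩, c, k'⟩

/-- The loop `while k > 0`; every round decreases `k`, so `k` rounds suffice. -/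
def greedyLoop (N : ℕ) (rec : Procedure I) (r : Fin I.n) (δ : Fin I.n → ℤ) :
    ℕ → Finset (Fin I.n) → ℕ → Partial I → Timed (Option (Partial I))
  | 0, _, _, S => pure (some S)
  | fuel + 1, R, k, S => do
    if ← Timed.lt 0 k then
      match ← I.bestCandidate N rec r R δ k with
      | none => pure none
      | some C => do
        let E ← Timed.union S.edges C.sub.edges
        let U ← Timed.union S.served C.sub.served
        let R' ← Timed.sdiff R C.sub.served
        let k' ← Timed.sub k C.count
        greedyLoop N rec r δ fuel R' k' ⟨E, U⟩
    else pure (some S)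

/-- The recursive procedure with `i` levels (`i ≥ 1`; level `0` only serves to start the
recursion).  It returns `none` if fewer than `k` terminals can be reached within their bounds. -/
def shallowLight (N : ℕ) : ℕ → Procedure I
  | 0 => fun _ _ _ _ => pure none
  | i + 1 => fun r R δ k => do
    let P ← I.terminalPaths N r R δ
    let reachable ← I.countPaths P
    if ← Timed.lt reachable k then pure none
    else
      if i = 0 then
        let S ← I.addCheapest P k ⟨∅, ∅⟩
        pure (some S)
      else I.greedyLoop N (shallowLight N i) r δ k R k ⟨∅, ∅⟩

/-- One round of growing a shortest path tree of the subgraph `E`: of all edges of `E` that leave the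
tree `s.1`, add one with the nearest endpoint; `s.2` holds the distances in the tree. -/
def growTree (E : Finset (Fin I.m)) (s : Finset (Fin I.m) × (Fin I.n → Option ℕ)) :
    Timed (Finset (Fin I.m) × (Fin I.n → Option ℕ)) := do
  let best : Option (Fin I.m × ℕ) ←
    Timed.fold (List.finRange I.m) none fun best e => do
      if ← Timed.mem e E then
        let x ← Timed.get I.src e
        let y ← Timed.get I.tgt e
        match ← Timed.get s.2 x, ← Timed.get s.2 y with
        | some a, none => do
          let l ← Timed.get I.len e
          let b ← Timed.add a l
          Timed.keepMin Prod.snd best (e, b)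
        | _, _ => pure best
      else pure best
  match best with
  | none => pure s
  | some (e, b) => do
    let A ← Timed.insert e s.1
    let y ← Timed.get I.tgt e
    let dist ← Timed.table fun x => do
      if ← Timed.eq x y then pure (some b) else Timed.get s.2 x
    pure (A, dist)

/-- The shortest path tree, from the root, of the subgraph `E`. -/
def shortestPathTree (E : Finset (Fin I.m)) : Timed (Finset (Fin I.m)) := do
  let dist ← Timed.table fun x => do
    if ← Timed.eq x I.root then pure (some 0) else pure none
  let out ← Timed.fold (List.range I.n) (∅, dist) fun s _ => I.growTree E s
  pure out.1

/-- The complete algorithm with `i` levels and accuracy `ε = 1/N`: the procedure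
`shallowLight` is called with `k = |R|`, and the subgraph it returns is turned into a tree. -/
def algorithm (i N : ℕ) : Timed (Option (Finset (Fin I.m))) := do
  let δ ← Timed.table fun u => do
    let a ← Timed.get I.d u
    let b ← Timed.mul (N + 1) a
    pure (b : ℤ)
  let k ← Timed.card I.R
  match ← I.shallowLight N i I.root I.R δ k with
  | none => pure none
  | some S => do
    let T ← I.shortestPathTree S.edges
    pure (some T)

end SLProblem

/-! The heart of the proof is a density argument on an optimal tree of cost c. A feasible tree is
turned into a derivation of `Spans`, so that facts about trees become structural inductions
(`IsFeasible.spans`). Dropping terminals keeps the cost (`Spans.subset`), so whatever the greedy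
loop has not yet served is still spanned at cost c.

Ratio: by induction on levels, i levels serve k terminals at cost at most F·k^(1/i)·c, with F
depending only on i (`shallowLight_approximates`). One level uses k paths of cost at most (1+1/N)c ≤
2c each. For the step from α = 1/i to β = 1/(i+1), cut a tree with k terminals bottom-up into pieces
with about s = k^(1-β) terminals. There are at most k/s ≤ k^β pieces, up to a small remainder at the
root. Each hangs on a path of cost at most c, and the recursion serves a piece at a loss of O(s^α) =
O(k^β). Averaging, some piece with its path has density O(k^(β-1))·c (`Spans.density`), and the
exhaustive search finds a candidate that is at least as light
(`Procedure.Approximates.bestCandidate`). By concavity, a round that serves j terminals is paid for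
by the decrease from k^β to (k-j)^β, and these decreases telescope
(`Procedure.Approximates.greedyLoop`).

Distances: budgets are multiplied by N+1. A unit of length uses up N+1 in the optimal tree, but the
algorithm subtracts only N. Guessing a length D costs a factor 1+1/N, so the path found satisfies
N·ℓ(P) ≤ (N+1)·ℓ(Q), where Q is the path in the tree. Hence the budgets of the algorithm dominate
those of the tree, and the recursion succeeds whenever the tree does. Conversely a served terminal
satisfies N·length ≤ (N+1)·d, which is the factor 1+1/N. The final shortest path tree lengthens no
distance and uses only edges already paid for.

Time: with X bounding all parameters and input bit lengths, paths have numbers of at most 2X bits,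
budgets have at most 4X bits, and each further level multiplies the time by at most X^12. -/

namespace Timed
variable {α β : Type}

/-! ### Values and step bounds of counted programs -/

@[simp] theorem val_pure (a : α) : (pure a : Timed α).val = a := rfl
@[simp] theorem val_bind (x : Timed α) (f : α → Timed β) : (x >>= f).val = (f x.val).val := rfl
@[simp] theorem val_get {ι : Type} (f : ι → α) (i : ι) : (get f i).val = f i := rfl
@[simp] theorem val_table {ι : Type} [Fintype ι] (f : ι → Timed α) (i : ι) :
    (table f).val i = (f i).val := rfl
@[simp] theorem val_add (a b : ℕ) : (add a b).val = a + b := rfl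
@[simp] theorem val_sub (a b : ℕ) : (sub a b).val = a - b := rfl
@[simp] theorem val_mul (a b : ℕ) : (mul a b).val = a * b := rfl
@[simp] theorem val_div (a b : ℕ) : (div a b).val = a / b := rfl
@[simp] theorem val_lt (a b : ℕ) : (lt a b).val = decide (a < b) := rfl
@[simp] theorem val_le (a b : ℕ) : (le a b).val = decide (a ≤ b) := rfl
@[simp] theorem val_bits (a : ℕ) : (bits a).val = a.size := rfl
@[simp] theorem val_intSub (a : ℤ) (b : ℕ) : (intSub a b).val = a - b := rfl
@[simp] theorem val_toNat? (a : ℤ) : (toNat? a).val = if a < 0 then none else some a.toNat := rfl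
@[simp] theorem val_eq {k : ℕ} (a b : Fin k) : (eq a b).val = decide (a = b) := rfl
@[simp] theorem val_mem {ι : Type} [DecidableEq ι] (i : ι) (s : Finset ι) :
    (mem i s).val = decide (i ∈ s) := rfl
@[simp] theorem val_insert {ι : Type} [Fintype ι] [DecidableEq ι] (i : ι) (s : Finset ι) :
    (Timed.insert i s).val = Insert.insert i s := rfl
@[simp] theorem val_union {ι : Type} [Fintype ι] [DecidableEq ι] (s t : Finset ι) :
    (union s t).val = s ∪ t := rfl
@[simp] theorem val_sdiff {ι : Type} [Fintype ι] [DecidableEq ι] (s t : Finset ι) :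
    (sdiff s t).val = s \ t := rfl
@[simp] theorem val_card {ι : Type} [Fintype ι] (s : Finset ι) : (card s).val = s.card := rfl

@[simp] theorem val_fold_nil (b : β) (f : β → α → Timed β) : (fold [] b f).val = b := rfl
@[simp] theorem val_fold_cons (a : α) (l : List α) (b : β) (f : β → α → Timed β) :
    (fold (a :: l) b f).val = (fold l (f b a).val f).val := rfl

theorem val_keepMin (key : α → ℕ) (best : Option α) (a : α) :
    (keepMin key best a).val = some a ∨ ∃ b, best = some b ∧ (keepMin key best a).val = some b := by
  unfold keepMin
  cases best with
  | none => exact Or.inl rfl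
  | some b => by_cases h : key a < key b <;> simp [h]

/-- `x` holds a value with key at most `c`. -/
def KeyLE (key : α → ℕ) (c : ℕ) (x : Option α) : Prop := ∃ a, x = some a ∧ key a ≤ c

theorem keyLE_keepMin_new (key : α → ℕ) (best : Option α) {a : α} {c : ℕ} (h : key a ≤ c) :
    KeyLE key c (keepMin key best a).val := by
  unfold keepMin
  cases best with
  | none => exact ⟨a, rfl, h⟩
  | some b =>
    by_cases hab : key a < key b
    · exact ⟨a, by simp [hab], h⟩
    · exact ⟨b, by simp [hab], by omega⟩

theorem keyLE_keepMin_old (key : α → ℕ) {best : Option α} (a : α) {c : ℕ} (h : KeyLE key c best) :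
    KeyLE key c (keepMin key best a).val := by
  obtain ⟨b, rfl, hb⟩ := h
  unfold keepMin
  by_cases hab : key a < key b
  · exact ⟨a, by simp [hab], by omega⟩
  · exact ⟨b, by simp [hab], hb⟩

/-- An invariant of the rounds holds at the end of a loop. -/
theorem fold_inv {l : List α} {b : β} {f : β → α → Timed β} (Inv : β → Prop) (hb : Inv b)
    (hf : ∀ b, ∀ a ∈ l, Inv b → Inv (f b a).val) : Inv (fold l b f).val := by
  induction l generalizing b with
  | nil => exact hb
  | cons a l ih =>
    rw [val_fold_cons]
    exact ih (hf b a (by simp) hb) fun b a' ha' => hf b a' (by simp [ha'])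

/-- A property that the round of `a` establishes and that all rounds preserve holds at the end. -/
theorem fold_reach {l : List α} {b : β} {f : β → α → Timed β} (Inv Good : β → Prop) (hb : Inv b)
    (hf : ∀ b, ∀ a ∈ l, Inv b → Inv (f b a).val)
    (hG : ∀ b, ∀ a ∈ l, Inv b → Good b → Good (f b a).val)
    {a : α} (ha : a ∈ l) (hGa : ∀ b, Inv b → Good (f b a).val) : Good (fold l b f).val := by
  induction l generalizing b with
  | nil => simp at ha
  | cons a' l ih =>
    rw [val_fold_cons]
    have hb' := hf b a' (by simp) hb
    have hf' : ∀ b, ∀ a ∈ l, Inv b → Inv (f b a).val := fun b x hx => hf b x (by simp [hx])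
    rcases List.mem_cons.1 ha with rfl | ha
    · refine (fold_inv (fun b => Inv b ∧ Good b) ⟨hb', hGa b hb⟩ ?_).2
      exact fun b x hx hbx => ⟨hf' b x hx hbx.1, hG b x (by simp [hx]) hbx.1 hbx.2⟩
    · exact ih hb' hf' (fun b x hx => hG b x (by simp [hx])) ha

/-- The value satisfies `P`, and the number of steps is at most `t`. -/
def Spec (x : Timed α) (P : α → Prop) (t : ℕ) : Prop := P x.val ∧ x.time ≤ t

theorem Spec.mono {x : Timed α} {P Q : α → Prop} {s t : ℕ} (h : Spec x P s)
    (hPQ : ∀ a, P a → Q a) (hst : s ≤ t) : Spec x Q t := ⟨hPQ _ h.1, h.2.trans hst⟩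

theorem Spec.le {x : Timed α} {P : α → Prop} {s t : ℕ} (h : Spec x P s) (hst : s ≤ t) :
    Spec x P t := ⟨h.1, h.2.trans hst⟩

theorem Spec.pure {a : α} {P : α → Prop} {t : ℕ} (h : P a) : Spec (Pure.pure a) P t :=
  ⟨h, Nat.zero_le _⟩

/-- The rest of the program is timed only for values satisfying `P`. Steps are charged by bit
length, so size bounds have to be carried along with time bounds. -/
theorem Spec.bind {x : Timed α} {f : α → Timed β} {P : α → Prop} {Q : β → Prop} {s t u : ℕ}
    (hx : Spec x P s) (hst : s + t ≤ u) (hf : ∀ a, P a → Spec (f a) Q t) :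
    Spec (x >>= f) Q u :=
  ⟨(hf _ hx.1).1, (Nat.add_le_add hx.2 (hf _ hx.1).2).trans hst⟩

theorem Spec.table {ι : Type} [Fintype ι] {f : ι → Timed α} {P : ι → α → Prop} {t c u : ℕ}
    (hc : Fintype.card ι ≤ c) (hu : 1 + c * (1 + t) ≤ u) (h : ∀ i, Spec (f i) (P i) t) :
    Spec (table f) (fun g => ∀ i, P i (g i)) u := by
  refine ⟨fun i => (h i).1, le_trans ?_ hu⟩
  have h1 : ∑ i, (1 + (f i).time) ≤ Fintype.card ι * (1 + t) := by
    rw [← smul_eq_mul, ← Finset.card_univ]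
    exact Finset.sum_le_card_nsmul _ _ _ fun i _ => Nat.add_le_add_left (h i).2 1
  exact Nat.add_le_add_left (h1.trans (Nat.mul_le_mul_right _ hc)) 1

theorem Spec.fold {l : List α} {b : β} {f : β → α → Timed β} {Inv : β → Prop} {t c u : ℕ}
    (hb : Inv b) (hc : l.length ≤ c) (hu : 1 + c * (1 + t) ≤ u)
    (h : ∀ b, ∀ a ∈ l, Inv b → Spec (f b a) Inv t) : Spec (fold l b f) Inv u := by
  refine ⟨fold_inv Inv hb fun b a ha hb => (h b a ha hb).1, le_trans ?_ hu⟩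
  refine le_trans ?_ (Nat.add_le_add_left (Nat.mul_le_mul_right _ hc) 1)
  clear hc hu
  induction l generalizing b with
  | nil => simp [Timed.fold]
  | cons a l ih =>
    have h1 := h b a (by simp) hb
    have h2 := ih h1.1 fun b a' ha' => h b a' (by simp [ha'])
    have h3 : (Timed.fold (a :: l) b f).time
        = (f b a).time + ((Timed.fold l (f b a).val f).time + 1) := rfl
    have h4 := h1.2
    rw [h3, List.length_cons, Nat.succ_mul]
    omega

end Timed

/-! ### Walks, their lengths and their costs -/

namespace SLProblem

variable {I : SLProblem}

/-- The length of a list of edges. -/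
def walkLen (I : SLProblem) (p : List (Fin I.m)) : ℕ := (p.map I.len).sum

/-- The cost of a list of edges. -/
def walkCost (I : SLProblem) (p : List (Fin I.m)) : ℕ := (p.map I.cost).sum

@[simp] theorem walkLen_nil : I.walkLen [] = 0 := rfl
@[simp] theorem walkCost_nil : I.walkCost [] = 0 := rfl
@[simp] theorem walkLen_cons (e : Fin I.m) (p : List (Fin I.m)) :
    I.walkLen (e :: p) = I.len e + I.walkLen p := by simp [walkLen]
@[simp] theorem walkCost_cons (e : Fin I.m) (p : List (Fin I.m)) :
    I.walkCost (e :: p) = I.cost e + I.walkCost p := by simp [walkCost]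
@[simp] theorem walkLen_append (p q : List (Fin I.m)) :
    I.walkLen (p ++ q) = I.walkLen p + I.walkLen q := by simp [walkLen]
@[simp] theorem walkCost_append (p q : List (Fin I.m)) :
    I.walkCost (p ++ q) = I.walkCost p + I.walkCost q := by simp [walkCost]
@[simp] theorem walkLen_reverse (p : List (Fin I.m)) : I.walkLen p.reverse = I.walkLen p := by
  simp [walkLen, List.sum_reverse]

@[simp] theorem isWalk_nil {T : Finset (Fin I.m)} {u v : Fin I.n} : I.IsWalk T u v [] ↔ u = v :=
  Iff.rfl

@[simp] theorem isWalk_cons {T : Finset (Fin I.m)} {u v : Fin I.n} {e : Fin I.m}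
    {p : List (Fin I.m)} :
    I.IsWalk T u v (e :: p) ↔ e ∈ T ∧ I.src e = u ∧ I.IsWalk T (I.tgt e) v p := Iff.rfl

theorem isWalk_append {T : Finset (Fin I.m)} {u v : Fin I.n} {p q : List (Fin I.m)} :
    I.IsWalk T u v (p ++ q) ↔ ∃ w, I.IsWalk T u w p ∧ I.IsWalk T w v q := by
  induction p generalizing u with
  | nil => simp
  | cons e p ih => simp [ih, and_assoc]

theorem isWalk_concat {T : Finset (Fin I.m)} {u v : Fin I.n} {p : List (Fin I.m)} {e : Fin I.m} :
    I.IsWalk T u v (p ++ [e]) ↔ I.IsWalk T u (I.src e) p ∧ e ∈ T ∧ I.tgt e = v := by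
  rw [isWalk_append]
  constructor
  · rintro ⟨w, h1, h2, rfl, h3⟩
    exact ⟨h1, h2, h3⟩
  · rintro ⟨h1, h2, h3⟩
    exact ⟨_, h1, h2, rfl, h3⟩

theorem IsWalk.mem {T : Finset (Fin I.m)} {u v : Fin I.n} {p : List (Fin I.m)}
    (h : I.IsWalk T u v p) : ∀ e ∈ p, e ∈ T := by
  induction p generalizing u with
  | nil => simp
  | cons f p ih =>
    intro e he
    rcases List.mem_cons.1 he with rfl | he
    · exact h.1
    · exact ih h.2.2 e he

theorem IsWalk.of_mem {T S : Finset (Fin I.m)} {u v : Fin I.n} {p : List (Fin I.m)}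
    (h : I.IsWalk T u v p) (hS : ∀ e ∈ p, e ∈ S) : I.IsWalk S u v p := by
  induction p generalizing u with
  | nil => exact h
  | cons f p ih =>
    exact ⟨hS f (by simp), h.2.1, ih h.2.2 fun e he => hS e (by simp [he])⟩

theorem IsWalk.mono {T S : Finset (Fin I.m)} {u v : Fin I.n} {p : List (Fin I.m)}
    (h : I.IsWalk T u v p) (hTS : T ⊆ S) : I.IsWalk S u v p :=
  h.of_mem fun e he => hTS (h.mem e he)

theorem IsWalk.univ {T : Finset (Fin I.m)} {u v : Fin I.n} {p : List (Fin I.m)}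
    (h : I.IsWalk T u v p) : I.IsWalk Finset.univ u v p := h.mono (Finset.subset_univ T)

/-- Cutting out cycles. -/
theorem IsWalk.exists_nodup {T : Finset (Fin I.m)} {u v : Fin I.n} {p : List (Fin I.m)}
    (h : I.IsWalk T u v p) :
    ∃ q, I.IsWalk T u v q ∧ q.Sublist p ∧ (q.map I.src).Nodup := by
  induction p generalizing u with
  | nil => exact ⟨[], h, List.Sublist.refl _, by simp⟩
  | cons e p ih =>
    obtain ⟨q, hq, hqp, hn⟩ := ih h.2.2
    by_cases hu : u ∈ q.map I.src
    -- The walk returns to `u`: keep only the part of `q` from the edge `f` that leaves `u`.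
    · obtain ⟨f, hf, rfl⟩ := List.mem_map.1 hu
      obtain ⟨a, b, rfl⟩ := List.append_of_mem hf
      obtain ⟨w, -, hw⟩ := isWalk_append.1 hq
      have hw' : I.IsWalk T (I.src f) v (f :: b) := ⟨hw.1, rfl, hw.2.2⟩
      refine ⟨f :: b, hw', ?_, ?_⟩
      · exact ((List.sublist_append_right a _).trans hqp).trans (List.sublist_cons_self _ _)
      · rw [List.map_append] at hn
        exact hn.of_append_right
    · refine ⟨e :: q, ⟨h.1, h.2.1, hq⟩, hqp.cons_cons e, ?_⟩
      rw [List.map_cons, List.nodup_cons, h.2.1]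
      exact ⟨hu, hn⟩

theorem walkLen_sublist {p q : List (Fin I.m)} (h : q.Sublist p) : I.walkLen q ≤ I.walkLen p :=
  (h.map I.len).sum_le_sum (by simp)

theorem walkCost_sublist {p q : List (Fin I.m)} (h : q.Sublist p) :
    I.walkCost q ≤ I.walkCost p :=
  (h.map I.cost).sum_le_sum (by simp)

theorem length_le_of_nodup {p : List (Fin I.m)} (h : (p.map I.src).Nodup) : p.length ≤ I.n := by
  simpa using h.length_le_card

/-- Distinct sources force distinct edges. This is why length bounds up to the total length of all
edges suffice. -/
theorem walkLen_le_of_nodup {p : List (Fin I.m)} (h : (p.map I.src).Nodup) :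
    I.walkLen p ≤ ∑ e, I.len e := by
  have hp : p.Nodup := List.Nodup.of_map _ h
  have : I.walkLen p = ∑ e ∈ p.toFinset, I.len e := (List.sum_toFinset _ hp).symm
  rw [this]
  exact Finset.sum_le_sum_of_subset (Finset.subset_univ _)

theorem totalCost_toFinset_le (p : List (Fin I.m)) : I.totalCost p.toFinset ≤ I.walkCost p := by
  induction p with
  | nil => simp [totalCost]
  | cons e p ih =>
    rw [List.toFinset_cons, walkCost_cons]
    by_cases he : e ∈ p.toFinset
    · rw [Finset.insert_eq_of_mem he]; omega
    · unfold totalCost at *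
      rw [Finset.sum_insert he]; omega

theorem totalCost_union_le (S T : Finset (Fin I.m)) :
    I.totalCost (S ∪ T) ≤ I.totalCost S + I.totalCost T := by
  unfold totalCost
  rw [← Finset.sum_union_inter]
  omega

theorem totalCost_mono {S T : Finset (Fin I.m)} (h : S ⊆ T) : I.totalCost S ≤ I.totalCost T :=
  Finset.sum_le_sum_of_subset h

end SLProblem

/-! ### The approximation scheme `minCostPath` -/

namespace SLProblem

variable {I : SLProblem}

/-- `P` stores a walk from `u` to `v`. -/
structure Path.Valid (P : Path I) (u v : Fin I.n) : Prop where
  isWalk : I.IsWalk Finset.univ u v P.edges.reverse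
  len_eq : P.len = I.walkLen P.edges
  cost_eq : P.cost = I.walkCost P.edges

/-- All edges of `q` have a scaled cost, and these add up to at most `b`. -/
def ScaledLE (σ : Fin I.m → Option ℕ) (q : List (Fin I.m)) (b : ℕ) : Prop :=
  (∀ e ∈ q, σ e ≠ none) ∧ (q.map fun e => (σ e).getD 0).sum ≤ b

theorem scaledLE_cons {σ : Fin I.m → Option ℕ} {e : Fin I.m} {q : List (Fin I.m)} {b : ℕ} :
    ScaledLE σ (e :: q) b ↔ ∃ s, σ e = some s ∧ s ≤ b ∧ ScaledLE σ q (b - s) := by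
  unfold ScaledLE
  constructor
  · rintro ⟨h1, h2⟩
    obtain ⟨s, hs⟩ := Option.ne_none_iff_exists'.1 (h1 e (by simp))
    simp only [List.map_cons, List.sum_cons, hs, Option.getD_some] at h2
    exact ⟨s, hs, by omega, fun f hf => h1 f (by simp [hf]), by omega⟩
  · rintro ⟨s, hs, hsb, h1, h2⟩
    refine ⟨fun f hf => ?_, ?_⟩
    · rcases List.mem_cons.1 hf with rfl | hf
      · simp [hs]
      · exact h1 f hf
    · simp only [List.map_cons, List.sum_cons, hs, Option.getD_some]
      omega

theorem scaledLE_reverse {σ : Fin I.m → Option ℕ} {q : List (Fin I.m)} {b : ℕ} :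
    ScaledLE σ q.reverse b ↔ ScaledLE σ q b := by
  simp [ScaledLE, List.sum_reverse]

/-- What an entry `P` of `walkTable` at `(x, b)` after `t` rounds satisfies. -/
structure TableEntry (σ : Fin I.m → Option ℕ) (u x : Fin I.n) (t b : ℕ) (P : Path I) : Prop where
  valid : P.Valid u x
  length_le : P.edges.length ≤ t
  scaled : ScaledLE σ P.edges b

/-- One step of the inner loop of `walkTable`. -/
def relax (σ : Fin I.m → Option ℕ) (B : ℕ) (f : Fin I.n × Fin (B + 1) → Option (Path I))
    (xb : Fin I.n × Fin (B + 1)) (best : Option (Path I)) (e : Fin I.m) :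
    Timed (Option (Path I)) := do
  let y ← Timed.get I.tgt e
  if ← Timed.eq y xb.1 then
    match ← Timed.get σ e with
    | none => pure best
    | some s => do
      if ← Timed.le s xb.2.val then
        let b ← Timed.finSub xb.2 s
        let z ← Timed.get I.src e
        match ← Timed.get f (z, b) with
        | none => pure best
        | some p => do
          let le ← Timed.get I.len e
          let ce ← Timed.get I.cost e
          let l ← Timed.add p.len le
          let c ← Timed.add p.cost ce
          Timed.keepMin Path.len best ⟨e :: p.edges, l, c⟩
      else pure best
  else pure best

theorem walkTable_succ (σ : Fin I.m → Option ℕ) (B : ℕ) (u : Fin I.n) (t : ℕ) :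
    I.walkTable σ B u (t + 1) = (do
      let f ← I.walkTable σ B u t
      Timed.table fun xb => do
        let old ← Timed.get f xb
        Timed.fold (List.finRange I.m) old (relax σ B f xb)) := rfl

theorem relax_val (σ : Fin I.m → Option ℕ) (B : ℕ) (f : Fin I.n × Fin (B + 1) → Option (Path I))
    (xb : Fin I.n × Fin (B + 1)) (best : Option (Path I)) (e : Fin I.m) :
    (relax σ B f xb best e).val = best ∨
    ∃ s p, I.tgt e = xb.1 ∧ σ e = some s ∧ s ≤ xb.2.val ∧
      f (I.src e, (Timed.finSub xb.2 s).val) = some p ∧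
      (relax σ B f xb best e).val =
        (Timed.keepMin Path.len best ⟨e :: p.edges, p.len + I.len e, p.cost + I.cost e⟩).val := by
  unfold relax
  by_cases h1 : I.tgt e = xb.1
  · cases hs : σ e with
    | none => simp [h1, hs]
    | some s =>
      by_cases h2 : s ≤ xb.2.val
      · cases hp : f (I.src e, (Timed.finSub xb.2 s).val) with
        | none => simp [h1, h2, hs, hp]
        | some p =>
          right
          refine ⟨s, p, h1, rfl, h2, hp, ?_⟩
          simp [h1, h2, hs, hp]
      · simp [h1, h2, hs]
  · simp [h1]

theorem relax_val_of_some {σ : Fin I.m → Option ℕ} {B : ℕ}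
    {f : Fin I.n × Fin (B + 1) → Option (Path I)} {xb : Fin I.n × Fin (B + 1)}
    (best : Option (Path I)) {e : Fin I.m} {s : ℕ} {p : Path I} (h1 : I.tgt e = xb.1)
    (hs : σ e = some s) (h2 : s ≤ xb.2.val)
    (hp : f (I.src e, (Timed.finSub xb.2 s).val) = some p) :
    (relax σ B f xb best e).val =
      (Timed.keepMin Path.len best ⟨e :: p.edges, p.len + I.len e, p.cost + I.cost e⟩).val := by
  simp [relax, h1, h2, hs, hp]

theorem walkTable_sound (σ : Fin I.m → Option ℕ) (B : ℕ) (u : Fin I.n) (t : ℕ)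
    (xb : Fin I.n × Fin (B + 1)) (P : Path I) (hP : (I.walkTable σ B u t).val xb = some P) :
    TableEntry σ u xb.1 t xb.2.val P := by
  induction t generalizing xb P with
  | zero =>
    by_cases h : xb.1 = u
    · simp only [walkTable, Timed.val_table, Timed.val_bind, Timed.val_eq, h, decide_true,
        if_true, Timed.val_pure, Option.some.injEq] at hP
      subst hP
      exact ⟨⟨h.symm, rfl, rfl⟩, le_rfl, by simp [ScaledLE]⟩
    · simp [walkTable, h] at hP
  | succ t ih =>
    rw [walkTable_succ] at hP
    simp only [Timed.val_bind, Timed.val_table, Timed.val_get] at hP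
    revert hP P
    refine Timed.fold_inv
      (fun best => ∀ P, best = some P → TableEntry σ u xb.1 (t + 1) xb.2.val P) ?_ ?_
    · intro P hP
      obtain ⟨h1, h2, h3⟩ := ih xb P hP
      exact ⟨h1, h2.trans (Nat.le_succ t), h3⟩
    · intro best e _ hbest P hP
      rcases relax_val σ B (I.walkTable σ B u t).val xb best e with h | ⟨s, p, h1, hs, h2, hp, h⟩
      · exact hbest P (h.symm.trans hP)
      · rw [h] at hP
        rcases Timed.val_keepMin Path.len best
            ⟨e :: p.edges, p.len + I.len e, p.cost + I.cost e⟩ with h' | ⟨b, rfl, h'⟩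
        · rw [h'] at hP
          obtain rfl := Option.some.inj hP
          obtain ⟨⟨hw, hl, hc⟩, hlen, hsc⟩ := ih _ _ hp
          refine ⟨⟨?_, ?_, ?_⟩, ?_, ?_⟩
          · simp only [List.reverse_cons]
            exact isWalk_concat.2 ⟨hw, Finset.mem_univ _, h1⟩
          · simp [hl, add_comm]
          · simp [hc, add_comm]
          · simpa using hlen
          · exact scaledLE_cons.2 ⟨s, hs, h2, hsc⟩
        · rw [h'] at hP
          exact hbest P hP

/-- Peel off the last edge `e` of `q`. The rest has scaled cost at most `b - s`, so the entry it
competes for is no longer than it, and relaxing `e` gives an entry no longer than `q`. Later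
relaxations only shorten entries. -/
theorem walkTable_complete (σ : Fin I.m → Option ℕ) (B : ℕ) (u : Fin I.n) (t : ℕ)
    (xb : Fin I.n × Fin (B + 1)) (q : List (Fin I.m))
    (hq : I.IsWalk Finset.univ u xb.1 q) (hqt : q.length ≤ t) (hqb : ScaledLE σ q xb.2.val) :
    Timed.KeyLE Path.len (I.walkLen q) ((I.walkTable σ B u t).val xb) := by
  have hpres : ∀ t (xb : Fin I.n × Fin (B + 1)) c e best,
      Timed.KeyLE Path.len c best →
      Timed.KeyLE Path.len c (relax σ B (I.walkTable σ B u t).val xb best e).val := by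
    intro t xb c e best hbest
    rcases relax_val σ B (I.walkTable σ B u t).val xb best e with h | ⟨s, p, -, -, -, -, h⟩
    · rw [h]; exact hbest
    · rw [h]; exact Timed.keyLE_keepMin_old _ _ hbest
  -- The empty walk is entered at the start, and each round begins with the old entry, so it never
  -- gets lost.
  have hnil : ∀ t (b : Fin (B + 1)),
      Timed.KeyLE Path.len 0 ((I.walkTable σ B u t).val (u, b)) := by
    intro t b
    induction t with
    | zero => exact ⟨⟨[], 0, 0⟩, by simp [walkTable], le_rfl⟩
    | succ t ih =>
      rw [walkTable_succ]
      simp only [Timed.val_bind, Timed.val_table, Timed.val_get]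
      exact Timed.fold_inv (Timed.KeyLE Path.len 0) ih fun best e _ h => hpres t _ 0 e best h
  induction t generalizing xb q with
  | zero =>
    obtain rfl := List.length_eq_zero_iff.1 (Nat.le_zero.1 hqt)
    obtain ⟨x, b⟩ := xb
    obtain rfl : u = x := hq
    exact hnil 0 b
  | succ t ih =>
    rcases List.eq_nil_or_concat q with rfl | ⟨q', e, rfl⟩
    · obtain ⟨x, b⟩ := xb
      obtain rfl : u = x := hq
      exact hnil (t + 1) b
    · rw [List.concat_eq_append] at *
      obtain ⟨hw, -, ht⟩ := isWalk_concat.1 hq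
      rw [← scaledLE_reverse, List.reverse_append, List.reverse_singleton, List.singleton_append,
        scaledLE_cons] at hqb
      obtain ⟨s, hs, hsb, hsc⟩ := hqb
      rw [scaledLE_reverse] at hsc
      obtain ⟨p, hp, hpl⟩ := ih (I.src e, (Timed.finSub xb.2 s).val) q' hw
        (by simpa using hqt) hsc
      rw [walkTable_succ]
      simp only [Timed.val_bind, Timed.val_table, Timed.val_get]
      refine Timed.fold_reach (fun _ => True) _ trivial (fun _ _ _ _ => trivial)
        (fun best f _ _ h => hpres t xb _ f best h) (List.mem_finRange e) fun best _ => ?_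
      rw [relax_val_of_some best ht hs hsb hp]
      refine Timed.keyLE_keepMin_new _ _ ?_
      simpa using hpl

/-- For `c₀ = 0` the division by zero gives scaled cost 0, which is right: only edges of cost 0 are
kept. -/
theorem scaledCost_val (N c₀ : ℕ) (e : Fin I.m) :
    (I.scaledCost N c₀).val e =
      if I.cost e ≤ c₀ then some (I.cost e * (I.n * N) / c₀) else none := by
  by_cases h : I.cost e ≤ c₀ <;> simp [scaledCost, h]

/-- The body of `minCostPath`, for one guess `c₀` of the largest edge cost. -/
def guessPath (N : ℕ) (u v : Fin I.n) (D B : ℕ) (best : Option (Path I)) (c₀ : ℕ) :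
    Timed (Option (Path I)) := do
  let σ ← I.scaledCost N c₀
  let f ← I.walkTable σ B u I.n
  Timed.fold (List.finRange (B + 1)) best fun best b => do
    match ← Timed.get f (v, b) with
    | none => pure best
    | some p => do
      if ← Timed.le p.len D then Timed.keepMin Path.cost best p else pure best

theorem minCostPath_eq (N : ℕ) (u v : Fin I.n) (D : ℕ) :
    I.minCostPath N u v D = (do
      let nn ← Timed.mul I.n I.n
      let B ← Timed.mul nn N
      let best ← guessPath N u v D B none 0
      Timed.fold (List.finRange I.m) best fun best e => do
        let c₀ ← Timed.get I.cost e
        guessPath N u v D B best c₀) := rfl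

/-- What a path returned by `minCostPath` satisfies. -/
structure Path.Good (P : Path I) (u v : Fin I.n) (D : ℕ) : Prop where
  valid : P.Valid u v
  len_le : P.len ≤ D

theorem guessPath_sound {N : ℕ} {u v : Fin I.n} {D B : ℕ} {best : Option (Path I)} {c₀ : ℕ}
    (hbest : ∀ P, best = some P → P.Good u v D) (P : Path I)
    (hP : (guessPath N u v D B best c₀).val = some P) : P.Good u v D := by
  revert P
  refine Timed.fold_inv (fun best : Option (Path I) => ∀ P, best = some P → P.Good u v D) hbest ?_
  intro best b _ hbest P hP
  cases hf : (I.walkTable (I.scaledCost N c₀).val B u I.n).val (v, b) with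
  | none =>
    simp only [Timed.val_bind, Timed.val_get, hf, Timed.val_pure] at hP
    exact hbest P hP
  | some p =>
    have hp := walkTable_sound _ _ _ _ _ _ hf
    by_cases hD : p.len ≤ D
    · simp only [Timed.val_bind, Timed.val_get, hf, Timed.val_le, hD, decide_true, if_true] at hP
      rcases Timed.val_keepMin Path.cost best p with h | ⟨b, rfl, h⟩
      · rw [h] at hP
        obtain rfl := Option.some.inj hP
        exact ⟨hp.valid, hD⟩
      · rw [h] at hP
        exact hbest P hP
    · simp [hf, hD] at hP
      exact hbest P hP

theorem guessPath_old {N : ℕ} {u v : Fin I.n} {D B : ℕ} {best : Option (Path I)} {c₀ c : ℕ}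
    (hbest : Timed.KeyLE Path.cost c best) :
    Timed.KeyLE Path.cost c (guessPath N u v D B best c₀).val := by
  refine Timed.fold_inv (Timed.KeyLE Path.cost c) hbest ?_
  intro best b _ hbest
  cases hf : (I.walkTable (I.scaledCost N c₀).val B u I.n).val (v, b) with
  | none => simpa [hf] using hbest
  | some p =>
    by_cases hD : p.len ≤ D
    · simpa [hf, hD] using Timed.keyLE_keepMin_old Path.cost p hbest
    · simpa [hf, hD] using hbest

/-- The entry at `(v, b)` is no longer than `q`, so it passes the test against `D`. It may be a
different walk, so its true cost is controlled only through its scaled cost; this is the purpose of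
`hc`. -/
theorem guessPath_new {N : ℕ} {u v : Fin I.n} {D B : ℕ} {best : Option (Path I)} {c₀ c : ℕ}
    {q : List (Fin I.m)} (hq : I.IsWalk Finset.univ u v q) (hqn : q.length ≤ I.n)
    (hqD : I.walkLen q ≤ D) {b : ℕ} (hb : b ≤ B)
    (hqb : ScaledLE (I.scaledCost N c₀).val q b)
    (hc : ∀ p, ScaledLE (I.scaledCost N c₀).val p b → p.length ≤ I.n → I.walkCost p ≤ c) :
    Timed.KeyLE Path.cost c (guessPath N u v D B best c₀).val := by
  have hstep : ∀ best (b : Fin (B + 1)), Timed.KeyLE Path.cost c best → Timed.KeyLE Path.cost c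
      (do
        match ← Timed.get (I.walkTable (I.scaledCost N c₀).val B u I.n).val (v, b) with
        | none => pure best
        | some p => do
          if ← Timed.le p.len D then Timed.keepMin Path.cost best p else pure best :
        Timed (Option (Path I))).val := by
    intro best b hbest
    cases hf : (I.walkTable (I.scaledCost N c₀).val B u I.n).val (v, b) with
    | none => simpa [hf] using hbest
    | some p =>
      by_cases hD : p.len ≤ D
      · simpa [hf, hD] using Timed.keyLE_keepMin_old Path.cost p hbest
      · simpa [hf, hD] using hbest
  refine Timed.fold_reach (fun _ => True) _ trivial (fun _ _ _ _ => trivial)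
    (fun best b _ _ h => hstep best b h)
    (List.mem_finRange (⟨b, Nat.lt_succ_of_le hb⟩ : Fin (B + 1))) fun best _ => ?_
  obtain ⟨P, hP, hPl⟩ := walkTable_complete (I.scaledCost N c₀).val B u I.n
    (v, ⟨b, Nat.lt_succ_of_le hb⟩) q hq hqn hqb
  have hS := walkTable_sound _ _ _ _ _ _ hP
  have hD : P.len ≤ D := hPl.trans hqD
  simp only [Timed.val_bind, Timed.val_get, hP, Timed.val_le, hD, decide_true, if_true]
  refine Timed.keyLE_keepMin_new _ _ ?_
  rw [hS.valid.cost_eq]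
  exact hc _ hS.scaled hS.length_le

theorem minCostPath_sound {N : ℕ} {u v : Fin I.n} {D : ℕ} {P : Path I}
    (hP : (I.minCostPath N u v D).val = some P) : P.Good u v D := by
  rw [minCostPath_eq] at hP
  have h : ∀ P : Path I, _ = some P → P.Good u v D :=
    Timed.fold_inv (fun best : Option (Path I) => ∀ P, best = some P → P.Good u v D)
      (l := List.finRange I.m) (b := (guessPath N u v D (I.n * I.n * N) none 0).val)
      (f := fun best e => do
        let c₀ ← Timed.get I.cost e
        guessPath N u v D (I.n * I.n * N) best c₀)
      (guessPath_sound (by simp)) fun best e _ h => guessPath_sound h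
  exact h P hP

/-- The scaling lemma: a list of at most `n` edges whose scaled cost is at most that of `q`
costs at most `(1 + 1/N)` times as much as `q`. -/
theorem walkCost_le_of_scaledLE {N c₀ : ℕ} {q p : List (Fin I.m)}
    (hmax : c₀ = 0 ∨ ∃ e ∈ q, I.cost e = c₀)
    (hp : ScaledLE (I.scaledCost N c₀).val p
      (q.map fun e => I.cost e * (I.n * N) / c₀).sum) (hpn : p.length ≤ I.n) :
    N * I.walkCost p ≤ (N + 1) * I.walkCost q := by
  obtain ⟨hp1, hp2⟩ := hp
  have hpc : ∀ e ∈ p, I.cost e ≤ c₀ := by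
    intro e he
    by_contra h
    exact hp1 e he (by rw [scaledCost_val, if_neg h])
  rcases Nat.eq_zero_or_pos c₀ with h0 | h0
  · have : I.walkCost p = 0 := by
      unfold walkCost
      rw [List.sum_eq_zero_iff]
      intro x hx
      obtain ⟨e, he, rfl⟩ := List.mem_map.1 hx
      have := hpc e he
      omega
    simp [this]
  · obtain ⟨e₀, he₀, hc₀⟩ : ∃ e ∈ q, I.cost e = c₀ := by
      rcases hmax with h | h
      · omega
      · exact h
    have hn : 0 < I.n := lt_of_le_of_lt (Nat.zero_le _) (I.src e₀).isLt
    -- Undoing the scaling: rounding down loses less than one unit, worth `c₀`, per edge.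
    have h1 : ∀ l : List (Fin I.m), (∀ e ∈ l, I.cost e ≤ c₀) →
        I.walkCost l * (I.n * N) ≤
          c₀ * ((l.map fun e => ((I.scaledCost N c₀).val e).getD 0).sum + l.length) := by
      intro l
      induction l with
      | nil => simp
      | cons e l ih =>
        intro hl
        have h2 := ih fun e he => hl e (by simp [he])
        have h3 : I.cost e * (I.n * N) ≤ c₀ * (I.cost e * (I.n * N) / c₀ + 1) :=
          (Nat.lt_mul_div_succ _ h0).le
        simp only [List.map_cons, List.sum_cons, List.length_cons, walkCost_cons, scaledCost_val,
          if_pos (hl e (by simp)), Option.getD_some] at h2 ⊢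
        nlinarith
    have h2 : ∀ l : List (Fin I.m),
        c₀ * (l.map fun e => I.cost e * (I.n * N) / c₀).sum ≤ I.walkCost l * (I.n * N) := by
      intro l
      induction l with
      | nil => simp
      | cons e l ih =>
        have h3 := Nat.mul_div_le (I.cost e * (I.n * N)) c₀
        simp only [List.map_cons, List.sum_cons, walkCost_cons]
        nlinarith
    -- The guess is attained on `q`. So the total rounding error `c₀ * n` is at most a fraction `1 /
    -- N` of `walkCost q * (n * N)`.
    have h3 : c₀ ≤ I.walkCost q := by
      rw [← hc₀]
      exact List.single_le_sum (by simp) _ (List.mem_map_of_mem he₀)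
    have h4 := h1 p hpc
    have h5 := h2 q
    have h6 : I.walkCost p * (I.n * N) ≤ I.walkCost q * (I.n * N) + I.walkCost q * I.n := by
      calc I.walkCost p * (I.n * N) ≤ c₀ * ((q.map fun e => I.cost e * (I.n * N) / c₀).sum + I.n) :=
            h4.trans (Nat.mul_le_mul_left _ (Nat.add_le_add hp2 hpn))
        _ = c₀ * (q.map fun e => I.cost e * (I.n * N) / c₀).sum + c₀ * I.n := Nat.mul_add _ _ _
        _ ≤ _ := Nat.add_le_add h5 (Nat.mul_le_mul_right _ h3)
    have h7 : I.n * (N * I.walkCost p) ≤ I.n * ((N + 1) * I.walkCost q) := by nlinarith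
    exact Nat.le_of_mul_le_mul_left h7 hn

/-- After cutting out cycles at most `n` edges remain, and the largest cost among them is one of the
guesses. -/
theorem minCostPath_complete {N : ℕ} (hN : 0 < N) {u v : Fin I.n} {D : ℕ} {q : List (Fin I.m)}
    (hq : I.IsWalk Finset.univ u v q) (hqD : I.walkLen q ≤ D) :
    ∃ P, (I.minCostPath N u v D).val = some P ∧ N * P.cost ≤ (N + 1) * I.walkCost q := by
  obtain ⟨q', hq', hsub, hnd⟩ := hq.exists_nodup
  have hlen := length_le_of_nodup hnd
  have hD' := (walkLen_sublist hsub).trans hqD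
  suffices h : Timed.KeyLE Path.cost ((N + 1) * I.walkCost q' / N)
      (I.minCostPath N u v D).val by
    obtain ⟨P, hP, hc⟩ := h
    refine ⟨P, hP, ?_⟩
    rw [Nat.le_div_iff_mul_le hN, mul_comm] at hc
    exact hc.trans (Nat.mul_le_mul_left _ (walkCost_sublist hsub))
  have key : ∀ c₀ best, (c₀ = 0 ∨ ∃ e ∈ q', I.cost e = c₀) → (∀ e ∈ q', I.cost e ≤ c₀) →
      Timed.KeyLE Path.cost ((N + 1) * I.walkCost q' / N)
        (guessPath N u v D (I.n * I.n * N) best c₀).val := by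
    intro c₀ best h1 h2
    have hs : ∀ l : List (Fin I.m), (∀ e ∈ l, I.cost e ≤ c₀) →
        (l.map fun e => ((I.scaledCost N c₀).val e).getD 0).sum =
          (l.map fun e => I.cost e * (I.n * N) / c₀).sum := by
      intro l hl
      congr 1
      refine List.map_congr_left fun e he => ?_
      rw [scaledCost_val, if_pos (hl e he), Option.getD_some]
    -- At most `n` edges of scaled cost at most `n * N` each: this determines the width of the
    -- table.
    have hb : (q'.map fun e => I.cost e * (I.n * N) / c₀).sum ≤ I.n * I.n * N := by
      have : (q'.map fun e => I.cost e * (I.n * N) / c₀).sum ≤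
          (q'.map fun e => I.cost e * (I.n * N) / c₀).length • (I.n * N) := by
        refine List.sum_le_card_nsmul _ _ fun x hx => ?_
        obtain ⟨e, he, rfl⟩ := List.mem_map.1 hx
        refine Nat.div_le_of_le_mul ?_
        exact Nat.mul_le_mul_right _ (h2 e he)
      refine this.trans ?_
      rw [List.length_map, smul_eq_mul, mul_assoc]
      exact Nat.mul_le_mul_right _ hlen
    refine guessPath_new hq' hlen hD' hb ⟨?_, (hs q' h2).le⟩ ?_
    · intro e he
      rw [scaledCost_val, if_pos (h2 e he)]
      simp
    · intro p hp hpn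
      rw [Nat.le_div_iff_mul_le hN, mul_comm]
      exact walkCost_le_of_scaledLE h1 hp hpn
  rw [minCostPath_eq]
  simp only [Timed.val_bind, Timed.val_mul]
  -- The empty walk has no largest edge; the extra guess `0` takes care of it, even in a graph
  -- without edges.
  by_cases h : q' = []
  · refine Timed.fold_inv (Timed.KeyLE Path.cost _) ?_ fun best e _ hb => guessPath_old hb
    exact key 0 none (Or.inl rfl) (by simp [h])
  · have hne : q'.toFinset.Nonempty := by
      simpa using h
    obtain ⟨e, he, hmax⟩ := Finset.exists_max_image q'.toFinset I.cost hne
    refine Timed.fold_reach (fun _ => True) (Timed.KeyLE Path.cost _) trivial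
      (fun _ _ _ _ => trivial) (fun best e _ _ hb => guessPath_old hb) (List.mem_finRange e)
      fun best _ => ?_
    exact key _ best (Or.inr ⟨e, by simpa using he, rfl⟩) fun f hf => hmax f (by simpa using hf)

end SLProblem

/-! ### Decomposing an optimal out-tree -/

namespace SLProblem

variable {I : SLProblem}

/-- `Spans M v δ K c`: some out-tree with root `v` and cost `c` reaches every terminal `t ∈ K`
along a walk of length at most `δ t / M`.  Out-trees are built from single vertices by prepending
an edge and by joining at the root. -/
inductive Spans (I : SLProblem) (M : ℕ) :
    Fin I.n → (Fin I.n → ℤ) → Finset (Fin I.n) → ℕ → Prop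
  | nil (v : Fin I.n) (δ : Fin I.n → ℤ) : Spans I M v δ ∅ 0
  | here (v : Fin I.n) (δ : Fin I.n → ℤ) : 0 ≤ δ v → Spans I M v δ {v} 0
  | edge (e : Fin I.m) (v : Fin I.n) (δ : Fin I.n → ℤ) (K : Finset (Fin I.n)) (c : ℕ) :
      I.src e = v → Spans I M (I.tgt e) (fun u => δ u - M * I.len e) K c →
      Spans I M v δ K (I.cost e + c)
  | join (v : Fin I.n) (δ : Fin I.n → ℤ) (K₁ K₂ : Finset (Fin I.n)) (c₁ c₂ : ℕ) :
      Disjoint K₁ K₂ → Spans I M v δ K₁ c₁ → Spans I M v δ K₂ c₂ →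
      Spans I M v δ (K₁ ∪ K₂) (c₁ + c₂)

namespace Spans

variable {M : ℕ}

/-- Lets the recursion use the larger budgets that result from subtracting only `N` times the length
of a path. -/
theorem mono_budget {v : Fin I.n} {δ δ' : Fin I.n → ℤ} {K : Finset (Fin I.n)} {c : ℕ}
    (h : Spans I M v δ K c) (hδ : ∀ u, δ u ≤ δ' u) : Spans I M v δ' K c := by
  induction h generalizing δ' with
  | nil v δ => exact nil v δ'
  | here v δ h => exact here v δ' (h.trans (hδ v))
  | edge e v δ K c he _ ih =>
    exact edge e v δ' K c he (ih fun u => Int.sub_le_sub_right (hδ u) _)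
  | join v δ K₁ K₂ c₁ c₂ hd _ _ ih₁ ih₂ => exact join v δ' K₁ K₂ c₁ c₂ hd (ih₁ hδ) (ih₂ hδ)

/-- Edges that served only dropped terminals are kept and still paid for, so `c` does not change. -/
theorem subset {v : Fin I.n} {δ : Fin I.n → ℤ} {K K' : Finset (Fin I.n)} {c : ℕ}
    (h : Spans I M v δ K c) (hK : K' ⊆ K) : Spans I M v δ K' c := by
  induction h generalizing K' with
  | nil v δ =>
    rw [Finset.subset_empty.1 hK]
    exact nil v δ
  | here v δ h =>
    rcases Finset.subset_singleton_iff.1 hK with rfl | rfl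
    · exact nil v δ
    · exact here v δ h
  | edge e v δ K c he _ ih => exact edge e v δ K' c he (ih hK)
  | join v δ K₁ K₂ c₁ c₂ hd _ _ ih₁ ih₂ =>
    have := join v δ (K' ∩ K₁) (K' ∩ K₂) c₁ c₂
      (hd.mono Finset.inter_subset_right Finset.inter_subset_right)
      (ih₁ Finset.inter_subset_right) (ih₂ Finset.inter_subset_right)
    rwa [← Finset.inter_union_distrib_left, Finset.inter_eq_left.2 hK] at this

theorem exists_walk {v : Fin I.n} {δ : Fin I.n → ℤ} {K : Finset (Fin I.n)} {c : ℕ}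
    (h : Spans I M v δ K c) {t : Fin I.n} (ht : t ∈ K) :
    ∃ p, I.IsWalk Finset.univ v t p ∧ (M * I.walkLen p : ℤ) ≤ δ t ∧ I.walkCost p ≤ c := by
  induction h with
  | nil v δ => simp at ht
  | here v δ h =>
    obtain rfl := Finset.mem_singleton.1 ht
    exact ⟨[], rfl, by simpa using h, by simp⟩
  | edge e v δ K c he _ ih =>
    obtain ⟨p, hp, hl, hc⟩ := ih ht
    refine ⟨e :: p, ⟨Finset.mem_univ _, he, hp⟩, ?_, ?_⟩
    · rw [walkLen_cons]
      push_cast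
      linarith
    · rw [walkCost_cons]
      omega
  | join v δ K₁ K₂ c₁ c₂ hd _ _ ih₁ ih₂ =>
    rcases Finset.mem_union.1 ht with ht | ht
    · obtain ⟨p, hp, hl, hc⟩ := ih₁ ht
      exact ⟨p, hp, hl, by omega⟩
    · obtain ⟨p, hp, hl, hc⟩ := ih₂ ht
      exact ⟨p, hp, hl, by omega⟩

/-- Splitting off pieces with between `s` and `2 s` terminals from an out-tree, bottom-up, leaves a
residual out-tree with fewer than `s` terminals. -/
theorem exists_residual {s : ℕ} (hs : 1 ≤ s) {a f θ C : ℝ} (ha : 0 ≤ a) {r : Fin I.n}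
    {δ₀ : Fin I.n → ℤ} {K₀ : Finset (Fin I.n)}
    (H : ∀ Q w K' c', I.IsWalk Finset.univ r w Q → K' ⊆ K₀ → K'.Nonempty → K'.card ≤ 2 * s →
      Spans I M w (fun u => δ₀ u - M * I.walkLen Q) K' c' →
      K'.card * θ ≤ a * I.walkCost Q + f * c')
    {w : Fin I.n} {δ : Fin I.n → ℤ} {K : Finset (Fin I.n)} {c : ℕ} (h : Spans I M w δ K c)
    {Q : List (Fin I.m)} (hQ : I.IsWalk Finset.univ r w Q)
    (hδ : δ = fun u => δ₀ u - M * I.walkLen Q) (hC : (I.walkCost Q + c : ℝ) ≤ C) (hK : K ⊆ K₀) :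
    ∃ K' c', K' ⊆ K ∧ K'.card < s ∧ c' ≤ c ∧ Spans I M w δ K' c' ∧
      s * (K.card - K'.card) * θ ≤ (K.card - K'.card) * (a * C) + s * (f * (c - c')) := by
  -- The cutting step: a remainder with at most `2 * s` terminals is kept if it has fewer than `s`.
  -- Otherwise it is detached as one piece and charged through `H`, which leaves the empty tree.
  have finish : ∀ {w : Fin I.n} {δ : Fin I.n → ℤ} {K : Finset (Fin I.n)} {c : ℕ}
      {Q : List (Fin I.m)}, I.IsWalk Finset.univ r w Q →
      (δ = fun u => δ₀ u - M * I.walkLen Q) → (I.walkCost Q + c : ℝ) ≤ C → K ⊆ K₀ →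
      (∃ K' c', K' ⊆ K ∧ K'.card ≤ 2 * s ∧ c' ≤ c ∧ Spans I M w δ K' c' ∧
        s * (K.card - K'.card) * θ ≤ (K.card - K'.card) * (a * C) + s * (f * (c - c'))) →
      ∃ K' c', K' ⊆ K ∧ K'.card < s ∧ c' ≤ c ∧ Spans I M w δ K' c' ∧
        s * (K.card - K'.card) * θ ≤ (K.card - K'.card) * (a * C) + s * (f * (c - c')) := by
    intro w δ K c Q hQ hδ hC hK ⟨K', c', h1, h2, h3, h4, h5⟩
    rcases lt_or_ge K'.card s with h6 | h6
    · exact ⟨K', c', h1, h6, h3, h4, h5⟩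
    refine ⟨∅, 0, Finset.empty_subset _, hs, Nat.zero_le _, nil w δ, ?_⟩
    subst hδ
    have h7 := H Q w K' c' hQ (h1.trans hK) (Finset.card_pos.1 (by omega)) h2 h4
    have h8 : (s : ℝ) ≤ K'.card := by exact_mod_cast h6
    have h9 : (0 : ℝ) ≤ s := Nat.cast_nonneg s
    have hc : (I.walkCost Q : ℝ) ≤ C := le_trans (by linarith [(Nat.cast_nonneg c : (0 : ℝ) ≤ c)]) hC
    have h10 : a * I.walkCost Q ≤ a * C := mul_le_mul_of_nonneg_left hc ha
    have h11 : 0 ≤ a * C := le_trans (mul_nonneg ha (Nat.cast_nonneg _)) h10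
    have h12 := mul_le_mul_of_nonneg_left (h7.trans (add_le_add_left h10 _)) h9
    -- A detached piece has at least `s` terminals, so these can share the path cost: `s * (a * C) ≤
    -- K'.card * (a * C)`. This replaces counting the pieces.
    have h13 := mul_le_mul_of_nonneg_right h8 h11
    simp only [Finset.card_empty, Nat.cast_zero, sub_zero]
    linarith
  induction h generalizing Q with
  | nil v δ => exact ⟨∅, 0, subset_rfl, hs, le_rfl, nil v δ, by simp⟩
  | here v δ h =>
    refine finish hQ hδ hC hK ⟨{v}, 0, subset_rfl, ?_, le_rfl, here v δ h, by simp⟩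
    rw [Finset.card_singleton]; omega
  | edge e v δ K c he h ih =>
    -- Descending along `e` moves its cost from the subtree to the path, so `C` bounds the sum as
    -- before.
    have hC' : ((I.walkCost (Q ++ [e]) : ℕ) + c : ℝ) ≤ C := by
      rw [walkCost_append]
      push_cast [walkCost_cons, walkCost_nil] at hC ⊢
      linarith
    obtain ⟨K', c', h1, h2, h3, h4, h5⟩ := ih
      (isWalk_concat.2 ⟨he ▸ hQ, Finset.mem_univ e, rfl⟩)
      (by
        subst hδ
        funext u
        rw [walkLen_append, walkLen_cons, walkLen_nil]
        push_cast
        ring) hC' hK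
    refine ⟨K', I.cost e + c', h1, h2, by omega, edge e v δ K' c' he h4, ?_⟩
    push_cast
    linarith
  | join v δ K₁ K₂ c₁ c₂ hd _ _ ih₁ ih₂ =>
    have hC' := hC
    push_cast at hC'
    obtain ⟨K₁', c₁', h1, h2, h3, h4, h5⟩ := ih₁ hQ hδ
      (by linarith [(Nat.cast_nonneg c₂ : (0 : ℝ) ≤ c₂)]) (Finset.subset_union_left.trans hK)
    obtain ⟨K₂', c₂', h1', h2', h3', h4', h5'⟩ := ih₂ hQ hδ
      (by linarith [(Nat.cast_nonneg c₁ : (0 : ℝ) ≤ c₁)]) (Finset.subset_union_right.trans hK)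
    have hd' : Disjoint K₁' K₂' := hd.mono h1 h1'
    -- Two remainders with fewer than `s` terminals each have fewer than `2 * s` together, so at
    -- most one cut is needed.
    refine finish hQ hδ hC hK ⟨K₁' ∪ K₂', c₁' + c₂', Finset.union_subset_union h1 h1', ?_,
      by omega, join v δ _ _ _ _ hd' h4 h4', ?_⟩
    · rw [Finset.card_union_of_disjoint hd']; omega
    · rw [Finset.card_union_of_disjoint hd', Finset.card_union_of_disjoint hd]
      push_cast
      linarith

/-- If `θ` bounds the density of every small piece from below, it bounds the density of the
whole out-tree. -/
theorem density {s : ℕ} (hs : 1 ≤ s) {a f θ : ℝ} (ha : 0 ≤ a) {r : Fin I.n} {δ : Fin I.n → ℤ}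
    {K : Finset (Fin I.n)} {c : ℕ} (h : Spans I M r δ K c)
    (hf : 0 ≤ f)
    (H : ∀ Q w K' c', I.IsWalk Finset.univ r w Q → K' ⊆ K → K'.Nonempty → K'.card ≤ 2 * s →
      Spans I M w (fun u => δ u - M * I.walkLen Q) K' c' →
      K'.card * θ ≤ a * I.walkCost Q + f * c') :
    s * (K.card * θ) ≤ (K.card * a + s * f) * c := by
  obtain ⟨K', c', h1, h2, h3, h4, h5⟩ := exists_residual hs ha H h (Q := []) rfl (by simp)
    (C := c) (by simp) subset_rfl
  -- The final remainder sits at the root, so its connecting path is empty and costs nothing.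
  have h6 : K'.card * θ ≤ f * c' := by
    rcases K'.eq_empty_or_nonempty with rfl | hne
    · simpa using mul_nonneg hf (Nat.cast_nonneg c')
    · simpa using H [] r K' c' rfl h1 hne (by omega) (by simpa using h4)
  have h7 := mul_le_mul_of_nonneg_left h6 (Nat.cast_nonneg s : (0 : ℝ) ≤ s)
  have h8 : 0 ≤ (K'.card : ℝ) * (a * c) := by positivity
  linarith

/-- A family of walks in which every edge is preceded by a unique initial segment spans its ends at
the cost of the edges used. -/
theorem of_walks {K : Finset (Fin I.n)} {r : Fin I.n} {δ : Fin I.n → ℤ}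
    (W : Fin I.n → List (Fin I.m)) (hW : ∀ t ∈ K, I.IsWalk Finset.univ r t (W t))
    (hl : ∀ t ∈ K, (M * I.walkLen (W t) : ℤ) ≤ δ t)
    (hu : ∀ t ∈ K, ∀ t' ∈ K, ∀ p q e, p ++ [e] <+: W t → q ++ [e] <+: W t' → p = q) :
    ∃ c, Spans I M r δ K c ∧ c ≤ I.totalCost (K.biUnion fun t => (W t).toFinset) := by
  -- Induction on the total length of the walks. Those starting with a fixed edge `e` lose that edge
  -- and become an `edge` node, which is joined with the others.
  induction hn : ∑ t ∈ K, ((W t).length + 1) using Nat.strong_induction_on generalizing K r δ W with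
  | _ n ih =>
  by_cases hne : ∃ t ∈ K, W t ≠ []
  · obtain ⟨t₀, ht₀, hWt₀⟩ := hne
    obtain ⟨e, p₀, hep⟩ := List.exists_cons_of_ne_nil hWt₀
    have hsrc : I.src e = r := by
      have := hW t₀ ht₀
      rw [hep] at this
      exact this.2.1
    let K₁ := K.filter fun t => (W t).head? = some e
    let K₂ := K.filter fun t => ¬ (W t).head? = some e
    have hhead : ∀ t ∈ K₁, t ∈ K ∧ W t = e :: (W t).tail := by
      intro t ht
      obtain ⟨h1, h2⟩ := Finset.mem_filter.1 ht
      refine ⟨h1, ?_⟩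
      cases h : W t with
      | nil => simp [h] at h2
      | cons f l => simp [h] at h2; simp [h2]
    have ht₁ : t₀ ∈ K₁ := Finset.mem_filter.2 ⟨ht₀, by simp [hep]⟩
    have hsum : ∑ t ∈ K, ((W t).length + 1) =
        ∑ t ∈ K₁, ((W t).length + 1) + ∑ t ∈ K₂, ((W t).length + 1) :=
      (Finset.sum_filter_add_sum_filter_not K _ _).symm
    have hsub₂ : K₂ ⊆ K := Finset.filter_subset _ _
    obtain ⟨c₁, hc₁, hle₁⟩ := ih (∑ t ∈ K₁, ((W t).tail.length + 1)) (by
        have : ∑ t ∈ K₁, ((W t).tail.length + 1) < ∑ t ∈ K₁, ((W t).length + 1) := by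
          refine Finset.sum_lt_sum_of_nonempty ⟨t₀, ht₁⟩ fun t ht => ?_
          have := (hhead t ht).2
          rw [this]; simp
        omega) (K := K₁) (r := I.tgt e) (δ := fun u => δ u - M * I.len e) (fun t => (W t).tail)
      (by
        intro t ht
        have h := hW t (hhead t ht).1
        rw [(hhead t ht).2] at h
        exact h.2.2)
      (by
        intro t ht
        have h := hl t (hhead t ht).1
        rw [(hhead t ht).2, walkLen_cons] at h
        push_cast at h
        linarith)
      (by
        intro t ht t' ht' p q f hp hq
        have h1 : (e :: p) ++ [f] <+: W t := by
          rw [(hhead t ht).2]; simpa using hp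
        have h2 : (e :: q) ++ [f] <+: W t' := by
          rw [(hhead t' ht').2]; simpa using hq
        exact List.cons_injective (hu t (hhead t ht).1 t' (hhead t' ht').1 _ _ f h1 h2)) rfl
    obtain ⟨c₂, hc₂, hle₂⟩ := ih (∑ t ∈ K₂, ((W t).length + 1)) (by
        have : 0 < ∑ t ∈ K₁, ((W t).length + 1) :=
          Finset.sum_pos (fun _ _ => Nat.succ_pos _) ⟨t₀, ht₁⟩
        omega) (K := K₂) (r := r) (δ := δ) W (fun t ht => hW t (hsub₂ ht))
      (fun t ht => hl t (hsub₂ ht)) (fun t ht t' ht' => hu t (hsub₂ ht) t' (hsub₂ ht')) rfl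
    have hK : K₁ ∪ K₂ = K := Finset.filter_union_filter_not_eq _ K
    have hd : Disjoint K₁ K₂ := Finset.disjoint_filter_filter_not _ _ _
    refine ⟨I.cost e + c₁ + c₂, ?_, ?_⟩
    · rw [← hK]
      exact join r δ K₁ K₂ _ _ hd (edge e r δ K₁ c₁ hsrc hc₁) hc₂
    · set F₁ := K₁.biUnion fun t => (W t).tail.toFinset
      set F₂ := K₂.biUnion fun t => (W t).toFinset
      have prefix_of_mem : ∀ {l : List (Fin I.m)} {f : Fin I.m}, f ∈ l → ∃ p, p ++ [f] <+: l := by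
        intro l f hf
        obtain ⟨a, b, rfl⟩ := List.append_of_mem hf
        exact ⟨a, b, by simp⟩
      -- A second occurrence of `e` would be preceded by a nonempty initial segment, whereas the
      -- first is preceded by the empty one.
      have heF₁ : e ∉ F₁ := by
        intro h
        obtain ⟨t, ht, hte⟩ := Finset.mem_biUnion.1 h
        obtain ⟨p, hp⟩ := prefix_of_mem (List.mem_toFinset.1 hte)
        have h1 : (e :: p) ++ [e] <+: W t := by
          rw [(hhead t ht).2]; simpa using hp
        have h2 : [] ++ [e] <+: W t := by
          rw [(hhead t ht).2]; simp
        have := hu t (hhead t ht).1 t (hhead t ht).1 _ _ e h1 h2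
        simp at this
      -- A common edge has a common initial segment, which would make a walk of the second group
      -- start with `e` too.
      have hdF : Disjoint (insert e F₁) F₂ := by
        rw [Finset.disjoint_left]
        intro f hf hf₂
        obtain ⟨t', ht', hf₂⟩ := Finset.mem_biUnion.1 hf₂
        obtain ⟨q, hq⟩ := prefix_of_mem (List.mem_toFinset.1 hf₂)
        have hex : ∃ t ∈ K₁, ∃ p, p ++ [f] <+: W t ∧ (p ++ [f]).head? = some e := by
          rcases Finset.mem_insert.1 hf with rfl | hf
          · refine ⟨t₀, ht₁, [], ?_, rfl⟩
            rw [hep]; simp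
          · obtain ⟨t, ht, hte⟩ := Finset.mem_biUnion.1 hf
            obtain ⟨p, hp⟩ := prefix_of_mem (List.mem_toFinset.1 hte)
            refine ⟨t, ht, e :: p, ?_, rfl⟩
            rw [(hhead t ht).2]; simpa using hp
        obtain ⟨t, ht, p, hp, hpe⟩ := hex
        obtain rfl := hu t (hhead t ht).1 t' (hsub₂ ht') _ _ f hp hq
        refine (Finset.mem_filter.1 ht').2 ?_
        obtain ⟨b, hb⟩ := hq
        rw [← hb, List.head?_append, hpe]
        rfl
      have hsubF : insert e F₁ ∪ F₂ ⊆ K.biUnion fun t => (W t).toFinset := by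
        intro f hf
        rcases Finset.mem_union.1 hf with hf | hf
        · rcases Finset.mem_insert.1 hf with rfl | hf
          · exact Finset.mem_biUnion.2 ⟨t₀, ht₀, by simp [hep]⟩
          · obtain ⟨t, ht, hte⟩ := Finset.mem_biUnion.1 hf
            exact Finset.mem_biUnion.2 ⟨t, (hhead t ht).1,
              List.mem_toFinset.2 (List.mem_of_mem_tail (List.mem_toFinset.1 hte))⟩
        · obtain ⟨t, ht, hte⟩ := Finset.mem_biUnion.1 hf
          exact Finset.mem_biUnion.2 ⟨t, hsub₂ ht, hte⟩
      refine le_trans ?_ (totalCost_mono hsubF)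
      have : I.totalCost (insert e F₁ ∪ F₂) = I.cost e + I.totalCost F₁ + I.totalCost F₂ := by
        unfold totalCost
        rw [Finset.sum_union hdF, Finset.sum_insert heF₁]
      omega
  · push Not at hne
    have hK : K ⊆ {r} := by
      intro t ht
      have := hW t ht
      rw [hne t ht] at this
      exact Finset.mem_singleton.2 this.symm
    rcases Finset.subset_singleton_iff.1 hK with rfl | rfl
    · exact ⟨0, nil r δ, Nat.zero_le _⟩
    · refine ⟨0, here r δ ?_, Nat.zero_le _⟩
      have h1 := hl r (by simp)
      rw [hne r (by simp)] at h1
      simpa using h1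

end Spans

/-- Compare last edges: two edges into the same vertex coincide, and none enters the root. -/
theorem IsRootedTree.walk_unique {T : Finset (Fin I.m)} (hT : I.IsRootedTree T) {x : Fin I.n}
    {p q : List (Fin I.m)} (hp : I.IsWalk T I.root x p) (hq : I.IsWalk T I.root x q) : p = q := by
  induction p using List.reverseRecOn generalizing x q with
  | nil =>
    obtain rfl : I.root = x := hp
    rcases List.eq_nil_or_concat q with rfl | ⟨q', f, rfl⟩
    · rfl
    · rw [List.concat_eq_append] at hq
      obtain ⟨-, h1, h2⟩ := isWalk_concat.1 hq
      exact absurd h2 (hT.1 f h1)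
  | append_singleton p e ih =>
    obtain ⟨h1, h2, h3⟩ := isWalk_concat.1 hp
    rcases List.eq_nil_or_concat q with rfl | ⟨q', f, rfl⟩
    · obtain rfl : I.root = x := hq
      exact absurd h3 (hT.1 e h2)
    · rw [List.concat_eq_append] at hq ⊢
      obtain ⟨h4, h5, h6⟩ := isWalk_concat.1 hq
      obtain rfl := hT.2.1 e h2 f h5 (h3.trans h6.symm)
      rw [ih h1 h4]

/-- In an out-tree the part of a walk before an edge `e` is a walk from the root to the source of
`e`, hence determined by `e`. So `Spans.of_walks` applies. -/
theorem IsFeasible.spans {T : Finset (Fin I.m)} (hT : I.IsFeasible T) (M : ℕ) :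
    ∃ c, Spans I M I.root (fun u => M * I.d u) I.R c ∧ c ≤ I.totalCost T := by
  have hex : ∀ v, ∃ p, v ∈ I.R → I.IsWalk T I.root v p ∧ I.walkLen p ≤ I.d v := by
    intro v
    by_cases hv : v ∈ I.R
    · obtain ⟨p, hp, hl⟩ := hT.2 v hv
      rw [one_mul, Nat.cast_le] at hl
      exact ⟨p, fun _ => ⟨hp, hl⟩⟩
    · exact ⟨[], fun h => absurd h hv⟩
  choose W hW using hex
  obtain ⟨c, hc, hle⟩ := Spans.of_walks (M := M) (K := I.R) (r := I.root)
    (δ := fun u => M * I.d u) W (fun t ht => (hW t ht).1.univ)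
    (fun t ht => by exact_mod_cast Nat.mul_le_mul_left M (hW t ht).2)
    (by
      rintro t ht t' ht' p q e ⟨a, ha⟩ ⟨b, hb⟩
      have h1 := (hW t ht).1
      have h2 := (hW t' ht').1
      rw [← ha] at h1
      rw [← hb] at h2
      obtain ⟨w, h1, -⟩ := isWalk_append.1 h1
      obtain ⟨w', h2, -⟩ := isWalk_append.1 h2
      exact hT.1.walk_unique (isWalk_concat.1 h1).1 (isWalk_concat.1 h2).1)
  refine ⟨c, hc, hle.trans (totalCost_mono ?_)⟩
  intro e he
  obtain ⟨t, ht, hte⟩ := Finset.mem_biUnion.1 he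
  exact (hW t ht).1.mem e (List.mem_toFinset.1 hte)

end SLProblem

/-! ### Soundness and completeness of the greedy procedure -/

namespace SLProblem

variable {I : SLProblem}

theorem addPath_val (E : Finset (Fin I.m)) (P : Path I) :
    (I.addPath E P).val = E ∪ P.edges.toFinset := by
  unfold addPath
  generalize P.edges = l
  induction l generalizing E with
  | nil => simp
  | cons e l ih =>
    rw [Timed.val_fold_cons, ih, Timed.val_insert, List.toFinset_cons, Finset.insert_union,
      Finset.union_insert]

theorem costOf_val (E : Finset (Fin I.m)) : (I.costOf E).val = I.totalCost E := by
  have h : ∀ (l : List (Fin I.m)) (b : ℕ), (Timed.fold l b fun acc e => do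
      if ← Timed.mem e E then
        let c ← Timed.get I.cost e
        Timed.add acc c
      else pure acc).val = b + (l.map fun e => if e ∈ E then I.cost e else 0).sum := by
    intro l
    induction l with
    | nil => simp
    | cons e l ih =>
      intro b
      rw [Timed.val_fold_cons, ih]
      by_cases he : e ∈ E <;> simp [he, add_assoc]
  unfold costOf
  rw [h, zero_add, totalCost, ← List.ofFn_eq_map, List.sum_ofFn, Finset.sum_ite_mem,
    Finset.univ_inter]

theorem terminalPaths_val (N : ℕ) (r : Fin I.n) (R : Finset (Fin I.n)) (δ : Fin I.n → ℤ)
    (t : Fin I.n) :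
    (I.terminalPaths N r R δ).val t =
      if t ∈ R ∧ 0 ≤ δ t then (I.minCostPath N r t ((δ t).toNat / (N + 1))).val else none := by
  by_cases h1 : t ∈ R
  · by_cases h2 : δ t < 0
    · simp [terminalPaths, h1, h2]
    · simp [terminalPaths, h1, h2, not_lt.1 h2]
  · simp [terminalPaths, h1]

theorem countPaths_val (P : Fin I.n → Option (Path I)) :
    (I.countPaths P).val = (Finset.univ.filter fun t => P t ≠ none).card := by
  have h : ∀ (l : List (Fin I.n)) (b : ℕ), (Timed.fold l b fun acc t => do
      match ← Timed.get P t with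
      | none => pure acc
      | some _ => Timed.add acc 1).val = b + (l.map fun t => if P t ≠ none then 1 else 0).sum := by
    intro l
    induction l with
    | nil => simp
    | cons e l ih =>
      intro b
      rw [Timed.val_fold_cons, ih]
      cases he : P e <;> simp [he, add_assoc]
  refine (h (List.finRange I.n) 0).trans ?_
  rw [zero_add, ← List.ofFn_eq_map, List.sum_ofFn, Finset.card_filter]

theorem mem_lengthBounds_zero (N : ℕ) : 0 ∈ (I.lengthBounds N).val := by
  simp [lengthBounds]

theorem mem_lengthBounds_pow (N : ℕ) {j : ℕ} (hj : j ≤ N * (∑ e, I.len e).size) :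
    (N + 1) ^ j / N ^ j ∈ (I.lengthBounds N).val := by
  -- The loop keeps numerator and denominator of the current power. Arbitrary starting values make
  -- the induction over the rounds work.
  have h : ∀ (l : List ℕ) (acc : List ℕ) (p q : ℕ), ∀ x ∈ acc ++
      (List.range l.length).map fun j => (p * (N + 1) ^ j) / (q * N ^ j), x ∈
      (Timed.fold l (acc, p, q) fun (s : List ℕ × ℕ × ℕ) _ => do
        let b ← Timed.div s.2.1 s.2.2
        let p' ← Timed.mul s.2.1 (N + 1)
        let q' ← Timed.mul s.2.2 N
        pure (b :: s.1, p', q')).val.1 := by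
    intro l
    induction l with
    | nil => simp
    | cons e l ih =>
      intro acc p q x hx
      rw [Timed.val_fold_cons]
      refine ih (p / q :: acc) (p * (N + 1)) (q * N) x ?_
      rw [List.length_cons, List.range_succ_eq_map, List.map_cons, List.map_map] at hx
      have : (fun j => p * (N + 1) ^ j / (q * N ^ j)) ∘ Nat.succ =
          fun j => p * (N + 1) * (N + 1) ^ j / (q * N * N ^ j) := by
        funext j
        simp only [Function.comp, pow_succ']
        congr 1 <;> ring
      rw [this] at hx
      simp only [pow_zero, mul_one, List.mem_append, List.mem_cons] at hx ⊢
      tauto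
  have hL : (Timed.fold (List.finRange I.m) 0 fun acc e => do
      let l ← Timed.get I.len e
      Timed.add acc l).val = ∑ e, I.len e := by
    have h : ∀ (l : List (Fin I.m)) (b : ℕ), (Timed.fold l b fun acc e => do
        let l ← Timed.get I.len e
        Timed.add acc l).val = b + (l.map I.len).sum := by
      intro l
      induction l with
      | nil => simp
      | cons e l ih =>
        intro b
        rw [Timed.val_fold_cons, ih]
        simp [add_assoc]
    rw [h, zero_add, ← List.ofFn_eq_map, List.sum_ofFn]
  refine List.mem_cons_of_mem 0 (h (List.range (N * Nat.size _ + 1)) [] 1 1 _ ?_)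
  rw [hL]
  simp only [one_mul, List.nil_append, List.length_range, List.mem_map, List.mem_range]
  exact ⟨j, Nat.lt_succ_of_le hj, rfl⟩

/-- Every length `x ≤ ℓ(E)` is rounded up to a length bound by a factor at most `1 + 1/N`. -/
theorem exists_lengthBound {N : ℕ} (hN : 0 < N) {x : ℕ} (hx : x ≤ ∑ e, I.len e) :
    ∃ D ∈ (I.lengthBounds N).val, x ≤ D ∧ N * D ≤ (N + 1) * x := by
  rcases Nat.eq_zero_or_pos x with rfl | hx0
  · exact ⟨0, mem_lengthBounds_zero N, le_rfl, by simp⟩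
  set s := (∑ e, I.len e).size
  -- Bernoulli's inequality: `(1 + 1/N)^N ≥ 2`.
  have htwo : 2 * N ^ N ≤ (N + 1) ^ N := by
    have h := one_add_mul_le_pow (a := (1 / N : ℝ)) (by
      have : (0 : ℝ) ≤ 1 / N := by positivity
      linarith) N
    have hN' : (0 : ℝ) < N := by exact_mod_cast hN
    rw [mul_one_div_cancel hN'.ne'] at h
    have h2 : (1 + 1 / (N : ℝ)) ^ N * N ^ N = (N + 1) ^ N := by
      rw [← mul_pow]; congr 1; field_simp
    have h3 : (2 * N ^ N : ℝ) ≤ (N + 1) ^ N := by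
      rw [← h2]
      exact mul_le_mul_of_nonneg_right (by linarith) (by positivity)
    exact_mod_cast h3
  have hlarge : x * N ^ (N * s) ≤ (N + 1) ^ (N * s) := by
    have h1 : x ≤ 2 ^ s := hx.trans (Nat.lt_size_self _).le
    calc x * N ^ (N * s) ≤ 2 ^ s * (N ^ N) ^ s := by
          rw [pow_mul]; exact Nat.mul_le_mul_right _ h1
      _ = (2 * N ^ N) ^ s := (mul_pow _ _ _).symm
      _ ≤ ((N + 1) ^ N) ^ s := Nat.pow_le_pow_left htwo s
      _ = _ := (pow_mul _ _ _).symm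
  have hex : ∃ j, x * N ^ j ≤ (N + 1) ^ j := ⟨_, hlarge⟩
  classical
  -- Take the least power of `1 + 1/N` that reaches `x`: the preceding power is below `x`. Rounding
  -- down is harmless since `x` is an integer.
  refine ⟨(N + 1) ^ Nat.find hex / N ^ Nat.find hex,
    mem_lengthBounds_pow N (Nat.find_min' hex hlarge), ?_, ?_⟩
  · rw [Nat.le_div_iff_mul_le (Nat.pow_pos hN)]
    exact Nat.find_spec hex
  · rcases Nat.eq_zero_or_pos (Nat.find hex) with h0 | h0
    · rw [h0]
      simp only [pow_zero, Nat.div_one, mul_one]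
      nlinarith
    · obtain ⟨j, hj⟩ := Nat.exists_eq_succ_of_ne_zero h0.ne'
      have hlt : (N + 1) ^ j < x * N ^ j := by
        have := Nat.find_min hex (m := j) (by omega)
        omega
      rw [hj]
      have h1 : (N + 1) ^ (j + 1) / N ^ (j + 1) * N ^ (j + 1) ≤ (N + 1) ^ (j + 1) :=
        Nat.div_mul_le_self _ _
      set D := (N + 1) ^ (j + 1) / N ^ (j + 1)
      have h2 : N * D * N ^ j ≤ (N + 1) * x * N ^ j := by
        calc N * D * N ^ j = D * N ^ (j + 1) := by ring
          _ ≤ (N + 1) ^ (j + 1) := h1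
          _ = (N + 1) * (N + 1) ^ j := by ring
          _ ≤ (N + 1) * (x * N ^ j) := Nat.mul_le_mul_left _ hlt.le
          _ = _ := by ring
      exact Nat.le_of_mul_le_mul_right h2 (Nat.pow_pos hN)

/-- `S` serves exactly `k` terminals of `R` within the relaxed bounds `δ t / N`. -/
structure Partial.Serves (S : Partial I) (N : ℕ) (r : Fin I.n) (R : Finset (Fin I.n))
    (δ : Fin I.n → ℤ) (k : ℕ) : Prop where
  subset : S.served ⊆ R
  card_eq : S.served.card = k
  reach : ∀ t ∈ S.served, ∃ p, I.IsWalk S.edges r t p ∧ (N * I.walkLen p : ℤ) ≤ δ t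

/-- The search for the cheapest path to a terminal that is not yet served. -/
def cheapest (P : Fin I.n → Option (Path I)) (U : Finset (Fin I.n)) :
    Timed (Option (Fin I.n × Path I)) :=
  Timed.fold (List.finRange I.n) none fun best t => do
    if ← Timed.mem t U then pure best
    else
      match ← Timed.get P t with
      | none => pure best
      | some p => Timed.keepMin (fun tp => tp.2.cost) best (t, p)

theorem addCheapest_succ (P : Fin I.n → Option (Path I)) (k : ℕ) (S : Partial I) :
    I.addCheapest P (k + 1) S = (do
      match ← cheapest P S.served with
      | none => pure S
      | some (t, p) => do
        let E ← I.addPath S.edges p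
        let U ← Timed.insert t S.served
        I.addCheapest P k ⟨E, U⟩) := rfl

theorem cheapest_sound {P : Fin I.n → Option (Path I)} {U : Finset (Fin I.n)}
    {tp : Fin I.n × Path I} (h : (cheapest P U).val = some tp) :
    tp.1 ∉ U ∧ P tp.1 = some tp.2 := by
  have key : ∀ tp : Fin I.n × Path I, _ = some tp → tp.1 ∉ U ∧ P tp.1 = some tp.2 :=
    Timed.fold_inv (l := List.finRange I.n) (b := none)
      (f := fun best t => do
        if ← Timed.mem t U then pure best
        else
          match ← Timed.get P t with
          | none => pure best
          | some p => Timed.keepMin (fun tp => tp.2.cost) best (t, p))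
      (fun best : Option (Fin I.n × Path I) =>
        ∀ tp, best = some tp → tp.1 ∉ U ∧ P tp.1 = some tp.2) (by simp) (by
      intro best t _ hb tp htp
      by_cases h1 : t ∈ U
      · simp [h1] at htp
        exact hb tp htp
      · cases h2 : P t with
        | none =>
          simp [h1, h2] at htp
          exact hb tp htp
        | some p =>
          simp only [Timed.val_bind, Timed.val_mem, h1, decide_false, Bool.false_eq_true,
            if_false, Timed.val_get, h2] at htp
          rcases Timed.val_keepMin (fun tp : Fin I.n × Path I => tp.2.cost) best (t, p) with
            h | ⟨b, rfl, h⟩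
          · rw [h] at htp
            obtain rfl := Option.some.inj htp
            exact ⟨h1, h2⟩
          · rw [h] at htp
            exact hb tp htp)
  exact key tp h

theorem cheapest_complete {P : Fin I.n → Option (Path I)} {U : Finset (Fin I.n)} {t : Fin I.n}
    {p : Path I} (ht : t ∉ U) (hp : P t = some p) :
    Timed.KeyLE (fun tp : Fin I.n × Path I => tp.2.cost) p.cost (cheapest P U).val := by
  refine Timed.fold_reach (fun _ => True) _ trivial (fun _ _ _ _ => trivial) ?_
    (List.mem_finRange t) ?_
  · intro best x _ _ hb
    by_cases h1 : x ∈ U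
    · simpa [h1] using hb
    · cases h2 : P x with
      | none => simpa [h1, h2] using hb
      | some q =>
        simpa [h1, h2] using
          Timed.keyLE_keepMin_old (fun tp : Fin I.n × Path I => tp.2.cost) (x, q) hb
  · intro best _
    simpa [ht, hp] using
      Timed.keyLE_keepMin_new (fun tp : Fin I.n × Path I => tp.2.cost) best (a := (t, p)) le_rfl

/-- If enough paths are available, `addCheapest` serves `k` further terminals. -/
theorem addCheapest_sound {N : ℕ} {r : Fin I.n} {R : Finset (Fin I.n)} {δ : Fin I.n → ℤ}
    {P : Fin I.n → Option (Path I)}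
    (hP : ∀ t p, P t = some p → t ∈ R ∧ I.IsWalk Finset.univ r t p.edges.reverse ∧
      (N * I.walkLen p.edges : ℤ) ≤ δ t)
    {k j : ℕ} {S : Partial I} (hS : S.Serves N r R δ j)
    (hk : k + j ≤ (Finset.univ.filter fun t => P t ≠ none).card) :
    (I.addCheapest P k S).val.Serves N r R δ (k + j) := by
  induction k generalizing j S with
  | zero => simpa [addCheapest] using hS
  | succ k ih =>
    obtain ⟨t₀, ht₀, htU⟩ : ∃ t ∈ (Finset.univ.filter fun t => P t ≠ none), t ∉ S.served := by
      by_contra! h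
      have := Finset.card_le_card h
      rw [hS.card_eq] at this
      omega
    obtain ⟨p₀, hp₀⟩ := Option.ne_none_iff_exists'.1 (Finset.mem_filter.1 ht₀).2
    obtain ⟨⟨t, p⟩, htp, -⟩ := cheapest_complete htU hp₀
    obtain ⟨h1, h2⟩ := cheapest_sound htp
    obtain ⟨h3, h4, h5⟩ := hP t p h2
    rw [addCheapest_succ]
    simp only [Timed.val_bind, htp, Timed.val_insert, addPath_val]
    have := ih (j := j + 1) (S := ⟨S.edges ∪ p.edges.toFinset, insert t S.served⟩) ?_ (by omega)
    · rwa [show k + 1 + j = k + (j + 1) by omega]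
    · refine ⟨Finset.insert_subset h3 hS.subset, ?_, ?_⟩
      · rw [Finset.card_insert_of_notMem h1, hS.card_eq]
      · intro x hx
        rcases Finset.mem_insert.1 hx with rfl | hx
        · refine ⟨p.edges.reverse, h4.of_mem fun e he => ?_, by simpa using h5⟩
          exact Finset.mem_union_right _ (by simpa using he)
        · obtain ⟨q, hq, hl⟩ := hS.reach x hx
          exact ⟨q, hq.mono Finset.subset_union_left, hl⟩

/-- `addCheapest` pays at most `x` for each terminal if sufficiently many terminals have paths of
cost at most `x`. -/
theorem addCheapest_cost {P : Fin I.n → Option (Path I)} {K : Finset (Fin I.n)} {x : ℕ}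
    (hK : ∀ t ∈ K, ∃ p, P t = some p ∧ p.cost ≤ x)
    (hcost : ∀ t p, P t = some p → p.cost = I.walkCost p.edges)
    {k : ℕ} {S : Partial I} (hk : k + S.served.card ≤ K.card) :
    I.totalCost (I.addCheapest P k S).val.edges ≤ I.totalCost S.edges + k * x := by
  induction k generalizing S with
  | zero => simp [addCheapest]
  | succ k ih =>
    -- Fewer than `K.card` terminals are served, so a path of cost at most `x` is still available,
    -- and the chosen one is no costlier.
    obtain ⟨t₀, ht₀, htU⟩ : ∃ t ∈ K, t ∉ S.served := by
      by_contra! h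
      have := Finset.card_le_card h
      omega
    obtain ⟨p₀, hp₀, hx⟩ := hK t₀ ht₀
    obtain ⟨⟨t, p⟩, htp, hle⟩ := cheapest_complete htU hp₀
    obtain ⟨h1, h2⟩ := cheapest_sound htp
    rw [addCheapest_succ]
    simp only [Timed.val_bind, htp, Timed.val_insert, addPath_val]
    refine (ih (S := ⟨S.edges ∪ p.edges.toFinset, insert t S.served⟩) ?_).trans ?_
    · rw [Finset.card_insert_of_notMem h1]; omega
    · have h3 := totalCost_union_le S.edges p.edges.toFinset
      have h4 := totalCost_toFinset_le p.edges
      have h5 := hcost t p h2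
      simp only at hle
      rw [Nat.succ_mul]
      simp only
      omega

/-- The body of the loops of `bestCandidate`. -/
def tryCandidate (N : ℕ) (rec : Procedure I) (R : Finset (Fin I.n)) (δ : Fin I.n → ℤ)
    (r v : Fin I.n) (k' : ℕ) (best : Option (Candidate I)) (D : ℕ) :
    Timed (Option (Candidate I)) := do
  match ← I.minCostPath N r v D with
  | none => pure best
  | some P => do
    let shift ← Timed.mul N P.len
    let δ' ← Timed.table fun u => do
      let a ← Timed.get δ u
      Timed.intSub a shift
    match ← rec v R δ' k' with
    | none => pure best
    | some S => do
      let E ← I.addPath S.edges P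
      let c ← I.costOf E
      I.keepLighter best ⟨⟨E, S.served⟩, c, k'⟩

theorem bestCandidate_eq (N : ℕ) (rec : Procedure I) (r : Fin I.n) (R : Finset (Fin I.n))
    (δ : Fin I.n → ℤ) (k : ℕ) : I.bestCandidate N rec r R δ k = (do
      let bounds ← I.lengthBounds N
      Timed.fold (List.finRange I.n) none fun best v =>
        Timed.fold (List.range' 1 k) best fun best k' =>
          Timed.fold bounds best (tryCandidate N rec R δ r v k')) := rfl

theorem keepLighter_val (best : Option (Candidate I)) (a : Candidate I) :
    (I.keepLighter best a).val = some a ∨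
      ∃ b, best = some b ∧ (I.keepLighter best a).val = some b := by
  unfold keepLighter
  cases best with
  | none => exact Or.inl rfl
  | some b => by_cases h : a.cost * b.count < b.cost * a.count <;> simp [h]

/-- The outcome of one attempt: nothing new, or a comparison with a new candidate. -/
theorem tryCandidate_val (N : ℕ) (rec : Procedure I) (R : Finset (Fin I.n)) (δ : Fin I.n → ℤ)
    (r v : Fin I.n) (k' : ℕ) (best : Option (Candidate I)) (D : ℕ) :
    (tryCandidate N rec R δ r v k' best D).val = best ∨
    ∃ P S, (I.minCostPath N r v D).val = some P ∧
      (rec v R (fun u => δ u - (N * P.len : ℕ)) k').val = some S ∧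
      (tryCandidate N rec R δ r v k' best D).val = (I.keepLighter best
        ⟨⟨S.edges ∪ P.edges.toFinset, S.served⟩,
          I.totalCost (S.edges ∪ P.edges.toFinset), k'⟩).val := by
  unfold tryCandidate
  cases hP : (I.minCostPath N r v D).val with
  | none => simp [hP]
  | some P =>
    cases hS : (rec v R (fun u => δ u - (N * P.len : ℕ)) k').val with
    | none =>
      left
      simp only [Timed.val_bind, hP, Timed.val_mul]
      rw [show (Timed.table fun u => Timed.get δ u >>= fun a => Timed.intSub a (N * P.len)).val =
        fun u => δ u - (N * P.len : ℕ) from rfl, hS]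
      rfl
    | some S =>
      refine Or.inr ⟨P, S, rfl, hS, ?_⟩
      simp only [Timed.val_bind, hP, Timed.val_mul]
      rw [show (Timed.table fun u => Timed.get δ u >>= fun a => Timed.intSub a (N * P.len)).val =
        fun u => δ u - (N * P.len : ℕ) from rfl, hS]
      simp only [Timed.val_bind, addPath_val, costOf_val]

theorem tryCandidate_val_of_some {N : ℕ} {rec : Procedure I} {R : Finset (Fin I.n)}
    {δ : Fin I.n → ℤ} {r v : Fin I.n} {k' : ℕ} (best : Option (Candidate I)) {D : ℕ} {P : Path I}
    {S : Partial I} (hP : (I.minCostPath N r v D).val = some P)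
    (hS : (rec v R (fun u => δ u - (N * P.len : ℕ)) k').val = some S) :
    (tryCandidate N rec R δ r v k' best D).val = (I.keepLighter best
      ⟨⟨S.edges ∪ P.edges.toFinset, S.served⟩,
        I.totalCost (S.edges ∪ P.edges.toFinset), k'⟩).val := by
  unfold tryCandidate
  simp only [Timed.val_bind, hP, Timed.val_mul]
  rw [show (Timed.table fun u => Timed.get δ u >>= fun a => Timed.intSub a (N * P.len)).val =
    fun u => δ u - (N * P.len : ℕ) from rfl, hS]
  simp only [Timed.val_bind, addPath_val, costOf_val]

/-- What a candidate returned by `bestCandidate` satisfies. -/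
structure Candidate.Sound (C : Candidate I) (N : ℕ) (r : Fin I.n) (R : Finset (Fin I.n))
    (δ : Fin I.n → ℤ) (k : ℕ) : Prop where
  pos : 1 ≤ C.count
  le : C.count ≤ k
  cost_eq : C.cost = I.totalCost C.sub.edges
  serves : C.sub.Serves N r R δ C.count

/-- What a sound procedure satisfies. -/
def Procedure.Sound (rec : Procedure I) (N : ℕ) : Prop :=
  ∀ r R δ k S, (rec r R δ k).val = some S → S.Serves N r R δ k

/-- The recursive call received budgets reduced by `N * P.len`, which is exactly what prepending `P`
adds. -/
theorem bestCandidate_sound {N : ℕ} {rec : Procedure I} (hrec : rec.Sound N) {r : Fin I.n}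
    {R : Finset (Fin I.n)} {δ : Fin I.n → ℤ} {k : ℕ} {C : Candidate I}
    (hC : (I.bestCandidate N rec r R δ k).val = some C) : C.Sound N r R δ k := by
  rw [bestCandidate_eq] at hC
  let Inv := fun best : Option (Candidate I) => ∀ C, best = some C → C.Sound N r R δ k
  refine (?_ : Inv _) C hC
  refine Timed.fold_inv Inv (by simp [Inv]) fun best v _ hb => ?_
  refine Timed.fold_inv Inv hb fun best k' hk' hb => ?_
  refine Timed.fold_inv Inv hb fun best D _ hb => ?_
  rw [List.mem_range'_1] at hk'
  intro C hC
  rcases tryCandidate_val N rec R δ r v k' best D with h | ⟨P, S, hP, hS, h⟩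
  · exact hb C (h.symm.trans hC)
  · rw [h] at hC
    rcases keepLighter_val best ⟨⟨S.edges ∪ P.edges.toFinset, S.served⟩,
      I.totalCost (S.edges ∪ P.edges.toFinset), k'⟩ with h' | ⟨b, rfl, h'⟩
    · rw [h'] at hC
      obtain rfl := Option.some.inj hC
      obtain ⟨h1, h2, h3⟩ := hrec _ _ _ _ _ hS
      obtain ⟨⟨hw, hlen, -⟩, -⟩ := minCostPath_sound hP
      refine ⟨by simp; omega, by simp; omega, rfl, h1, h2, fun t ht => ?_⟩
      obtain ⟨q, hq, hl⟩ := h3 t ht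
      refine ⟨P.edges.reverse ++ q, isWalk_append.2 ⟨v, hw.of_mem fun e he => ?_,
        hq.mono Finset.subset_union_left⟩, ?_⟩
      · exact Finset.mem_union_right _ (by simpa using he)
      · rw [walkLen_append, walkLen_reverse, ← hlen]
        push_cast at hl ⊢
        linarith
    · rw [h'] at hC
      exact hb C hC

/-- `best` is a candidate of density at most `x / k`. -/
def LighterThan (x k : ℕ) (best : Option (Candidate I)) : Prop :=
  ∃ C, best = some C ∧ C.cost * k ≤ x * C.count

theorem lighterThan_keepLighter_new {best : Option (Candidate I)} {a : Candidate I} :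
    LighterThan a.cost a.count (I.keepLighter best a).val := by
  unfold keepLighter
  cases best with
  | none => exact ⟨a, rfl, le_rfl⟩
  | some b =>
    by_cases h : a.cost * b.count < b.cost * a.count
    · exact ⟨a, by simp [h], le_rfl⟩
    · exact ⟨b, by simp [h], not_lt.1 h⟩

/-- Chaining two cross-multiplied comparisons requires cancelling the middle denominator, hence
`hpos`. -/
theorem lighterThan_keepLighter_old {x k : ℕ} {best : Option (Candidate I)} {a : Candidate I}
    (hpos : ∀ b, best = some b → 1 ≤ b.count) (hbest : LighterThan x k best) :
    LighterThan x k (I.keepLighter best a).val := by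
  obtain ⟨b, rfl, hb⟩ := hbest
  unfold keepLighter
  by_cases h : a.cost * b.count < b.cost * a.count
  · refine ⟨a, by simp [h], ?_⟩
    have h1 : b.count * (a.cost * k) ≤ b.count * (x * a.count) := by
      calc b.count * (a.cost * k) = a.cost * b.count * k := by ring
        _ ≤ b.cost * a.count * k := Nat.mul_le_mul_right _ h.le
        _ = b.cost * k * a.count := by ring
        _ ≤ x * b.count * a.count := Nat.mul_le_mul_right _ hb
        _ = _ := by ring
    exact Nat.le_of_mul_le_mul_left h1 (hpos b rfl)
  · exact ⟨b, by simp [h], hb⟩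

/-- The nested loops reach the triple `(v, k', D)` in some round, after which the best density never
increases. The positivity of the counts is carried along as an invariant for
`lighterThan_keepLighter_old`. -/
theorem bestCandidate_complete {N : ℕ} {rec : Procedure I} {r v : Fin I.n}
    {R : Finset (Fin I.n)} {δ : Fin I.n → ℤ} {k k' D : ℕ} {P : Path I} {S : Partial I}
    (hk1 : 1 ≤ k') (hk : k' ≤ k) (hD : D ∈ (I.lengthBounds N).val)
    (hP : (I.minCostPath N r v D).val = some P)
    (hS : (rec v R (fun u => δ u - (N * P.len : ℕ)) k').val = some S) :
    LighterThan (I.totalCost (S.edges ∪ P.edges.toFinset)) k'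
      (I.bestCandidate N rec r R δ k).val := by
  rw [bestCandidate_eq]
  let Inv := fun best : Option (Candidate I) => ∀ b, best = some b → 1 ≤ b.count
  let Good := LighterThan (I := I) (I.totalCost (S.edges ∪ P.edges.toFinset)) k'
  have inv : ∀ best v, ∀ k₁ ∈ List.range' 1 k, ∀ D, Inv best →
      Inv (tryCandidate N rec R δ r v k₁ best D).val := by
    intro best v k₁ hk₁ D hb C hC
    rw [List.mem_range'_1] at hk₁
    rcases tryCandidate_val N rec R δ r v k₁ best D with h | ⟨P, S, hP, hS, h⟩
    · exact hb C (h.symm.trans hC)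
    · rw [h] at hC
      rcases keepLighter_val best ⟨⟨S.edges ∪ P.edges.toFinset, S.served⟩,
        I.totalCost (S.edges ∪ P.edges.toFinset), k₁⟩ with h' | ⟨b, rfl, h'⟩
      · rw [h'] at hC
        obtain rfl := Option.some.inj hC
        exact hk₁.1
      · rw [h'] at hC
        exact hb C hC
  have pres : ∀ best v k₁ D, Inv best → Good best →
      Good (tryCandidate N rec R δ r v k₁ best D).val := by
    intro best v k₁ D hb hg
    rcases tryCandidate_val N rec R δ r v k₁ best D with h | ⟨P, S, hP, hS, h⟩
    · rw [h]; exact hg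
    · rw [h]; exact lighterThan_keepLighter_old hb hg
  have hmem : k' ∈ List.range' 1 k := List.mem_range'_1.2 ⟨hk1, by omega⟩
  refine Timed.fold_reach Inv Good (by simp [Inv]) ?_ ?_ (List.mem_finRange v) ?_
  · intro best v _ hb
    refine Timed.fold_inv Inv hb fun best k₁ hk₁ hb => ?_
    exact Timed.fold_inv Inv hb fun best D _ hb => inv best v k₁ hk₁ D hb
  · intro best v _ hb hg
    refine (Timed.fold_inv (fun b => Inv b ∧ Good b) ⟨hb, hg⟩ fun best k₁ hk₁ h => ?_).2
    exact Timed.fold_inv (fun b => Inv b ∧ Good b) h fun best D _ h =>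
      ⟨inv best v k₁ hk₁ D h.1, pres best v k₁ D h.1 h.2⟩
  · intro best hb
    refine Timed.fold_reach Inv Good hb ?_ ?_ hmem ?_
    · intro best k₁ hk₁ hb
      exact Timed.fold_inv Inv hb fun best D _ hb => inv best v k₁ hk₁ D hb
    · intro best k₁ hk₁ hb hg
      exact (Timed.fold_inv (fun b => Inv b ∧ Good b) ⟨hb, hg⟩ fun best D _ h =>
        ⟨inv best v k₁ hk₁ D h.1, pres best v k₁ D h.1 h.2⟩).2
    · intro best hb
      refine Timed.fold_reach Inv Good hb (fun best D _ hb => inv best v k' hmem D hb)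
        (fun best D _ hb hg => pres best v k' D hb hg) hD fun best _ => ?_
      rw [tryCandidate_val_of_some best hP hS]
      exact lighterThan_keepLighter_new

theorem greedyLoop_zero (N : ℕ) (rec : Procedure I) (r : Fin I.n) (δ : Fin I.n → ℤ)
    (R : Finset (Fin I.n)) (k : ℕ) (S : Partial I) :
    (I.greedyLoop N rec r δ 0 R k S).val = some S := rfl

theorem greedyLoop_done (N : ℕ) (rec : Procedure I) (r : Fin I.n) (δ : Fin I.n → ℤ)
    (fuel : ℕ) (R : Finset (Fin I.n)) (S : Partial I) :
    (I.greedyLoop N rec r δ fuel R 0 S).val = some S := by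
  cases fuel <;> simp [greedyLoop]

theorem greedyLoop_none {N : ℕ} {rec : Procedure I} {r : Fin I.n} {δ : Fin I.n → ℤ}
    {fuel : ℕ} {R : Finset (Fin I.n)} {k : ℕ} (hk : 0 < k) (S : Partial I)
    (h : (I.bestCandidate N rec r R δ k).val = none) :
    (I.greedyLoop N rec r δ (fuel + 1) R k S).val = none := by
  simp [greedyLoop, hk, h]

theorem greedyLoop_some {N : ℕ} {rec : Procedure I} {r : Fin I.n} {δ : Fin I.n → ℤ}
    {fuel : ℕ} {R : Finset (Fin I.n)} {k : ℕ} (hk : 0 < k) (S : Partial I) {C : Candidate I}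
    (h : (I.bestCandidate N rec r R δ k).val = some C) :
    (I.greedyLoop N rec r δ (fuel + 1) R k S).val =
      (I.greedyLoop N rec r δ fuel (R \ C.sub.served) (k - C.count)
        ⟨S.edges ∪ C.sub.edges, S.served ∪ C.sub.served⟩).val := by
  simp [greedyLoop, hk, h]

/-- A candidate serves only terminals still in `R`, none of which was served before, so the counts
add up. Every round has a positive count, so with `k ≤ fuel` the fuel cannot run out early. -/
theorem greedyLoop_sound {N : ℕ} {rec : Procedure I} (hrec : rec.Sound N) {r : Fin I.n}
    {δ : Fin I.n → ℤ} {R₀ : Finset (Fin I.n)} {fuel : ℕ} {R : Finset (Fin I.n)} {k j : ℕ}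
    {S S' : Partial I} (hk : k ≤ fuel) (hR : R ⊆ R₀) (hd : Disjoint S.served R)
    (hS : S.Serves N r R₀ δ j) (h : (I.greedyLoop N rec r δ fuel R k S).val = some S') :
    S'.Serves N r R₀ δ (k + j) := by
  induction fuel generalizing R k j S with
  | zero =>
    obtain rfl : k = 0 := by omega
    rw [greedyLoop_zero] at h
    obtain rfl := Option.some.inj h
    simpa using hS
  | succ fuel ih =>
    rcases Nat.eq_zero_or_pos k with rfl | hk0
    · rw [greedyLoop_done] at h
      obtain rfl := Option.some.inj h
      simpa using hS
    · cases hC : (I.bestCandidate N rec r R δ k).val with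
      | none =>
        rw [greedyLoop_none hk0 S hC] at h
        simp at h
      | some C =>
        rw [greedyLoop_some hk0 S hC] at h
        obtain ⟨h1, h2, -, h3, h4, h5⟩ := bestCandidate_sound hrec hC
        have := ih (k := k - C.count) (j := C.count + j) (by omega)
          (Finset.sdiff_subset.trans hR) ?_ ?_ h
        · rwa [show k - C.count + (C.count + j) = k + j by omega] at this
        · rw [Finset.disjoint_union_left]
          exact ⟨hd.mono_right Finset.sdiff_subset, Finset.disjoint_sdiff⟩
        · refine ⟨Finset.union_subset hS.subset (h3.trans hR), ?_, ?_⟩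
          · rw [Finset.card_union_of_disjoint (hd.mono_right h3), hS.card_eq, h4, add_comm]
          · intro t ht
            rcases Finset.mem_union.1 ht with ht | ht
            · obtain ⟨p, hp, hl⟩ := hS.reach t ht
              exact ⟨p, hp.mono Finset.subset_union_left, hl⟩
            · obtain ⟨p, hp, hl⟩ := h5 t ht
              exact ⟨p, hp.mono Finset.subset_union_right, hl⟩

theorem serves_empty (N : ℕ) (r : Fin I.n) (R : Finset (Fin I.n)) (δ : Fin I.n → ℤ) :
    (⟨∅, ∅⟩ : Partial I).Serves N r R δ 0 :=
  ⟨Finset.empty_subset _, rfl, by simp⟩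

/-- The number of terminals that can be reached within their bounds, as computed. -/
def reachCount (I : SLProblem) (N : ℕ) (r : Fin I.n) (R : Finset (Fin I.n)) (δ : Fin I.n → ℤ) :
    ℕ :=
  (Finset.univ.filter fun t => (I.terminalPaths N r R δ).val t ≠ none).card

theorem shallowLight_fail {N i : ℕ} {r : Fin I.n} {R : Finset (Fin I.n)} {δ : Fin I.n → ℤ}
    {k : ℕ} (h : I.reachCount N r R δ < k) : (I.shallowLight N (i + 1) r R δ k).val = none := by
  simp only [shallowLight, Timed.val_bind, countPaths_val, Timed.val_lt]
  simp only [reachCount] at h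
  simp only [h, decide_true, if_true, Timed.val_pure]

theorem shallowLight_one {N : ℕ} {r : Fin I.n} {R : Finset (Fin I.n)} {δ : Fin I.n → ℤ}
    {k : ℕ} (h : k ≤ I.reachCount N r R δ) : (I.shallowLight N 1 r R δ k).val =
      some (I.addCheapest (I.terminalPaths N r R δ).val k ⟨∅, ∅⟩).val := by
  simp only [shallowLight, Timed.val_bind, countPaths_val, Timed.val_lt]
  simp only [reachCount, ← not_lt] at h
  simp only [h, decide_false, Bool.false_eq_true, if_false]
  rfl

theorem shallowLight_succ {N i : ℕ} {r : Fin I.n} {R : Finset (Fin I.n)} {δ : Fin I.n → ℤ}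
    {k : ℕ} (h : k ≤ I.reachCount N r R δ) : (I.shallowLight N (i + 2) r R δ k).val =
      (I.greedyLoop N (I.shallowLight N (i + 1)) r δ k R k ⟨∅, ∅⟩).val := by
  rw [shallowLight]
  simp only [Timed.val_bind, countPaths_val, Timed.val_lt]
  simp only [reachCount, ← not_lt] at h
  simp only [h, decide_false, Bool.false_eq_true, if_false]
  rfl

/-- A direct path even satisfies the bound with factor `N + 1`. The weaker factor `N` is the one
that survives the recursion. -/
theorem terminalPaths_sound {N : ℕ} {r : Fin I.n} {R : Finset (Fin I.n)}
    {δ : Fin I.n → ℤ} {t : Fin I.n} {p : Path I}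
    (h : (I.terminalPaths N r R δ).val t = some p) :
    t ∈ R ∧ p.Valid r t ∧ (N * I.walkLen p.edges : ℤ) ≤ δ t := by
  rw [terminalPaths_val] at h
  split_ifs at h with h1
  obtain ⟨hv, hl⟩ := minCostPath_sound h
  refine ⟨h1.1, hv, ?_⟩
  rw [hv.len_eq, Nat.le_div_iff_mul_le (Nat.succ_pos N)] at hl
  have h2 : (I.walkLen p.edges * (N + 1) : ℤ) ≤ δ t := by
    rw [← Int.toNat_of_nonneg h1.2]
    exact_mod_cast hl
  have h3 : (0 : ℤ) ≤ I.walkLen p.edges := Int.natCast_nonneg _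
  nlinarith

theorem shallowLight_sound (N i : ℕ) : Procedure.Sound (I.shallowLight N i) N := by
  induction i with
  | zero =>
    intro r R δ k S h
    simp [shallowLight] at h
  | succ i ih =>
    intro r R δ k S h
    rcases lt_or_ge (I.reachCount N r R δ) k with hk | hk
    · rw [shallowLight_fail hk] at h
      simp at h
    cases i with
    | zero =>
      rw [shallowLight_one hk] at h
      obtain rfl := Option.some.inj h
      refine addCheapest_sound (j := 0) (fun t p hp => ?_) (serves_empty N r R δ) hk
      obtain ⟨h1, h2, h3⟩ := terminalPaths_sound hp
      exact ⟨h1, h2.isWalk, h3⟩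
    | succ i =>
      rw [shallowLight_succ hk] at h
      exact greedyLoop_sound ih le_rfl subset_rfl (by simp) (serves_empty N r R δ) h

/-- Rounding the budget down to an integral length bound excludes no path, since lengths are
integers. -/
theorem terminalPaths_complete {N : ℕ} (hN : 0 < N) {r : Fin I.n} {R : Finset (Fin I.n)}
    {δ : Fin I.n → ℤ} {K : Finset (Fin I.n)} {c : ℕ} (h : Spans I (N + 1) r δ K c) (hK : K ⊆ R)
    {t : Fin I.n} (ht : t ∈ K) :
    ∃ p, (I.terminalPaths N r R δ).val t = some p ∧ N * p.cost ≤ (N + 1) * c := by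
  obtain ⟨q, hq, hl, hc⟩ := h.exists_walk ht
  have h0 : 0 ≤ δ t := le_trans (by positivity) hl
  rw [terminalPaths_val, if_pos ⟨hK ht, h0⟩]
  obtain ⟨P, hP, hPc⟩ := minCostPath_complete hN (D := (δ t).toNat / (N + 1)) hq (by
    rw [Nat.le_div_iff_mul_le (Nat.succ_pos N)]
    rw [← Int.toNat_of_nonneg h0] at hl
    have : (N + 1) * I.walkLen q ≤ (δ t).toNat := by exact_mod_cast hl
    linarith)
  exact ⟨P, hP, hPc.trans (Nat.mul_le_mul_left _ hc)⟩

/-- Ensures that the failure test does not fire when a tree spans enough terminals. -/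
theorem le_reachCount {N : ℕ} (hN : 0 < N) {r : Fin I.n} {R : Finset (Fin I.n)}
    {δ : Fin I.n → ℤ} {K : Finset (Fin I.n)} {c : ℕ} (h : Spans I (N + 1) r δ K c)
    (hK : K ⊆ R) : K.card ≤ I.reachCount N r R δ := by
  refine Finset.card_le_card fun t ht => ?_
  obtain ⟨p, hp, -⟩ := terminalPaths_complete hN h hK ht
  simp [hp]

end SLProblem

/-! ### The approximation ratio -/

namespace SLProblem

variable {I : SLProblem}

/-- The procedure serves any `k` terminals at most `F * k ^ α` times as expensively as an optimal
out-tree. -/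
def Procedure.Approximates (rec : Procedure I) (N : ℕ) (F α : ℝ) : Prop :=
  ∀ r R δ K c k, Spans I (N + 1) r δ K c → K ⊆ R → k ≤ K.card →
    ∃ S, (rec r R δ k).val = some S ∧ (I.totalCost S.edges : ℝ) ≤ F * (k : ℝ) ^ α * c

/-- For every piece of an optimal out-tree, the algorithm finds a candidate that is comparable. -/
theorem Procedure.Approximates.candidate {rec : Procedure I} {N : ℕ} {F α : ℝ} (hN : 0 < N)
    (hrec : rec.Approximates N F α) {r w : Fin I.n} {R : Finset (Fin I.n)} {δ : Fin I.n → ℤ}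
    {K : Finset (Fin I.n)} {k c : ℕ} {Q : List (Fin I.m)} (hQ : I.IsWalk Finset.univ r w Q)
    (hK : K ⊆ R) (hne : K.Nonempty) (hk : K.card ≤ k)
    (h : Spans I (N + 1) w (fun u => δ u - (N + 1 : ℕ) * I.walkLen Q) K c) :
    ∃ x : ℕ, LighterThan x K.card (I.bestCandidate N rec r R δ k).val ∧
      (x : ℝ) ≤ 2 * I.walkCost Q + F * (K.card : ℝ) ^ α * c := by
  obtain ⟨Q', hQ', hsub, hnd⟩ := hQ.exists_nodup
  obtain ⟨D, hD, hQD, hDN⟩ := exists_lengthBound hN (walkLen_le_of_nodup hnd)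
  obtain ⟨P, hP, hPc⟩ := minCostPath_complete hN hQ' hQD
  have hgood := minCostPath_sound hP
  -- The path has length at most `D`, which is at most `1 + 1/N` times the length of `Q`; so the
  -- recursion gets at least the budgets of the tree piece.
  have hshift : N * P.len ≤ (N + 1) * I.walkLen Q :=
    (Nat.mul_le_mul_left _ hgood.len_le).trans
      (hDN.trans (Nat.mul_le_mul_left _ (walkLen_sublist hsub)))
  have h' : Spans I (N + 1) w (fun u => δ u - (N * P.len : ℕ)) K c :=
    h.mono_budget fun u => Int.sub_le_sub_left (by exact_mod_cast hshift) _
  obtain ⟨S, hS, hSc⟩ := hrec _ _ _ _ _ _ h' hK le_rfl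
  refine ⟨_, bestCandidate_complete (Finset.card_pos.2 hne) hk hD hP hS, ?_⟩
  have h1 := totalCost_union_le S.edges P.edges.toFinset
  have h2 := totalCost_toFinset_le P.edges
  rw [← hgood.valid.cost_eq] at h2
  -- Uses `1 + 1/N ≤ 2`, so that the final constant does not depend on the accuracy.
  have h3 : P.cost ≤ 2 * I.walkCost Q := by
    have h4 : N * P.cost ≤ N * (2 * I.walkCost Q) := by
      calc N * P.cost ≤ (N + 1) * I.walkCost Q' := hPc
        _ ≤ (2 * N) * I.walkCost Q :=
          Nat.mul_le_mul (by omega) (walkCost_sublist hsub)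
        _ = _ := by ring
    exact Nat.le_of_mul_le_mul_left h4 hN
  have h5 : I.totalCost (S.edges ∪ P.edges.toFinset) ≤
      2 * I.walkCost Q + I.totalCost S.edges := by omega
  have h6 : (I.totalCost (S.edges ∪ P.edges.toFinset) : ℝ) ≤
      2 * I.walkCost Q + I.totalCost S.edges := by exact_mod_cast h5
  linarith

/-- The density of the best candidate. -/
theorem Procedure.Approximates.bestCandidate {rec : Procedure I} {N : ℕ} {F α β : ℝ} (hN : 0 < N)
    (hF : 0 ≤ F) (hα : 0 ≤ α) (hα1 : α ≤ 1) (hβ1 : β ≤ 1) (hαβ : (1 - β) * α = β)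
    (hsound : rec.Sound N) (hrec : rec.Approximates N F α) {r : Fin I.n} {R : Finset (Fin I.n)}
    {δ : Fin I.n → ℤ} {K : Finset (Fin I.n)} {k c : ℕ} (h : Spans I (N + 1) r δ K c)
    (hK : K ⊆ R) (hk : K.card = k) (hk0 : 0 < k) :
    ∃ C, (I.bestCandidate N rec r R δ k).val = some C ∧
      (C.cost : ℝ) ≤ (2 + 4 * F) * ((k : ℝ) ^ (β - 1) * C.count) * c := by
  have hne : K.Nonempty := Finset.card_pos.1 (by omega)
  -- The whole tree with the empty path shows that there is a candidate at all.
  obtain ⟨_, ⟨C, hC, -⟩, -⟩ := hrec.candidate hN (Q := []) rfl hK hne hk.le (by simpa using h)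
  have hS := bestCandidate_sound hsound hC
  have hcount : (0 : ℝ) < C.count := by exact_mod_cast hS.pos
  refine ⟨C, hC, ?_⟩
  have hkR : (1 : ℝ) ≤ k := by exact_mod_cast hk0
  have hkpos : (0 : ℝ) < k := by linarith
  set y : ℝ := (k : ℝ) ^ (1 - β) with hy
  have hy1 : 1 ≤ y := Real.one_le_rpow hkR (by linarith)
  set s := ⌈y⌉₊ with hs
  have hys : y ≤ s := Nat.le_ceil y
  have hsy : (s : ℝ) ≤ 2 * y := by
    have := Nat.ceil_lt_add_one (by linarith : 0 ≤ y)
    linarith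
  have hs1 : 1 ≤ s := by
    have : (1 : ℝ) ≤ s := hy1.trans hys
    exact_mod_cast this
  -- Here `θ` is the density of the best candidate, a lower bound for the density of every piece.
  -- The factor 2 is the path approximation. Pieces have at most `2 * s ≤ 4 * y` terminals, and `(4
  -- * y)^α ≤ 4 * y^α = 4 * k^β`.
  have hdens := h.density hs1 (a := 2) (f := 4 * F * (k : ℝ) ^ β) (θ := C.cost / C.count)
    (by norm_num) (by positivity) (by
      intro Q w K' c' hQ hK' hne' hcard hSp
      have hkK : K'.card ≤ k := hk ▸ Finset.card_le_card hK'
      obtain ⟨x, ⟨C', hC', hx⟩, hxle⟩ := hrec.candidate hN hQ (hK'.trans hK) hne' hkK hSp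
      obtain rfl : C = C' := Option.some.inj (hC.symm.trans hC')
      have h1 : (C.cost * K'.card : ℝ) ≤ x * C.count := by exact_mod_cast hx
      have h2 : (K'.card : ℝ) * (C.cost / C.count) ≤ x := by
        rw [mul_div_assoc', div_le_iff₀ hcount]
        linarith
      have h3 : (K'.card : ℝ) ^ α ≤ 4 * (k : ℝ) ^ β := by
        have h4 : (K'.card : ℝ) ≤ 4 * y := by
          have : (K'.card : ℝ) ≤ 2 * s := by exact_mod_cast hcard
          linarith
        calc (K'.card : ℝ) ^ α ≤ (4 * y) ^ α := Real.rpow_le_rpow (Nat.cast_nonneg _) h4 hα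
          _ = 4 ^ α * y ^ α := Real.mul_rpow (by norm_num) (by linarith)
          _ ≤ 4 ^ (1 : ℝ) * y ^ α := by
            refine mul_le_mul_of_nonneg_right ?_ (Real.rpow_nonneg (by linarith) _)
            exact Real.rpow_le_rpow_of_exponent_le (by norm_num) hα1
          _ = 4 * (k : ℝ) ^ β := by
            rw [Real.rpow_one, hy, ← Real.rpow_mul hkpos.le, hαβ]
      have h5 : F * (K'.card : ℝ) ^ α * c' ≤ 4 * F * (k : ℝ) ^ β * c' := by
        have := mul_le_mul_of_nonneg_left h3 hF
        refine mul_le_mul_of_nonneg_right ?_ (Nat.cast_nonneg _)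
        linarith
      linarith)
  rw [hk] at hdens
  have hspos : (0 : ℝ) < s := by exact_mod_cast hs1
  have hyinv : (k : ℝ) ^ (β - 1) * y = 1 := by
    rw [hy, ← Real.rpow_add hkpos]
    simp
  have hkβ : (k : ℝ) ^ β = (k : ℝ) ^ (β - 1) * k := by
    rw [← Real.rpow_add_one hkpos.ne']
    congr 1; ring
  set z := (k : ℝ) ^ (β - 1) with hz
  have hzpos : 0 < z := Real.rpow_pos_of_pos hkpos _
  have h1s : 1 ≤ z * s := by
    rw [← hyinv]
    exact mul_le_mul_of_nonneg_left hys hzpos.le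
  -- Since `s ≥ k^(1-β)`, the path term `2 * k` is at most `2 * s * k^β`, the same order as the term
  -- from the recursion.
  have h7 : s * (k * (C.cost / C.count : ℝ)) ≤ s * (k * ((2 + 4 * F) * z * c)) := by
    refine hdens.trans ?_
    rw [hkβ]
    have h8 : (k : ℝ) * 2 * c ≤ (z * s) * (k * 2 * c) :=
      le_mul_of_one_le_left (by positivity) h1s
    nlinarith
  have h9 := le_of_mul_le_mul_left (le_of_mul_le_mul_left h7 hspos) hkpos
  rw [div_le_iff₀ hcount] at h9
  linarith

/-- The concavity estimate behind the analysis of the greedy algorithm. -/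
theorem rpow_sub_one_mul_le {β : ℝ} (h0 : 0 < β) (h1 : β ≤ 1) {k j : ℕ} (hj : j ≤ k) (hk : 0 < k) :
    (k : ℝ) ^ (β - 1) * j ≤ β⁻¹ * ((k : ℝ) ^ β - ((k - j : ℕ) : ℝ) ^ β) := by
  have hkpos : (0 : ℝ) < k := by exact_mod_cast hk
  have hjk : (j : ℝ) ≤ k := by exact_mod_cast hj
  -- Bernoulli's inequality for exponents at most 1, reversed: `(1 - j/k)^β ≤ 1 - β * j/k`.
  have hb := rpow_one_add_le_one_add_mul_self (s := -(j / k : ℝ)) (p := β)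
    (by
      have : (j / k : ℝ) ≤ 1 := (div_le_one hkpos).2 hjk
      linarith) h0.le h1
  have hsub : ((k - j : ℕ) : ℝ) = k * (1 + -(j / k : ℝ)) := by
    rw [Nat.cast_sub hj]; field_simp; ring
  have hnn : (0 : ℝ) ≤ 1 + -(j / k : ℝ) := by
    have : (j / k : ℝ) ≤ 1 := (div_le_one hkpos).2 hjk
    linarith
  rw [hsub, Real.mul_rpow hkpos.le hnn]
  have hkβ : (k : ℝ) ^ β = (k : ℝ) ^ (β - 1) * k := by
    rw [← Real.rpow_add_one hkpos.ne']
    congr 1; ring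
  have hz : 0 < (k : ℝ) ^ (β - 1) := Real.rpow_pos_of_pos hkpos _
  have h2 : (k : ℝ) ^ β * (1 + -(j / k : ℝ)) ^ β ≤ (k : ℝ) ^ β * (1 + β * -(j / k : ℝ)) :=
    mul_le_mul_of_nonneg_left hb (Real.rpow_nonneg hkpos.le _)
  have h3 : (k : ℝ) ^ β * (1 + β * -(j / k : ℝ)) = (k : ℝ) ^ β - β * ((k : ℝ) ^ (β - 1) * j) := by
    rw [hkβ]; field_simp; ring
  rw [h3] at h2
  rw [← mul_le_mul_iff_right₀ h0, mul_inv_cancel_left₀ h0.ne']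
  linarith

/-- A round removes exactly `C.count` terminals from `R`, so at least `k - C.count` terminals of `K`
remain, spanned by the same tree at the same cost. The round costs at most a multiple of `k^β - (k -
C.count)^β`, and the sum telescopes. -/
theorem Procedure.Approximates.greedyLoop {rec : Procedure I} {N : ℕ} {F α β : ℝ} (hN : 0 < N)
    (hF : 0 ≤ F) (hα : 0 ≤ α) (hα1 : α ≤ 1) (hβ : 0 < β) (hβ1 : β ≤ 1) (hαβ : (1 - β) * α = β)
    (hsound : rec.Sound N) (hrec : rec.Approximates N F α) {r : Fin I.n} {δ : Fin I.n → ℤ}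
    {c fuel : ℕ} {R : Finset (Fin I.n)} {K : Finset (Fin I.n)} {k : ℕ}
    (h : Spans I (N + 1) r δ K c) (hK : K ⊆ R) (hk : k ≤ K.card) (hfuel : k ≤ fuel)
    (S : Partial I) :
    ∃ S', (I.greedyLoop N rec r δ fuel R k S).val = some S' ∧
      (I.totalCost S'.edges : ℝ) ≤
        I.totalCost S.edges + (2 + 4 * F) * (β⁻¹ * (k : ℝ) ^ β) * c := by
  induction fuel generalizing R K k S with
  | zero =>
    refine ⟨S, rfl, ?_⟩
    have : 0 ≤ (2 + 4 * F) * (β⁻¹ * (k : ℝ) ^ β) * c := by positivity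
    linarith
  | succ fuel ih =>
    rcases Nat.eq_zero_or_pos k with rfl | hk0
    · refine ⟨S, greedyLoop_done _ _ _ _ _ _ _, ?_⟩
      have : 0 ≤ (2 + 4 * F) * (β⁻¹ * ((0 : ℕ) : ℝ) ^ β) * c := by positivity
      linarith
    -- The density estimate needs exactly as many terminals as are still requested, so surplus ones
    -- are dropped for this round only.
    · obtain ⟨K₁, hK₁, hcard⟩ := Finset.exists_subset_card_eq hk
      obtain ⟨C, hC, hCc⟩ := hrec.bestCandidate hN hF hα hα1 hβ1 hαβ hsound
        (h.subset hK₁) (hK₁.trans hK) hcard hk0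
      have hS := bestCandidate_sound hsound hC
      have hpos := hS.pos
      obtain ⟨S', hS', hle⟩ := ih (R := R \ C.sub.served) (K := K \ C.sub.served)
        (k := k - C.count) (h.subset Finset.sdiff_subset) (Finset.sdiff_subset_sdiff hK subset_rfl)
        (by
          have := Finset.le_card_sdiff C.sub.served K
          rw [hS.serves.card_eq] at this
          omega) (by omega) ⟨S.edges ∪ C.sub.edges, S.served ∪ C.sub.served⟩
      refine ⟨S', by rw [greedyLoop_some hk0 S hC, hS'], hle.trans ?_⟩
      have h1 : (I.totalCost (S.edges ∪ C.sub.edges) : ℝ) ≤ I.totalCost S.edges + C.cost := by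
        rw [hS.cost_eq]
        exact_mod_cast totalCost_union_le _ _
      have h2 := rpow_sub_one_mul_le hβ hβ1 hS.le hk0
      have h3 : (2 + 4 * F) * ((k : ℝ) ^ (β - 1) * C.count) * c ≤
          (2 + 4 * F) * (β⁻¹ * ((k : ℝ) ^ β - ((k - C.count : ℕ) : ℝ) ^ β)) * c :=
        mul_le_mul_of_nonneg_right (mul_le_mul_of_nonneg_left h2 (by positivity))
          (Nat.cast_nonneg _)
      simp only
      nlinarith

/-- The constant starts at 2 and a further level replaces `F` by `(2 + 4 * F) * β⁻¹`, independently
of the instance and of `N`. The exponents `α = 1/(i+1)` and `β = 1/(i+2)` satisfy `(1 - β) * α = β`,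
which balances paths against recursion. -/
theorem shallowLight_approximates (i : ℕ) : ∃ F : ℝ, 0 ≤ F ∧ ∀ (I : SLProblem) (N : ℕ), 0 < N →
    Procedure.Approximates (I.shallowLight N (i + 1)) N F (1 / (i + 1 : ℝ)) := by
  induction i with
  | zero =>
    refine ⟨2, by norm_num, fun I N hN r R δ K c k h hK hk => ?_⟩
    have hreach := hk.trans (le_reachCount hN h hK)
    refine ⟨_, shallowLight_one hreach, ?_⟩
    have h1 := addCheapest_cost (P := (I.terminalPaths N r R δ).val) (K := K) (x := 2 * c) (k := k)
      (S := ⟨∅, ∅⟩) (by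
        intro t ht
        obtain ⟨p, hp, hc⟩ := terminalPaths_complete hN h hK ht
        refine ⟨p, hp, Nat.le_of_mul_le_mul_left (hc.trans ?_) hN⟩
        nlinarith)
      (fun t p hp => (terminalPaths_sound hp).2.1.cost_eq) (by simpa using hk)
    have h2 : ((I.totalCost (I.addCheapest (I.terminalPaths N r R δ).val k ⟨∅, ∅⟩).val.edges : ℕ)
        : ℝ) ≤ (k * (2 * c) : ℕ) := by
      refine Nat.cast_le.2 (h1.trans ?_)
      simp [totalCost]
    refine h2.trans (le_of_eq ?_)
    push_cast
    norm_num
    ring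
  | succ i ih =>
    obtain ⟨F, hF, hrec⟩ := ih
    set β : ℝ := 1 / ((i + 1 : ℕ) + 1 : ℝ) with hβ
    have hβ0 : 0 < β := by positivity
    refine ⟨(2 + 4 * F) * β⁻¹, by positivity, fun I N hN r R δ K c k h hK hk => ?_⟩
    have hi : (0 : ℝ) < i + 1 := by positivity
    obtain ⟨S, hS, hle⟩ := (hrec I N hN).greedyLoop hN hF (β := β)
      (by positivity) (by rw [div_le_one hi]; linarith [(Nat.cast_nonneg i : (0 : ℝ) ≤ i)]) hβ0
      (by rw [hβ, div_le_one (by positivity)]; push_cast; linarith) (by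
        rw [hβ]; push_cast; field_simp; ring) (shallowLight_sound N (i + 1)) h hK hk le_rfl ⟨∅, ∅⟩
    refine ⟨S, by rw [shallowLight_succ (hk.trans (le_reachCount hN h hK)), hS], hle.trans ?_⟩
    simp only [totalCost, Finset.sum_empty, Nat.cast_zero, zero_add]
    exact le_of_eq (by ring)

end SLProblem

/-! ### The shortest path tree and the approximation guarantee -/

namespace SLProblem

variable {I : SLProblem}

/-- The search of `growTree` for the nearest endpoint of an edge that leaves the tree. -/
def nearest (E : Finset (Fin I.m)) (s : Finset (Fin I.m) × (Fin I.n → Option ℕ)) :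
    Timed (Option (Fin I.m × ℕ)) :=
  Timed.fold (List.finRange I.m) none fun best e => do
    if ← Timed.mem e E then
      let x ← Timed.get I.src e
      let y ← Timed.get I.tgt e
      match ← Timed.get s.2 x, ← Timed.get s.2 y with
      | some a, none => do
        let l ← Timed.get I.len e
        let b ← Timed.add a l
        Timed.keepMin Prod.snd best (e, b)
      | _, _ => pure best
    else pure best

theorem growTree_eq (E : Finset (Fin I.m)) (s : Finset (Fin I.m) × (Fin I.n → Option ℕ)) :
    I.growTree E s = (do
      match ← nearest E s with
      | none => pure s
      | some (e, b) => do
        let A ← Timed.insert e s.1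
        let y ← Timed.get I.tgt e
        let dist ← Timed.table fun x => do
          if ← Timed.eq x y then pure (some b) else Timed.get s.2 x
        pure (A, dist)) := rfl

theorem growTree_none {E : Finset (Fin I.m)} {s : Finset (Fin I.m) × (Fin I.n → Option ℕ)}
    (h : (nearest E s).val = none) : (I.growTree E s).val = s := by
  rw [growTree_eq]
  simp [h]

theorem growTree_some {E : Finset (Fin I.m)} {s : Finset (Fin I.m) × (Fin I.n → Option ℕ)}
    {e : Fin I.m} {b : ℕ} (h : (nearest E s).val = some (e, b)) :
    (I.growTree E s).val =
      (insert e s.1, fun x => if x = I.tgt e then some b else s.2 x) := by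
  rw [growTree_eq]
  simp only [Timed.val_bind, h, Timed.val_insert, Timed.val_get, Timed.val_pure]
  congr 1
  funext x
  by_cases hx : x = I.tgt e <;> simp [hx]

/-- The edge `e` leaves the tree, and its endpoint gets the distance `b`. -/
def Leaves (E : Finset (Fin I.m)) (s : Finset (Fin I.m) × (Fin I.n → Option ℕ)) (e : Fin I.m)
    (b : ℕ) : Prop :=
  e ∈ E ∧ (∃ a, s.2 (I.src e) = some a ∧ b = a + I.len e) ∧ s.2 (I.tgt e) = none

theorem nearest_spec (E : Finset (Fin I.m)) (s : Finset (Fin I.m) × (Fin I.n → Option ℕ)) :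
    (∀ e b, (nearest E s).val = some (e, b) → Leaves E s e b) ∧
    ∀ e b, Leaves E s e b → Timed.KeyLE Prod.snd b (nearest E s).val := by
  let step : Option (Fin I.m × ℕ) → Fin I.m → Timed (Option (Fin I.m × ℕ)) := fun best e => do
    if ← Timed.mem e E then
      let x ← Timed.get I.src e
      let y ← Timed.get I.tgt e
      match ← Timed.get s.2 x, ← Timed.get s.2 y with
      | some a, none => do
        let l ← Timed.get I.len e
        let b ← Timed.add a l
        Timed.keepMin Prod.snd best (e, b)
      | _, _ => pure best
    else pure best
  have hval : ∀ best e, (¬ (∃ b, Leaves E s e b) ∧ (step best e).val = best) ∨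
      ∃ b, Leaves E s e b ∧ (step best e).val = (Timed.keepMin Prod.snd best (e, b)).val := by
    intro best e
    by_cases he : e ∈ E
    · cases hx : s.2 (I.src e) with
      | none => left; simp [step, Leaves, he, hx]
      | some a =>
        cases hy : s.2 (I.tgt e) with
        | none =>
          right
          exact ⟨a + I.len e, ⟨he, ⟨a, hx, rfl⟩, hy⟩, by simp [step, he, hx, hy]⟩
        | some a' => left; simp [step, Leaves, he, hx, hy]
    · left; simp [step, Leaves, he]
  constructor
  · intro e b h
    let Inv := fun best : Option (Fin I.m × ℕ) => ∀ e b, best = some (e, b) → Leaves E s e b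
    refine (?_ : Inv _) e b h
    refine Timed.fold_inv (f := step) Inv (by simp [Inv]) fun best f _ hb e b hS => ?_
    rcases hval best f with ⟨-, h'⟩ | ⟨b', hl, h'⟩
    · exact hb e b (h'.symm.trans hS)
    · rw [h'] at hS
      rcases Timed.val_keepMin Prod.snd best (f, b') with h'' | ⟨x, rfl, h''⟩
      · rw [h''] at hS
        obtain ⟨rfl, rfl⟩ := Prod.mk.inj (Option.some.inj hS)
        exact hl
      · rw [h''] at hS
        exact hb e b hS
  · intro e b hl
    refine Timed.fold_reach (f := step) (fun _ => True) _ trivial (fun _ _ _ _ => trivial)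
      (fun best f _ _ hb => ?_) (List.mem_finRange e) fun best _ => ?_
    · rcases hval best f with ⟨-, h'⟩ | ⟨b', -, h'⟩
      · rw [h']; exact hb
      · rw [h']; exact Timed.keyLE_keepMin_old _ _ hb
    · rcases hval best e with ⟨h', -⟩ | ⟨b', ⟨-, ⟨a', ha', hb'⟩, -⟩, h'⟩
      · exact absurd ⟨b, hl⟩ h'
      · rw [h']
        obtain ⟨-, ⟨a, ha, hb⟩, -⟩ := hl
        obtain rfl := Option.some.inj (ha.symm.trans ha')
        exact Timed.keyLE_keepMin_new _ _ (by simp [hb, hb'])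

/-- The invariant of Dijkstra's algorithm. -/
structure TreeInv (E : Finset (Fin I.m)) (s : Finset (Fin I.m) × (Fin I.n → Option ℕ)) :
    Prop where
  subset : s.1 ⊆ E
  root : s.2 I.root = some 0
  tgt_ne : ∀ e ∈ s.1, I.tgt e ≠ I.root
  tgt_mem : ∀ e ∈ s.1, s.2 (I.tgt e) ≠ none
  src_mem : ∀ e ∈ s.1, s.2 (I.src e) ≠ none
  unique : ∀ e ∈ s.1, ∀ f ∈ s.1, I.tgt e = I.tgt f → e = f
  walk : ∀ x a, s.2 x = some a → ∃ p, I.IsWalk s.1 I.root x p ∧ I.walkLen p = a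
  shortest : ∀ x a, s.2 x = some a → ∀ q, I.IsWalk E I.root x q → a ≤ I.walkLen q

/-- A walk that ends outside the tree leaves it somewhere. -/
theorem TreeInv.exists_leaves {E : Finset (Fin I.m)}
    {s : Finset (Fin I.m) × (Fin I.n → Option ℕ)} (h : TreeInv E s) {y : Fin I.n}
    (hy : s.2 y = none) {q : List (Fin I.m)} (hq : I.IsWalk E I.root y q) :
    ∃ e b, Leaves E s e b ∧ b ≤ I.walkLen q := by
  have key : ∀ (q₂ q₁ : List (Fin I.m)) (x : Fin I.n), s.2 x ≠ none → I.IsWalk E I.root x q₁ →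
      I.IsWalk E x y q₂ → ∃ e b, Leaves E s e b ∧ b ≤ I.walkLen (q₁ ++ q₂) := by
    intro q₂
    induction q₂ with
    | nil =>
      intro q₁ x hx _ h2
      obtain rfl : x = y := h2
      exact absurd hy hx
    | cons f q₃ ih =>
      intro q₁ x hx h1 h2
      obtain ⟨hf, rfl, h3⟩ := h2
      cases hz : s.2 (I.tgt f) with
      | none =>
        obtain ⟨a, ha⟩ := Option.ne_none_iff_exists'.1 hx
        refine ⟨f, a + I.len f, ⟨hf, ⟨a, ha, rfl⟩, hz⟩, ?_⟩
        have := h.shortest _ a ha q₁ h1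
        rw [walkLen_append, walkLen_cons]
        omega
      | some a =>
        have := ih (q₁ ++ [f]) (I.tgt f) (by simp [hz]) (isWalk_concat.2 ⟨h1, hf, rfl⟩) h3
        simpa using this
  exact key q [] I.root (by simp [h.root]) rfl hq

/-- Dijkstra's argument: any walk to the new vertex leaves the labelled set along some edge, whose
label is at most the length of the walk and at least the minimum `b`. -/
theorem TreeInv.growTree {E : Finset (Fin I.m)} {s : Finset (Fin I.m) × (Fin I.n → Option ℕ)}
    (h : TreeInv E s) : TreeInv E (I.growTree E s).val := by
  obtain ⟨hsound, hmin⟩ := nearest_spec E s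
  cases hn : (nearest E s).val with
  | none => rw [growTree_none hn]; exact h
  | some eb =>
    obtain ⟨e, b⟩ := eb
    rw [growTree_some hn]
    obtain ⟨heE, ⟨a, ha, hb⟩, hy⟩ := hsound e b hn
    have hroot : I.root ≠ I.tgt e := by
      intro h'
      rw [← h', h.root] at hy
      simp at hy
    have hne : ∀ x, s.2 x ≠ none → x ≠ I.tgt e := by
      rintro x hx rfl
      exact hx hy
    have hmono : ∀ x, s.2 x ≠ none → (if x = I.tgt e then some b else s.2 x) ≠ none := by
      intro x hx
      rw [if_neg (hne x hx)]; exact hx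
    refine ⟨Finset.insert_subset heE h.subset, ?_, ?_, ?_, ?_, ?_, ?_, ?_⟩
    · simp only [if_neg hroot]; exact h.root
    · intro f hf
      rcases Finset.mem_insert.1 hf with rfl | hf
      · exact hroot.symm
      · exact h.tgt_ne f hf
    · intro f hf
      rcases Finset.mem_insert.1 hf with rfl | hf
      · simp
      · exact hmono _ (h.tgt_mem f hf)
    · intro f hf
      rcases Finset.mem_insert.1 hf with rfl | hf
      · exact hmono _ (by simp [ha])
      · exact hmono _ (h.src_mem f hf)
    · intro f hf g hg hfg
      rcases Finset.mem_insert.1 hf with hf' | hf' <;> rcases Finset.mem_insert.1 hg with hg' | hg'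
      · rw [hf', hg']
      · rw [hf'] at hfg
        exact absurd hfg.symm (hne _ (h.tgt_mem g hg'))
      · rw [hg'] at hfg
        exact absurd hfg (hne _ (h.tgt_mem f hf'))
      · exact h.unique f hf' g hg' hfg
    · intro x a' hx
      simp only at hx
      split_ifs at hx with hxe
      · obtain rfl := Option.some.inj hx
        obtain ⟨p, hp, hpl⟩ := h.walk _ a ha
        refine ⟨p ++ [e], isWalk_concat.2 ⟨hp.mono (Finset.subset_insert _ _),
          Finset.mem_insert_self _ _, hxe.symm⟩, ?_⟩
        simp [hpl, hb]
      · obtain ⟨p, hp, hpl⟩ := h.walk _ a' hx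
        exact ⟨p, hp.mono (Finset.subset_insert _ _), hpl⟩
    · intro x a' hx q hq
      simp only at hx
      split_ifs at hx with hxe
      · obtain rfl := Option.some.inj hx
        subst hxe
        obtain ⟨f, b', hl, hle⟩ := h.exists_leaves hy hq
        obtain ⟨eb, heb, hle'⟩ := hmin f b' hl
        rw [hn] at heb
        obtain rfl := Option.some.inj heb
        exact hle'.trans hle
      · exact h.shortest x a' hx q hq

theorem shortestPathTree_val (E : Finset (Fin I.m)) :
    (I.shortestPathTree E).val = (Timed.fold (List.range I.n)
      (∅, fun x => if x = I.root then some 0 else none) fun s _ => I.growTree E s).val.1 := by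
  unfold shortestPathTree
  simp only [Timed.val_bind, Timed.val_pure]
  congr 4
  funext x
  by_cases hx : x = I.root <;> simp [hx]

theorem shortestPathTree_spec (E : Finset (Fin I.m)) :
    (I.shortestPathTree E).val ⊆ E ∧ I.IsRootedTree (I.shortestPathTree E).val ∧
    ∀ x q, I.IsWalk E I.root x q →
      ∃ p, I.IsWalk (I.shortestPathTree E).val I.root x p ∧ I.walkLen p ≤ I.walkLen q := by
  rw [shortestPathTree_val]
  set s₀ : Finset (Fin I.m) × (Fin I.n → Option ℕ) :=
    (∅, fun x => if x = I.root then some 0 else none) with hs₀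
  have h₀ : TreeInv E s₀ := by
    refine ⟨Finset.empty_subset _, by simp [hs₀], by simp [hs₀], by simp [hs₀], by simp [hs₀],
      by simp [hs₀], ?_, ?_⟩
    · intro x a hx
      simp only [hs₀] at hx
      split_ifs at hx with h
      exact ⟨[], h.symm, Option.some.inj hx⟩
    · intro x a hx q _
      simp only [hs₀] at hx
      split_ifs at hx with h
      rw [← Option.some.inj hx]; exact Nat.zero_le _
  -- Either the search has already come to rest, or every round so far has labelled a new vertex.
  have hrounds : ∀ (l : List ℕ) (s : Finset (Fin I.m) × (Fin I.n → Option ℕ)), TreeInv E s →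
      (nearest E (Timed.fold l s fun s _ => I.growTree E s).val).val = none ∨
      (Finset.univ.filter fun x => s.2 x ≠ none).card + l.length ≤
        (Finset.univ.filter fun x =>
          (Timed.fold l s fun s _ => I.growTree E s).val.2 x ≠ none).card := by
    intro l
    induction l with
    | nil => exact fun s _ => Or.inr le_rfl
    | cons j l ih =>
      intro s hs
      rw [Timed.val_fold_cons]
      cases hn : (nearest E s).val with
      | none =>
        left
        rw [growTree_none hn]
        exact Timed.fold_inv (fun s' => (nearest E s').val = none) hn
          fun s' _ _ h' => by rw [growTree_none h']; exact h'
      | some eb =>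
        obtain ⟨e, b⟩ := eb
        refine (ih _ hs.growTree).imp id fun h => ?_
        refine le_trans ?_ h
        obtain ⟨-, -, hy⟩ := (nearest_spec E s).1 e b hn
        have hlt : (Finset.univ.filter fun x => s.2 x ≠ none).card <
            (Finset.univ.filter fun x => (I.growTree E s).val.2 x ≠ none).card := by
          refine Finset.card_lt_card ⟨fun x hx => ?_, fun hsub => ?_⟩
          · rw [growTree_some hn]
            have hx := (Finset.mem_filter.1 hx).2
            refine Finset.mem_filter.2 ⟨Finset.mem_univ _, ?_⟩
            simp only
            split_ifs
            · simp
            · exact hx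
          · have : I.tgt e ∈ Finset.univ.filter fun x => s.2 x ≠ none := hsub (by
              rw [growTree_some hn]; simp)
            exact (Finset.mem_filter.1 this).2 hy
        rw [List.length_cons]
        omega
  set s := (Timed.fold (List.range I.n) s₀ fun s _ => I.growTree E s).val
  have hinv : TreeInv E s := Timed.fold_inv (TreeInv E) h₀ fun s' _ _ h' => h'.growTree
  have hdone : (nearest E s).val = none := by
    refine (hrounds (List.range I.n) s₀ h₀).resolve_right fun h => ?_
    -- The root is labelled from the start, so `n` productive rounds would label `n + 1` vertices.
    have h1 : 1 ≤ (Finset.univ.filter fun x => s₀.2 x ≠ none).card :=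
      Finset.card_pos.2 ⟨I.root, by simp [hs₀]⟩
    have h2 := h.trans (Finset.card_le_univ _)
    rw [List.length_range, Fintype.card_fin] at h2
    omega
  refine ⟨hinv.subset, ⟨hinv.tgt_ne, hinv.unique, fun e he => ?_⟩, fun x q hq => ?_⟩
  · obtain ⟨a, ha⟩ := Option.ne_none_iff_exists'.1 (hinv.src_mem e he)
    obtain ⟨p, hp, -⟩ := hinv.walk _ a ha
    exact ⟨p, hp⟩
  · cases hx : s.2 x with
    | none =>
      obtain ⟨e, b, hl, -⟩ := hinv.exists_leaves hx hq
      obtain ⟨_, h, -⟩ := (nearest_spec E s).2 e b hl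
      rw [hdone] at h
      simp at h
    | some a =>
      obtain ⟨p, hp, hpl⟩ := hinv.walk x a hx
      exact ⟨p, hp, hpl ▸ hinv.shortest x a hx q hq⟩

theorem algorithm_val_of_some {i N : ℕ} {S : Partial I}
    (h : (I.shallowLight N i I.root I.R (fun u => ((N + 1 : ℕ) : ℤ) * I.d u) I.R.card).val
      = some S) :
    (I.algorithm i N).val = some (I.shortestPathTree S.edges).val := by
  have hδ : (Timed.table fun u : Fin I.n => (do
      let a ← Timed.get I.d u
      let b ← Timed.mul (N + 1) a
      pure (b : ℤ) : Timed ℤ)).val = fun u => ((N + 1 : ℕ) : ℤ) * I.d u := by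
    funext u
    simp
  unfold algorithm
  simp only [Timed.val_bind, Timed.val_card]
  rw [hδ, h]
  rfl

/-- The approximation guarantee. -/
theorem algorithm_approximates (i : ℕ) : ∃ F : ℝ, 0 ≤ F ∧ ∀ (I : SLProblem) (N : ℕ), 0 < N →
    (∃ T, I.IsFeasible T) → ∃ T, (I.algorithm (i + 1) N).val = some T ∧
      I.IsSolution (1 + 1 / N) T ∧ ∀ T', I.IsFeasible T' →
        (I.totalCost T : ℝ) ≤ F * (I.R.card : ℝ) ^ (1 / (i + 1 : ℝ)) * I.totalCost T' := by
  obtain ⟨F, hF, happ⟩ := shallowLight_approximates i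
  refine ⟨F, hF, fun I N hN ⟨T₀, hT₀⟩ => ?_⟩
  have hrun : ∀ T, I.IsFeasible T → ∃ S, (I.shallowLight N (i + 1) I.root I.R
      (fun u => ((N + 1 : ℕ) : ℤ) * I.d u) I.R.card).val = some S ∧
      (I.totalCost S.edges : ℝ) ≤
        F * (I.R.card : ℝ) ^ (1 / (i + 1 : ℝ)) * I.totalCost T := by
    intro T hT
    obtain ⟨c, hc, hcT⟩ := hT.spans (N + 1)
    obtain ⟨S, hS, hle⟩ := happ I N hN _ _ _ _ _ _ hc subset_rfl le_rfl
    refine ⟨S, hS, hle.trans (mul_le_mul_of_nonneg_left (by exact_mod_cast hcT) ?_)⟩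
    positivity
  obtain ⟨S, hS, -⟩ := hrun T₀ hT₀
  obtain ⟨hsub, htree, hdist⟩ := shortestPathTree_spec S.edges
  obtain ⟨h1, h2, h3⟩ := shallowLight_sound N (i + 1) _ _ _ _ _ hS
  refine ⟨_, algorithm_val_of_some hS, ⟨htree, fun v hv => ?_⟩, fun T' hT' => ?_⟩
  -- As many terminals as there are in `R` are served, hence all of them.
  · rw [← Finset.eq_of_subset_of_card_le h1 h2.ge] at hv
    obtain ⟨q, hq, hl⟩ := h3 v hv
    obtain ⟨p, hp, hpl⟩ := hdist v q hq
    refine ⟨p, hp, ?_⟩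
    have hN' : (0 : ℝ) < N := by exact_mod_cast hN
    have h4 : (N * I.walkLen p : ℝ) ≤ (N + 1) * I.d v := by
      have h5 : (N * I.walkLen p : ℤ) ≤ ((N + 1 : ℕ) : ℤ) * I.d v :=
        le_trans (by exact_mod_cast Nat.mul_le_mul_left N hpl) hl
      exact_mod_cast h5
    have h6 : (N : ℝ) * ((1 + 1 / N) * I.d v) = (N + 1) * I.d v := by
      field_simp
    rw [← h6] at h4
    exact le_of_mul_le_mul_left h4 hN'
  -- The run does not depend on `T'`, so the same subgraph is compared with every feasible solution.
  · obtain ⟨S', hS', hle⟩ := hrun T' hT'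
    obtain rfl := Option.some.inj (hS.symm.trans hS')
    exact le_trans (by exact_mod_cast totalCost_mono hsub) hle

end SLProblem

/-! ### Step counts of the primitives -/

namespace Timed
variable {α β : Type}

theorem size_le_of_lt_two_pow {a s : ℕ} (h : a < 2 ^ s) : a.size ≤ s := Nat.size_le.2 h

theorem size_le_of_le {a s : ℕ} (h : a ≤ s) : a.size ≤ s :=
  Nat.size_le.2 (h.trans_lt Nat.lt_two_pow_self)

theorem size_mul_le {a b s t : ℕ} (ha : a.size ≤ s) (hb : b.size ≤ t) : (a * b).size ≤ s + t := by
  rw [Nat.size_le] at *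
  rw [pow_add]
  exact Nat.mul_lt_mul'' ha hb

theorem spec_get {ι : Type} (f : ι → α) (i : ι) : Spec (get f i) (· = f i) 1 := ⟨rfl, le_rfl⟩

theorem spec_add {a b s t : ℕ} (ha : a.size ≤ s) (hb : b.size ≤ t) :
    Spec (add a b) (· = a + b) (1 + s + t) :=
  ⟨rfl, Nat.add_le_add (Nat.add_le_add le_rfl ha) hb⟩

theorem spec_sub {a b s t : ℕ} (ha : a.size ≤ s) (hb : b.size ≤ t) :
    Spec (sub a b) (· = a - b) (1 + s + t) :=
  ⟨rfl, Nat.add_le_add (Nat.add_le_add le_rfl ha) hb⟩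

theorem spec_mul {a b s t : ℕ} (ha : a.size ≤ s) (hb : b.size ≤ t) :
    Spec (mul a b) (· = a * b) ((1 + s) * (1 + t)) :=
  ⟨rfl, Nat.mul_le_mul (Nat.add_le_add_left ha 1) (Nat.add_le_add_left hb 1)⟩

theorem spec_div {a b s t : ℕ} (ha : a.size ≤ s) (hb : b.size ≤ t) :
    Spec (div a b) (· = a / b) ((1 + s) * (1 + t)) :=
  ⟨rfl, Nat.mul_le_mul (Nat.add_le_add_left ha 1) (Nat.add_le_add_left hb 1)⟩

theorem spec_lt {a b s t : ℕ} (ha : a.size ≤ s) (hb : b.size ≤ t) :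
    Spec (lt a b) (· = decide (a < b)) (1 + s + t) :=
  ⟨rfl, Nat.add_le_add (Nat.add_le_add le_rfl ha) hb⟩

theorem spec_le {a b s t : ℕ} (ha : a.size ≤ s) (hb : b.size ≤ t) :
    Spec (le a b) (· = decide (a ≤ b)) (1 + s + t) :=
  ⟨rfl, Nat.add_le_add (Nat.add_le_add le_rfl ha) hb⟩

theorem spec_bits {a s : ℕ} (ha : a.size ≤ s) : Spec (bits a) (· = a.size) (1 + s) :=
  ⟨rfl, Nat.add_le_add_left ha 1⟩

theorem spec_intSub {a : ℤ} {b s t : ℕ} (ha : a.natAbs.size ≤ s) (hb : b.size ≤ t) :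
    Spec (intSub a b) (· = a - b) (1 + s + t) :=
  ⟨rfl, Nat.add_le_add (Nat.add_le_add le_rfl ha) hb⟩

theorem spec_toNat? {a : ℤ} {s : ℕ} (ha : a.natAbs.size ≤ s) :
    Spec (toNat? a) (· = if a < 0 then none else some a.toNat) (1 + s) :=
  ⟨rfl, Nat.add_le_add_left ha 1⟩

theorem spec_finSub {k : ℕ} {a : Fin k} {b s t : ℕ} (ha : a.val.size ≤ s) (hb : b.size ≤ t) :
    Spec (finSub a b) (fun _ => True) (1 + s + t) :=
  ⟨trivial, Nat.add_le_add (Nat.add_le_add le_rfl ha) hb⟩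

theorem spec_eq {k s : ℕ} (hk : k ≤ s) (a b : Fin k) : Spec (eq a b) (fun _ => True) (1 + s + s) :=
  ⟨trivial, Nat.add_le_add (Nat.add_le_add le_rfl (size_le_of_le (a.isLt.le.trans hk)))
    (size_le_of_le (b.isLt.le.trans hk))⟩

theorem spec_mem {ι : Type} [DecidableEq ι] (i : ι) (s : Finset ι) :
    Spec (mem i s) (fun _ => True) 1 := ⟨trivial, le_rfl⟩

theorem spec_insert {ι : Type} [Fintype ι] [DecidableEq ι] {c : ℕ} (hc : Fintype.card ι ≤ c)
    (i : ι) (s : Finset ι) : Spec (Timed.insert i s) (fun _ => True) (1 + c) :=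
  ⟨trivial, Nat.add_le_add_left hc 1⟩

theorem spec_union {ι : Type} [Fintype ι] [DecidableEq ι] {c : ℕ} (hc : Fintype.card ι ≤ c)
    (s t : Finset ι) : Spec (union s t) (fun _ => True) (1 + c) :=
  ⟨trivial, Nat.add_le_add_left hc 1⟩

theorem spec_sdiff {ι : Type} [Fintype ι] [DecidableEq ι] {c : ℕ} (hc : Fintype.card ι ≤ c)
    (s t : Finset ι) : Spec (sdiff s t) (fun _ => True) (1 + c) :=
  ⟨trivial, Nat.add_le_add_left hc 1⟩

theorem spec_card {ι : Type} [Fintype ι] {c : ℕ} (hc : Fintype.card ι ≤ c) (s : Finset ι) :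
    Spec (card s) (· ≤ c) (1 + c) :=
  ⟨(Finset.card_le_univ s).trans hc, Nat.add_le_add_left hc 1⟩

theorem spec_keepMin {key : α → ℕ} {best : Option α} {a : α} {Q : α → Prop} {s : ℕ}
    (hbest : ∀ b, best = some b → Q b) (ha : Q a) (hs : ∀ b, Q b → (key b).size ≤ s) :
    Spec (keepMin key best a) (fun x => ∀ b, x = some b → Q b) (1 + s + s) := by
  unfold keepMin
  cases best with
  | none =>
    refine Spec.pure fun b hb => ?_
    obtain rfl := Option.some.inj hb
    exact ha
  | some b =>
    refine Spec.bind (t := 0) (spec_lt (hs a ha) (hs b (hbest b rfl))) le_rfl fun _ _ => ?_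
    split
    · refine Spec.pure fun b hb => ?_
      obtain rfl := Option.some.inj hb
      exact ha
    · exact Spec.pure hbest

/-- A loop with an invariant that depends on the number of rounds. -/
theorem Spec.fold_index {l : List α} {b : β} {f : β → α → Timed β} {Inv : ℕ → β → Prop}
    {t c u : ℕ} (hb : Inv 0 b) (hc : l.length ≤ c) (hu : 1 + c * (1 + t) ≤ u)
    (h : ∀ j, j < c → ∀ b, ∀ a ∈ l, Inv j b → Spec (f b a) (Inv (j + 1)) t) :
    Spec (Timed.fold l b f) (Inv l.length) u := by
  have key : ∀ (l : List α) (j : ℕ) (b : β), j + l.length ≤ c → Inv j b →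
      (∀ j, j < c → ∀ b, ∀ a ∈ l, Inv j b → Spec (f b a) (Inv (j + 1)) t) →
      Spec (Timed.fold l b f) (Inv (j + l.length)) (1 + l.length * (1 + t)) := by
    intro l
    induction l with
    | nil => exact fun j b _ hb _ => ⟨hb, by simp [Timed.fold]⟩
    | cons a l ih =>
      intro j b hj hb h
      rw [List.length_cons] at hj
      obtain ⟨h1, h2⟩ := h j (by omega) b a (by simp) hb
      obtain ⟨h3, h4⟩ := ih (j + 1) _ (by omega) h1 fun j hj b x hx => h j hj b x (by simp [hx])
      have h5 : (Timed.fold (a :: l) b f).time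
          = (f b a).time + ((Timed.fold l (f b a).val f).time + 1) := rfl
      refine ⟨?_, ?_⟩
      · rw [List.length_cons, val_fold_cons, show j + (l.length + 1) = j + 1 + l.length by omega]
        exact h3
      · rw [h5, List.length_cons, Nat.succ_mul]
        omega
  have := key l 0 b (by omega) hb h
  rw [Nat.zero_add] at this
  exact this.le ((Nat.add_le_add_left (Nat.mul_le_mul_right _ hc) 1).trans hu)

end Timed

/-! ### Running time of the subroutines -/

namespace SLProblem

open Timed (Spec)

variable {I : SLProblem}

/-- `X` bounds all parameters and the bit lengths of all numbers of the input. -/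
structure InputBound (I : SLProblem) (N X : ℕ) : Prop where
  large : 1000 ≤ X
  n_le : I.n ≤ X
  m_le : I.m ≤ X
  N_lt : N + 1 ≤ X
  cost_lt : ∀ e, I.cost e < 2 ^ X
  len_lt : ∀ e, I.len e < 2 ^ X
  d_lt : ∀ v, I.d v < 2 ^ X

theorem pow_chain {X : ℕ} (h : 1000 ≤ X) (k : ℕ) : 1000 * X ^ k ≤ X ^ (k + 1) := by
  rw [pow_succ']
  exact Nat.mul_le_mul_right _ h

/-- As `X ≥ 1000`, each power of `X` absorbs the constants and lower powers; crude polynomial bounds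
thereby reduce to linear arithmetic in the powers of `X`. -/
theorem pow_chains {X : ℕ} (h : 1000 ≤ X) :
    1000 * X ≤ X ^ 2 ∧ 1000 * X ^ 2 ≤ X ^ 3 ∧ 1000 * X ^ 3 ≤ X ^ 4 ∧ 1000 * X ^ 4 ≤ X ^ 5 ∧
    1000 * X ^ 5 ≤ X ^ 6 ∧ 1000 * X ^ 6 ≤ X ^ 7 ∧ 1000 * X ^ 7 ≤ X ^ 8 ∧ 1000 * X ^ 8 ≤ X ^ 9 ∧
    1000 * X ^ 9 ≤ X ^ 10 ∧ 1000 * X ^ 10 ≤ X ^ 11 ∧ 1000 * X ^ 11 ≤ X ^ 12 ∧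
    1000 * X ^ 12 ≤ X ^ 13 ∧ 1000 * X ^ 13 ≤ X ^ 14 ∧ 1000 * X ^ 14 ≤ X ^ 15 ∧
    1000 * X ^ 15 ≤ X ^ 16 ∧ 1000 * X ^ 16 ≤ X ^ 17 ∧ 1000 * X ^ 17 ≤ X ^ 18 := by
  refine ⟨?_, pow_chain h 2, pow_chain h 3, pow_chain h 4, pow_chain h 5, pow_chain h 6,
    pow_chain h 7, pow_chain h 8, pow_chain h 9, pow_chain h 10, pow_chain h 11, pow_chain h 12,
    pow_chain h 13, pow_chain h 14, pow_chain h 15, pow_chain h 16, pow_chain h 17⟩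
  simpa using pow_chain h 1

/-- Sums of at most `X` input numbers fit into `2 * X` bits. -/
theorem mul_two_pow_lt {t X : ℕ} (ht : t ≤ X) : t * 2 ^ X < 2 ^ (2 * X) := by
  rw [two_mul, pow_add]
  exact Nat.mul_lt_mul_of_pos_right (ht.trans_lt Nat.lt_two_pow_self) (Nat.two_pow_pos X)

/-- The path has at most `t` edges, and its numbers are bounded accordingly. -/
def SmallPath (I : SLProblem) (X t : ℕ) (P : Path I) : Prop :=
  P.edges.length ≤ t ∧ P.len ≤ t * 2 ^ X ∧ P.cost ≤ t * 2 ^ X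

theorem SmallPath.len_size {X t : ℕ} {P : Path I} (h : SmallPath I X t P) (ht : t ≤ X) :
    P.len.size ≤ 2 * X :=
  Timed.size_le_of_lt_two_pow (h.2.1.trans_lt (mul_two_pow_lt ht))

theorem SmallPath.cost_size {X t : ℕ} {P : Path I} (h : SmallPath I X t P) (ht : t ≤ X) :
    P.cost.size ≤ 2 * X :=
  Timed.size_le_of_lt_two_pow (h.2.2.trans_lt (mul_two_pow_lt ht))

theorem SmallPath.mono {X t t' : ℕ} {P : Path I} (h : SmallPath I X t P) (ht : t ≤ t') :
    SmallPath I X t' P :=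
  ⟨h.1.trans ht, h.2.1.trans (Nat.mul_le_mul_right _ ht), h.2.2.trans (Nat.mul_le_mul_right _ ht)⟩

namespace InputBound

variable {N X : ℕ}

theorem n_size (h : InputBound I N X) : I.n.size ≤ X := Timed.size_le_of_le h.n_le
theorem N_size (h : InputBound I N X) : N.size ≤ X :=
  Timed.size_le_of_le ((Nat.le_succ N).trans h.N_lt)
theorem N_succ_size (h : InputBound I N X) : (N + 1).size ≤ X := Timed.size_le_of_le h.N_lt
theorem cost_size (h : InputBound I N X) (e : Fin I.m) : (I.cost e).size ≤ X :=
  Timed.size_le_of_lt_two_pow (h.cost_lt e)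
theorem len_size (h : InputBound I N X) (e : Fin I.m) : (I.len e).size ≤ X :=
  Timed.size_le_of_lt_two_pow (h.len_lt e)
theorem card_n (h : InputBound I N X) : Fintype.card (Fin I.n) ≤ X := by simpa using h.n_le
theorem card_m (h : InputBound I N X) : Fintype.card (Fin I.m) ≤ X := by simpa using h.m_le
theorem length_n (h : InputBound I N X) : (List.finRange I.n).length ≤ X := by simpa using h.n_le
theorem length_m (h : InputBound I N X) : (List.finRange I.m).length ≤ X := by simpa using h.m_le

theorem scaledCost (h : InputBound I N X) {c₀ : ℕ} (hc₀ : c₀.size ≤ X) :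
    Spec (I.scaledCost N c₀) (fun σ => ∀ e s, σ e = some s → s.size ≤ 3 * X) (X ^ 4) := by
  refine Spec.table (P := fun _ o => ∀ s : ℕ, o = some s → s.size ≤ 3 * X)
    (t := 1 + ((1 + X + X) + ((1 + X) * (1 + X) + ((1 + X) * (1 + (X + X)) +
      ((1 + (X + (X + X))) * (1 + X) + 0))))) h.card_m ?_ fun e => ?_
  · have := pow_chains h.large
    linarith [h.large]
  refine Spec.bind (Timed.spec_get _ _) le_rfl ?_
  rintro _ rfl
  refine Spec.bind (Timed.spec_le (h.cost_size e) hc₀) le_rfl ?_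
  rintro _ -
  split
  · refine Spec.bind (Timed.spec_mul h.n_size h.N_size) le_rfl ?_
    rintro _ rfl
    have hK := Timed.size_mul_le h.n_size h.N_size
    refine Spec.bind (Timed.spec_mul (h.cost_size e) hK) le_rfl ?_
    rintro _ rfl
    have hcK := Timed.size_mul_le (h.cost_size e) hK
    refine Spec.bind (Timed.spec_div hcK hc₀) le_rfl ?_
    rintro _ rfl
    refine Spec.pure fun s hs => ?_
    obtain rfl := Option.some.inj hs
    have := Nat.size_le_size (Nat.div_le_self (I.cost e * (I.n * N)) c₀)
    omega
  · exact Spec.pure (by simp)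

theorem relax (h : InputBound I N X) {σ : Fin I.m → Option ℕ}
    (hσ : ∀ e s, σ e = some s → s.size ≤ 3 * X) {B : ℕ} (hB : B ≤ X ^ 3) {t : ℕ} (ht : t + 1 ≤ X)
    {f : Fin I.n × Fin (B + 1) → Option (Path I)}
    (hf : ∀ xb P, f xb = some P → SmallPath I X t P)
    (xb : Fin I.n × Fin (B + 1)) {best : Option (Path I)}
    (hbest : ∀ P, best = some P → SmallPath I X (t + 1) P) (e : Fin I.m) :
    Spec (relax σ B f xb best e) (fun x => ∀ P, x = some P → SmallPath I X (t + 1) P) (X ^ 2) := by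
  have hb : ∀ b : Fin (B + 1), b.val.size ≤ 3 * X := by
    intro b
    refine Timed.size_le_of_lt_two_pow ((Nat.le_of_lt_succ b.isLt).trans_lt (hB.trans_lt ?_))
    rw [mul_comm, pow_mul]
    exact Nat.pow_lt_pow_left Nat.lt_two_pow_self (by norm_num)
  refine Spec.le (s := 1 + ((1 + X + X) + (1 + ((1 + 3 * X + 3 * X) + ((1 + 3 * X + 3 * X) +
    (1 + (1 + (1 + (1 + ((1 + 2 * X + X) + ((1 + 2 * X + X) + (1 + 2 * X + 2 * X)))))))))))) ?_ ?_
  swap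
  · have := pow_chains h.large
    linarith [h.large]
  unfold SLProblem.relax
  refine Spec.bind (Timed.spec_get _ _) le_rfl ?_
  rintro _ rfl
  refine Spec.bind (Timed.spec_eq h.n_le _ _) le_rfl fun _ _ => ?_
  split
  · refine Spec.bind (Timed.spec_get _ _) le_rfl ?_
    rintro _ rfl
    split
    · exact Spec.pure hbest
    · rename_i s hs
      refine Spec.bind (Timed.spec_le (hσ e s hs) (hb _)) le_rfl fun _ _ => ?_
      split
      · refine Spec.bind (Timed.spec_finSub (hb _) (hσ e s hs)) le_rfl fun b _ => ?_
        refine Spec.bind (Timed.spec_get _ _) le_rfl ?_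
        rintro _ rfl
        refine Spec.bind (Timed.spec_get _ _) le_rfl ?_
        rintro _ rfl
        split
        · exact Spec.pure hbest
        · rename_i p hp
          have hp := hf _ p hp
          refine Spec.bind (Timed.spec_get _ _) le_rfl ?_
          rintro _ rfl
          refine Spec.bind (Timed.spec_get _ _) le_rfl ?_
          rintro _ rfl
          refine Spec.bind (Timed.spec_add (hp.len_size (by omega)) (h.len_size e)) le_rfl ?_
          rintro _ rfl
          refine Spec.bind (Timed.spec_add (hp.cost_size (by omega)) (h.cost_size e)) le_rfl ?_
          rintro _ rfl
          refine Timed.spec_keepMin hbest ?_ fun P hP => hP.len_size ht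
          refine ⟨by simpa using hp.1, ?_, ?_⟩
          · rw [Nat.succ_mul]
            exact Nat.add_le_add hp.2.1 (h.len_lt e).le
          · rw [Nat.succ_mul]
            exact Nat.add_le_add hp.2.2 (h.cost_lt e).le
      · exact Spec.pure hbest
  · exact Spec.pure hbest

/-- A round fills about `X * X ^ 3` entries with at most `X` relaxations of `X ^ 2` steps each, well
below `X ^ 10`. -/
theorem walkTable (h : InputBound I N X) {σ : Fin I.m → Option ℕ}
    (hσ : ∀ e s, σ e = some s → s.size ≤ 3 * X) {B : ℕ} (hB : B ≤ X ^ 3) (u : Fin I.n) {t : ℕ}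
    (ht : t ≤ X) :
    Spec (I.walkTable σ B u t) (fun f => ∀ xb P, f xb = some P → SmallPath I X t P)
      ((t + 1) * X ^ 10) := by
  have hcard : Fintype.card (Fin I.n × Fin (B + 1)) ≤ X * (X ^ 3 + 1) := by
    rw [Fintype.card_prod, Fintype.card_fin, Fintype.card_fin]
    exact Nat.mul_le_mul h.n_le (Nat.succ_le_succ hB)
  have hc := pow_chains h.large
  induction t with
  | zero =>
    refine Spec.table (P := fun _ o => ∀ P, o = some P → SmallPath I X 0 P)
      (t := (1 + X + X) + 0) hcard ?_ fun xb => ?_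
    · linarith [h.large]
    refine Spec.bind (Timed.spec_eq h.n_le _ _) le_rfl fun _ _ => ?_
    split
    · refine Spec.pure fun P hP => ?_
      obtain rfl := Option.some.inj hP
      exact ⟨le_rfl, Nat.zero_le _, Nat.zero_le _⟩
    · exact Spec.pure (by simp)
  | succ t ih =>
    rw [walkTable_succ]
    refine Spec.bind (ih (by omega)) (t := X ^ 10) (by rw [Nat.succ_mul (t + 1)]) fun f hf => ?_
    refine Spec.table (P := fun _ o => ∀ P, o = some P → SmallPath I X (t + 1) P)
      (t := 1 + (1 + X * (1 + X ^ 2))) hcard ?_ fun xb => ?_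
    · linarith [h.large]
    refine Spec.bind (Timed.spec_get _ _) le_rfl ?_
    rintro _ rfl
    refine Spec.fold (fun P hP => (hf xb P hP).mono (Nat.le_succ t)) h.length_m le_rfl ?_
    exact fun best e _ hbest => h.relax hσ hB ht hf xb hbest e

theorem guessPath (h : InputBound I N X) (u v : Fin I.n) {D B : ℕ} (hD : D.size ≤ X ^ 4)
    (hB : B ≤ X ^ 3) {best : Option (Path I)}
    (hbest : ∀ P, best = some P → SmallPath I X I.n P) {c₀ : ℕ} (hc₀ : c₀.size ≤ X) :
    Spec (guessPath N u v D B best c₀) (fun x => ∀ P, x = some P → SmallPath I X I.n P)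
      (X ^ 13) := by
  have hc := pow_chains h.large
  refine Spec.le (s := X ^ 4 + ((X + 1) * X ^ 10 + (1 + (X ^ 3 + 1) * (1 + (1 +
    ((1 + 2 * X + X ^ 4) + (1 + 2 * X + 2 * X))))))) ?_ ?_
  swap
  · linarith [h.large]
  unfold SLProblem.guessPath
  refine Spec.bind (h.scaledCost hc₀) le_rfl fun σ hσ => ?_
  refine Spec.bind ((h.walkTable hσ hB u h.n_le).le
    (Nat.mul_le_mul_right _ (Nat.succ_le_succ h.n_le))) le_rfl fun f hf => ?_
  refine Spec.fold hbest (by simpa using hB) le_rfl fun best b _ hbest => ?_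
  refine Spec.bind (Timed.spec_get _ _) le_rfl ?_
  rintro _ rfl
  split
  · exact Spec.pure hbest
  · rename_i p hp
    have hp := hf _ p hp
    refine Spec.bind (Timed.spec_le (hp.len_size h.n_le) hD) le_rfl fun _ _ => ?_
    split
    · exact Timed.spec_keepMin hbest hp fun P hP => hP.cost_size h.n_le
    · exact Spec.pure hbest

theorem minCostPath (h : InputBound I N X) (u v : Fin I.n) {D : ℕ} (hD : D.size ≤ X ^ 4) :
    Spec (I.minCostPath N u v D) (fun x => ∀ P, x = some P → SmallPath I X I.n P) (X ^ 15) := by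
  have hc := pow_chains h.large
  refine Spec.le (s := (1 + X) * (1 + X) + ((1 + (X + X)) * (1 + X) + (X ^ 13 +
    (1 + X * (1 + (1 + X ^ 13)))))) ?_ ?_
  swap
  · linarith [h.large]
  rw [minCostPath_eq]
  refine Spec.bind (Timed.spec_mul h.n_size h.n_size) le_rfl ?_
  rintro _ rfl
  refine Spec.bind (Timed.spec_mul (Timed.size_mul_le h.n_size h.n_size) h.N_size) le_rfl ?_
  rintro _ rfl
  have hB : I.n * I.n * N ≤ X ^ 3 := by
    rw [pow_three']
    exact Nat.mul_le_mul (Nat.mul_le_mul h.n_le h.n_le) ((Nat.le_succ N).trans h.N_lt)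
  refine Spec.bind (h.guessPath u v hD hB (by simp) (by simp)) le_rfl fun best hbest => ?_
  refine Spec.fold hbest h.length_m le_rfl fun best e _ hbest => ?_
  refine Spec.bind (Timed.spec_get _ _) le_rfl ?_
  rintro _ rfl
  exact h.guessPath u v hD hB hbest (h.cost_size e)

theorem addPath (h : InputBound I N X) (E : Finset (Fin I.m)) {P : Path I}
    (hP : SmallPath I X I.n P) : Spec (I.addPath E P) (fun _ => True) (X ^ 3) := by
  have hc := pow_chains h.large
  refine Spec.fold (t := 1 + X) trivial (hP.1.trans h.n_le) ?_ fun E e _ _ => ?_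
  · linarith [h.large]
  · exact Timed.spec_insert h.card_m _ _

theorem costOf (h : InputBound I N X) (E : Finset (Fin I.m)) :
    Spec (I.costOf E) (fun c => c.size ≤ 2 * X) (X ^ 3) := by
  have hc := pow_chains h.large
  have key := Spec.fold_index (l := List.finRange I.m) (b := 0) (f := fun acc e => do
      if ← Timed.mem e E then
        let c ← Timed.get I.cost e
        Timed.add acc c
      else pure acc) (Inv := fun j acc => acc ≤ j * 2 ^ X) (t := 1 + (1 + (1 + 2 * X + X)))
    (c := X) (u := X ^ 3) (Nat.zero_le _) h.length_m (by linarith [h.large]) (by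
      intro j hj acc e _ hacc
      refine Spec.bind (Timed.spec_mem _ _) le_rfl fun _ _ => ?_
      split
      · refine Spec.bind (Timed.spec_get _ _) le_rfl ?_
        rintro _ rfl
        refine (Timed.spec_add (Timed.size_le_of_lt_two_pow
          (hacc.trans_lt (mul_two_pow_lt hj.le))) (h.cost_size e)).mono ?_ le_rfl
        rintro _ rfl
        rw [Nat.succ_mul]
        exact Nat.add_le_add hacc (h.cost_lt e).le
      · exact Spec.pure (hacc.trans (Nat.mul_le_mul_right _ (Nat.le_succ j))))
  exact key.mono (fun c hc => Timed.size_le_of_lt_two_pow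
    (hc.trans_lt (mul_two_pow_lt h.length_m))) le_rfl

theorem terminalPaths (h : InputBound I N X) (r : Fin I.n) (R : Finset (Fin I.n))
    {δ : Fin I.n → ℤ} (hδ : ∀ u, (δ u).natAbs < 2 ^ (4 * X)) :
    Spec (I.terminalPaths N r R δ) (fun P => ∀ t p, P t = some p → SmallPath I X I.n p)
      (X ^ 17) := by
  have hc := pow_chains h.large
  refine Spec.table (P := fun _ o => ∀ p, o = some p → SmallPath I X I.n p)
    (t := 1 + (1 + ((1 + 4 * X) + ((1 + 4 * X) * (1 + X) + X ^ 15)))) h.card_n ?_ fun t => ?_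
  · linarith [h.large]
  refine Spec.bind (Timed.spec_mem _ _) le_rfl fun _ _ => ?_
  split
  · refine Spec.bind (Timed.spec_get _ _) le_rfl ?_
    rintro _ rfl
    refine Spec.bind (Timed.spec_toNat? (Timed.size_le_of_lt_two_pow (hδ t))) le_rfl ?_
    rintro _ rfl
    split
    · exact Spec.pure (by simp)
    · rename_i a ha
      have hle : a ≤ (δ t).natAbs := by
        split_ifs at ha
        obtain rfl := Option.some.inj ha
        omega
      have hsize : a.size ≤ 4 * X := Timed.size_le_of_lt_two_pow (hle.trans_lt (hδ t))
      refine Spec.bind (Timed.spec_div hsize h.N_succ_size) le_rfl ?_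
      rintro _ rfl
      refine h.minCostPath r t ?_
      have := Nat.size_le_size (Nat.div_le_self a (N + 1))
      linarith [h.large]
  · exact Spec.pure (by simp)

theorem countPaths (h : InputBound I N X) (P : Fin I.n → Option (Path I)) :
    Spec (I.countPaths P) (fun c => c.size ≤ X) (X ^ 3) := by
  have hc := pow_chains h.large
  have key := Spec.fold_index (l := List.finRange I.n) (b := 0) (f := fun acc t => do
      match ← Timed.get P t with
      | none => pure acc
      | some _ => Timed.add acc 1) (Inv := fun j acc => acc ≤ j) (t := 1 + (1 + X + 1))
    (c := X) (u := X ^ 3) (Nat.zero_le _) h.length_n (by linarith [h.large]) (by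
      intro j hj acc t _ hacc
      refine Spec.bind (Timed.spec_get _ _) le_rfl ?_
      rintro _ rfl
      split
      · exact Spec.pure (hacc.trans (Nat.le_succ j))
      · refine (Timed.spec_add (Timed.size_le_of_le (hacc.trans hj.le)) (by simp)).mono ?_ le_rfl
        rintro _ rfl
        exact Nat.succ_le_succ hacc)
  exact key.mono (fun c hc => Timed.size_le_of_le (hc.trans h.length_n)) le_rfl

theorem cheapest (h : InputBound I N X) {P : Fin I.n → Option (Path I)}
    (hP : ∀ t p, P t = some p → SmallPath I X I.n p) (U : Finset (Fin I.n)) :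
    Spec (cheapest P U) (fun x => ∀ tp, x = some tp → SmallPath I X I.n tp.2) (X ^ 3) := by
  have hc := pow_chains h.large
  refine Spec.fold (t := 1 + (1 + (1 + 2 * X + 2 * X))) (by simp) h.length_n ?_
    fun best t _ hbest => ?_
  · linarith [h.large]
  refine Spec.bind (Timed.spec_mem _ _) le_rfl fun _ _ => ?_
  split
  · exact Spec.pure hbest
  · refine Spec.bind (Timed.spec_get _ _) le_rfl ?_
    rintro _ rfl
    split
    · exact Spec.pure hbest
    · rename_i p hp
      exact Timed.spec_keepMin (Q := fun tp : Fin I.n × Path I => SmallPath I X I.n tp.2)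
        hbest (hP t p hp) fun tp htp => htp.cost_size h.n_le

theorem addCheapest (h : InputBound I N X) {P : Fin I.n → Option (Path I)}
    (hP : ∀ t p, P t = some p → SmallPath I X I.n p) (k : ℕ) (S : Partial I) :
    Spec (I.addCheapest P k S) (fun _ => True) (k * X ^ 4) := by
  have hc := pow_chains h.large
  induction k generalizing S with
  | zero => exact Spec.pure trivial
  | succ k ih =>
    rw [addCheapest_succ]
    refine Spec.le (s := X ^ 3 + (X ^ 3 + ((1 + X) + k * X ^ 4))) ?_ ?_
    swap
    · rw [Nat.succ_mul]
      linarith [h.large]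
    refine Spec.bind (h.cheapest hP _) le_rfl fun best hbest => ?_
    match best with
    | none => exact Spec.pure trivial
    | some (t, p) =>
      refine Spec.bind (h.addPath _ (hbest _ rfl)) le_rfl fun E _ => ?_
      refine Spec.bind (Timed.spec_insert h.card_n _ _) le_rfl fun U _ => ?_
      exact ih _

end InputBound

end SLProblem

/-! ### Running time of the recursion and of the whole algorithm -/

namespace SLProblem

open Timed (Spec)

variable {I : SLProblem}

namespace InputBound

variable {N X : ℕ}

/-- There are at most `2 * X ^ 2 + 1` powers, and the numerator and denominator in round `j` are at
most `X ^ j`. Hence the bounds may have up to `X ^ 4` bits, more than the input numbers. -/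
theorem lengthBounds (h : InputBound I N X) :
    Spec (I.lengthBounds N) (fun l => l.length ≤ X ^ 3 ∧ ∀ D ∈ l, D.size ≤ X ^ 4) (X ^ 13) := by
  have hc := pow_chains h.large
  refine Spec.le (s := X ^ 3 + ((1 + 2 * X) + ((1 + X) * (1 + 2 * X) + X ^ 12))) ?_ ?_
  swap
  · linarith [h.large]
  have hsum := Spec.fold_index (l := List.finRange I.m) (b := 0) (f := fun acc e => do
      let l ← Timed.get I.len e
      Timed.add acc l) (Inv := fun j acc => acc ≤ j * 2 ^ X) (t := 1 + (1 + 2 * X + X))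
    (c := X) (u := X ^ 3) (Nat.zero_le _) h.length_m (by linarith [h.large]) (by
      intro j hj acc e _ hacc
      refine Spec.bind (Timed.spec_get _ _) le_rfl ?_
      rintro _ rfl
      refine (Timed.spec_add (Timed.size_le_of_lt_two_pow
        (hacc.trans_lt (mul_two_pow_lt hj.le))) (h.len_size e)).mono ?_ le_rfl
      rintro _ rfl
      rw [Nat.succ_mul]
      exact Nat.add_le_add hacc (h.len_lt e).le)
  unfold SLProblem.lengthBounds
  refine Spec.bind hsum le_rfl fun L hL => ?_
  have hLs : L.size ≤ 2 * X :=
    Timed.size_le_of_lt_two_pow (hL.trans_lt (mul_two_pow_lt h.length_m))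
  refine Spec.bind (Timed.spec_bits hLs) le_rfl ?_
  rintro _ rfl
  refine Spec.bind (Timed.spec_mul h.N_size (Timed.size_le_of_le hLs)) le_rfl ?_
  rintro _ rfl
  have hJ : (List.range (N * L.size + 1)).length ≤ 2 * X ^ 2 + 1 := by
    rw [List.length_range]
    have := Nat.mul_le_mul ((Nat.le_succ N).trans h.N_lt) hLs
    linarith
  have hp : ∀ {j p : ℕ}, j < 2 * X ^ 2 + 1 → p ≤ X ^ j → p.size ≤ X ^ 4 := by
    intro j p hj hp
    have h1 : p < 2 ^ (X * j + 1) := by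
      calc p ≤ (2 ^ X) ^ j := hp.trans (Nat.pow_le_pow_left Nat.lt_two_pow_self.le j)
        _ < 2 ^ (X * j + 1) := by
          rw [← pow_mul]
          exact Nat.pow_lt_pow_right (by norm_num) (Nat.lt_succ_self _)
    refine (Timed.size_le_of_lt_two_pow h1).trans ?_
    have h2 : X * j ≤ X * (2 * X ^ 2) := Nat.mul_le_mul_left _ (by omega)
    linarith [h.large]
  have hloop := Spec.fold_index (l := List.range (N * L.size + 1))
    (b := (([], 1, 1) : List ℕ × ℕ × ℕ)) (f := fun (s : List ℕ × ℕ × ℕ) _ => do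
      let b ← Timed.div s.2.1 s.2.2
      let p' ← Timed.mul s.2.1 (N + 1)
      let q' ← Timed.mul s.2.2 N
      pure (b :: s.1, p', q'))
    (Inv := fun j s => s.1.length = j ∧ (∀ D ∈ s.1, D.size ≤ X ^ 4) ∧ s.2.1 ≤ X ^ j ∧
      s.2.2 ≤ X ^ j)
    (t := (1 + X ^ 4) * (1 + X ^ 4) + ((1 + X ^ 4) * (1 + X) + ((1 + X ^ 4) * (1 + X) + 0)))
    (c := 2 * X ^ 2 + 1) (u := X ^ 12) ⟨rfl, by simp, by simp, by simp⟩ hJ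
    (by linarith [h.large]) (by
      rintro j hj ⟨acc, p, q⟩ _ - ⟨h1, h2, h3, h4⟩
      refine Spec.bind (Timed.spec_div (hp hj h3) (hp hj h4)) le_rfl ?_
      rintro _ rfl
      refine Spec.bind (Timed.spec_mul (hp hj h3) h.N_succ_size) le_rfl ?_
      rintro _ rfl
      refine Spec.bind (Timed.spec_mul (hp hj h4) h.N_size) le_rfl ?_
      rintro _ rfl
      refine Spec.pure ⟨by simpa using h1, ?_, ?_, ?_⟩
      · intro D hD
        rcases List.mem_cons.1 hD with rfl | hD
        · exact (Nat.size_le_size (Nat.div_le_self _ _)).trans (hp hj h3)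
        · exact h2 D hD
      · rw [pow_succ]
        exact Nat.mul_le_mul h3 h.N_lt
      · rw [pow_succ]
        exact Nat.mul_le_mul h4 ((Nat.le_succ N).trans h.N_lt))
  refine Spec.bind (t := 0) hloop le_rfl ?_
  rintro ⟨acc, p, q⟩ ⟨h1, h2, -, -⟩
  refine Spec.pure ⟨?_, ?_⟩
  · rw [List.length_cons]
    simp only at h1
    linarith [h.large]
  · intro D hD
    rcases List.mem_cons.1 hD with rfl | hD
    · simp
    · exact h2 D hD

/-- The invariant of `bestCandidate`. -/
def SmallCandidate (X k : ℕ) (best : Option (Candidate I)) : Prop :=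
  ∀ C, best = some C → C.cost.size ≤ 2 * X ∧ C.count ≤ k

theorem keepLighter (h : InputBound I N X) {k : ℕ} (hk : k ≤ X) {best : Option (Candidate I)}
    (hbest : SmallCandidate X k best) {a : Candidate I} (ha : a.cost.size ≤ 2 * X)
    (hak : a.count ≤ k) : Spec (I.keepLighter best a) (SmallCandidate X k) (X ^ 3) := by
  have hc := pow_chains h.large
  have hsome : ∀ a : Candidate I, a.cost.size ≤ 2 * X → a.count ≤ k →
      SmallCandidate X k (some a) := by
    intro a h1 h2 C hC
    obtain rfl := Option.some.inj hC
    exact ⟨h1, h2⟩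
  unfold SLProblem.keepLighter
  match best with
  | none => exact Spec.pure (hsome a ha hak)
  | some b =>
    obtain ⟨h1, h2⟩ := hbest b rfl
    have hbs : b.count.size ≤ X := Timed.size_le_of_le (h2.trans hk)
    have has : a.count.size ≤ X := Timed.size_le_of_le (hak.trans hk)
    refine Spec.le (s := (1 + 2 * X) * (1 + X) + ((1 + 2 * X) * (1 + X) +
      ((1 + (2 * X + X) + (2 * X + X)) + 0))) ?_ ?_
    swap
    · linarith [h.large]
    refine Spec.bind (Timed.spec_mul ha hbs) le_rfl ?_
    rintro _ rfl
    refine Spec.bind (Timed.spec_mul h1 has) le_rfl ?_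
    rintro _ rfl
    refine Spec.bind (Timed.spec_lt (Timed.size_mul_le ha hbs) (Timed.size_mul_le h1 has))
      le_rfl fun _ _ => ?_
    split
    · exact Spec.pure (hsome a ha hak)
    · exact Spec.pure (hsome b h1 h2)

/-- Subtracting `N * P.len < 2 ^ (3 * X)` may make budgets negative and increases their absolute
values by less than that amount. So the recursive call is timed for budgets below `b + 2 ^ (3 * X)`.
-/
theorem tryCandidate (h : InputBound I N X) {rec : Procedure I} {T b : ℕ}
    (hb : b + 2 ^ (3 * X) ≤ 2 ^ (4 * X))
    (hrec : ∀ r R δ k, k ≤ X → (∀ u, (δ u).natAbs < b + 2 ^ (3 * X)) →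
      Spec (rec r R δ k) (fun _ => True) T)
    {δ : Fin I.n → ℤ} (hδ : ∀ u, (δ u).natAbs < b) (R : Finset (Fin I.n)) (r v : Fin I.n)
    {k k' : ℕ} (hk : k ≤ X) (hk' : k' ≤ k) {best : Option (Candidate I)}
    (hbest : SmallCandidate X k best) {D : ℕ} (hD : D.size ≤ X ^ 4) :
    Spec (tryCandidate N rec R δ r v k' best D) (SmallCandidate X k) (T + X ^ 16) := by
  have hc := pow_chains h.large
  refine Spec.le (s := X ^ 15 + ((1 + X) * (1 + 2 * X) + ((1 + X * (1 + (1 +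
    (1 + 4 * X + (X + 2 * X))))) + (T + (X ^ 3 + (X ^ 3 + X ^ 3)))))) ?_ ?_
  swap
  · linarith [h.large]
  unfold SLProblem.tryCandidate
  refine Spec.bind (h.minCostPath r v hD) le_rfl fun P hP => ?_
  match P with
  | none => exact Spec.pure hbest
  | some P =>
    have hP := hP P rfl
    have hlen := hP.len_size h.n_le
    refine Spec.bind (Timed.spec_mul h.N_size hlen) le_rfl ?_
    rintro _ rfl
    have hshift : N * P.len < 2 ^ (3 * X) := by
      have := Timed.size_mul_le h.N_size hlen
      rw [show X + 2 * X = 3 * X by ring] at this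
      exact Nat.size_le.1 this
    refine Spec.bind (Spec.table (P := fun _ (a : ℤ) => a.natAbs < b + 2 ^ (3 * X)) h.card_n
      le_rfl fun u => ?_) le_rfl fun δ' hδ' => ?_
    · refine Spec.bind (Timed.spec_get _ _) le_rfl ?_
      rintro _ rfl
      refine (Timed.spec_intSub (Timed.size_le_of_lt_two_pow ((hδ u).trans_le
        ((Nat.le_add_right _ _).trans hb))) (Timed.size_mul_le h.N_size hlen)).mono ?_ le_rfl
      rintro _ rfl
      have := hδ u
      omega
    · refine Spec.bind (hrec v R δ' k' (hk'.trans hk) hδ') le_rfl fun S _ => ?_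
      match S with
      | none => exact Spec.pure hbest
      | some S =>
        refine Spec.bind (h.addPath _ hP) le_rfl fun E _ => ?_
        refine Spec.bind (h.costOf E) le_rfl fun c hc => ?_
        exact h.keepLighter hk hbest hc hk'

/-- At most `X * X * X ^ 3` attempts of `T + X ^ 16` steps each; `hT` lets `T` absorb the second
summand. -/
theorem bestCandidate (h : InputBound I N X) {rec : Procedure I} {T b : ℕ} (hT : X ^ 16 ≤ T)
    (hb : b + 2 ^ (3 * X) ≤ 2 ^ (4 * X))
    (hrec : ∀ r R δ k, k ≤ X → (∀ u, (δ u).natAbs < b + 2 ^ (3 * X)) →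
      Spec (rec r R δ k) (fun _ => True) T)
    {δ : Fin I.n → ℤ} (hδ : ∀ u, (δ u).natAbs < b) (R : Finset (Fin I.n)) (r : Fin I.n)
    {k : ℕ} (hk : k ≤ X) :
    Spec (I.bestCandidate N rec r R δ k) (SmallCandidate X k) (X ^ 9 * T) := by
  have hc := pow_chains h.large
  have step : ∀ j, 1000 * (X ^ j * T) ≤ X ^ (j + 1) * T := by
    intro j
    rw [← mul_assoc]
    exact Nat.mul_le_mul_right T (pow_chain h.large j)
  have s0 := step 0
  have s1 := step 1
  have s2 := step 2
  have s3 := step 3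
  have s4 := step 4
  have s5 := step 5
  have s6 := step 6
  have s7 := step 7
  have s8 := step 8
  simp only [pow_zero, one_mul, Nat.reduceAdd, pow_one] at *
  refine Spec.le (s := X ^ 13 + (1 + X * (1 + (1 + X * (1 + (1 + X ^ 3 * (1 +
    (T + X ^ 16)))))))) ?_ ?_
  swap
  · have h1 : X ^ 3 * X ^ 16 ≤ X ^ 3 * T := Nat.mul_le_mul_left _ hT
    have h2 : X * X * (X ^ 3 * X ^ 16) ≤ X * X * (X ^ 3 * T) := Nat.mul_le_mul_left _ h1
    have h3 := h.large
    ring_nf at *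
    linarith
  rw [bestCandidate_eq]
  refine Spec.bind h.lengthBounds le_rfl ?_
  rintro bounds ⟨hlen, hsize⟩
  refine Spec.fold (by simp [SmallCandidate]) h.length_n le_rfl fun best v _ hbest => ?_
  refine Spec.fold hbest (by simpa using hk) le_rfl fun best k' hk' hbest => ?_
  refine Spec.fold hbest hlen le_rfl fun best D hD hbest => ?_
  rw [List.mem_range'_1] at hk'
  exact h.tryCandidate hb hrec hδ R r v hk (by omega) hbest (hsize D hD)

theorem greedyLoop (h : InputBound I N X) {rec : Procedure I} {T b : ℕ} (hT : X ^ 16 ≤ T)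
    (hb : b + 2 ^ (3 * X) ≤ 2 ^ (4 * X))
    (hrec : ∀ r R δ k, k ≤ X → (∀ u, (δ u).natAbs < b + 2 ^ (3 * X)) →
      Spec (rec r R δ k) (fun _ => True) T)
    {δ : Fin I.n → ℤ} (hδ : ∀ u, (δ u).natAbs < b) (r : Fin I.n) (fuel : ℕ)
    (R : Finset (Fin I.n)) {k : ℕ} (hk : k ≤ X) (S : Partial I) :
    Spec (I.greedyLoop N rec r δ fuel R k S) (fun _ => True) (fuel * (X ^ 10 * T)) := by
  have hc := pow_chains h.large
  induction fuel generalizing R k S with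
  | zero => exact Spec.pure trivial
  | succ fuel ih =>
    refine Spec.le (s := (1 + 0 + X) + (X ^ 9 * T + ((1 + X) + ((1 + X) + ((1 + X) +
      ((1 + X + X) + fuel * (X ^ 10 * T))))))) ?_ ?_
    swap
    · have h1 : 1000 * X ^ 9 * T ≤ X ^ 10 * T := Nat.mul_le_mul_right T hc.2.2.2.2.2.2.2.2.1
      have h2 : T ≤ X ^ 9 * T := Nat.le_mul_of_pos_left T (Nat.pow_pos (by linarith [h.large]))
      rw [Nat.succ_mul]
      linarith [h.large]
    unfold SLProblem.greedyLoop
    refine Spec.bind (Timed.spec_lt (by simp) (Timed.size_le_of_le hk)) le_rfl fun _ _ => ?_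
    split
    · refine Spec.bind (h.bestCandidate hT hb hrec hδ R r hk) le_rfl fun C hC => ?_
      match C with
      | none => exact Spec.pure trivial
      | some C =>
        refine Spec.bind (Timed.spec_union h.card_m _ _) le_rfl fun E _ => ?_
        refine Spec.bind (Timed.spec_union h.card_n _ _) le_rfl fun U _ => ?_
        refine Spec.bind (Timed.spec_sdiff h.card_n _ _) le_rfl fun R' _ => ?_
        refine Spec.bind (Timed.spec_sub (Timed.size_le_of_le hk)
          (Timed.size_le_of_le ((hC C rfl).2.trans hk))) le_rfl ?_
        rintro _ rfl
        exact ih R' ((Nat.sub_le _ _).trans hk) _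
    · exact Spec.pure trivial

/-- The hypothesis `hb` reserves `2 ^ (3 * X)` for each remaining level of recursion, so budgets
never exceed `4 * X` bits. A level runs at most `X` rounds of `X ^ 10 * T` steps each, where `T` is
the time one level below; this fits into `X ^ 12 * T` together with the remaining work. -/
theorem shallowLight (h : InputBound I N X) (i : ℕ) (r : Fin I.n) (R : Finset (Fin I.n))
    {δ : Fin I.n → ℤ} {b : ℕ} (hb : b + i * 2 ^ (3 * X) ≤ 2 ^ (4 * X))
    (hδ : ∀ u, (δ u).natAbs < b) {k : ℕ} (hk : k ≤ X) :
    Spec (I.shallowLight N (i + 1) r R δ k) (fun _ => True) (X ^ (18 + 12 * i)) := by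
  have hc := pow_chains h.large
  induction i generalizing r R δ b k with
  | zero =>
    refine Spec.le (s := X ^ 17 + (X ^ 3 + ((1 + X + X) + (X * X ^ 4 + 0)))) ?_ ?_
    swap
    · rw [show 18 + 12 * 0 = 18 from rfl]
      linarith [h.large]
    rw [SLProblem.shallowLight]
    refine Spec.bind (h.terminalPaths r R fun u => (hδ u).trans_le (by omega)) le_rfl
      fun P hP => ?_
    refine Spec.bind (h.countPaths P) le_rfl fun c hc => ?_
    refine Spec.bind (Timed.spec_lt hc (Timed.size_le_of_le hk)) le_rfl fun _ _ => ?_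
    split
    · exact Spec.pure trivial
    · rw [if_pos rfl]
      refine Spec.bind ((h.addCheapest hP k _).le (Nat.mul_le_mul_right _ hk)) le_rfl
        fun S _ => Spec.pure trivial
  | succ i ih =>
    have hT : X ^ 16 ≤ X ^ (18 + 12 * i) :=
      Nat.pow_le_pow_right (by linarith [h.large]) (by omega)
    refine Spec.le (s := X ^ 17 + (X ^ 3 + ((1 + X + X) + X * (X ^ 10 * X ^ (18 + 12 * i))))) ?_ ?_
    swap
    · have h1 : X ^ (18 + 12 * (i + 1)) = X ^ 12 * X ^ (18 + 12 * i) := by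
        rw [← pow_add]; congr 1; ring
      rw [h1]
      generalize X ^ (18 + 12 * i) = T at hT
      have h2 : 1000 * X ^ 11 * T ≤ X ^ 12 * T :=
        Nat.mul_le_mul_right T hc.2.2.2.2.2.2.2.2.2.2.1
      have h3 : X * X ^ 16 ≤ X ^ 11 * T :=
        Nat.mul_le_mul (Nat.le_self_pow (by norm_num) X) hT
      have h4 : X * (X ^ 10 * T) = X ^ 11 * T := by ring
      rw [h4]
      linarith [h.large]
    rw [SLProblem.shallowLight]
    have hb' : b + 2 ^ (3 * X) + i * 2 ^ (3 * X) ≤ 2 ^ (4 * X) := by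
      rw [Nat.succ_mul] at hb
      linarith
    have hb1 : b + 2 ^ (3 * X) ≤ 2 ^ (4 * X) := le_trans (Nat.le_add_right _ _) hb'
    refine Spec.bind (h.terminalPaths r R fun u => (hδ u).trans_le
      (le_trans (Nat.le_add_right _ _) hb1)) le_rfl fun P hP => ?_
    refine Spec.bind (h.countPaths P) le_rfl fun c hc => ?_
    refine Spec.bind (Timed.spec_lt hc (Timed.size_le_of_le hk)) le_rfl fun _ _ => ?_
    split
    · exact Spec.pure trivial
    · rw [if_neg (Nat.succ_ne_zero i)]
      refine (h.greedyLoop hT hb1 ?_ hδ r k R hk _).le (Nat.mul_le_mul_right _ hk)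
      exact fun r R δ k hk hδ => ih r R hb' hδ hk

/-- The distances in the tree after `j` rounds. -/
def SmallDist (X j : ℕ) (s : Finset (Fin I.m) × (Fin I.n → Option ℕ)) : Prop :=
  ∀ x a, s.2 x = some a → a ≤ j * 2 ^ X

theorem growTree (h : InputBound I N X) (E : Finset (Fin I.m)) {j : ℕ} (hj : j < X)
    {s : Finset (Fin I.m) × (Fin I.n → Option ℕ)} (hs : SmallDist X j s) :
    Spec (I.growTree E s) (SmallDist X (j + 1)) (X ^ 4) := by
  have hc := pow_chains h.large
  have hmono : SmallDist X (j + 1) s :=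
    fun x a hx => (hs x a hx).trans (Nat.mul_le_mul_right _ (Nat.le_succ j))
  refine Spec.le (s := (1 + X * (1 + (1 + (1 + (1 + (1 + (1 + (1 + ((1 + 2 * X + X) +
    (1 + 2 * X + 2 * X)))))))))) + ((1 + X) + (1 + ((1 + X * (1 + ((1 + X + X) + 1))) + 0)))) ?_ ?_
  swap
  · linarith [h.large]
  rw [growTree_eq]
  have hnear : Spec (nearest E s) (fun x => ∀ eb, x = some eb → eb.2 ≤ (j + 1) * 2 ^ X)
      (1 + X * (1 + (1 + (1 + (1 + (1 + (1 + (1 + ((1 + 2 * X + X) +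
        (1 + 2 * X + 2 * X)))))))))) := by
    refine Spec.fold (by simp) h.length_m le_rfl fun best e _ hbest => ?_
    refine Spec.bind (Timed.spec_mem _ _) le_rfl fun _ _ => ?_
    split
    · refine Spec.bind (Timed.spec_get _ _) le_rfl ?_
      rintro _ rfl
      refine Spec.bind (Timed.spec_get _ _) le_rfl ?_
      rintro _ rfl
      refine Spec.bind (Timed.spec_get _ _) le_rfl ?_
      rintro x rfl
      refine Spec.bind (Timed.spec_get _ _) le_rfl ?_
      rintro y rfl
      split
      · rename_i a ha _
        have ha := hs _ a ha
        refine Spec.bind (Timed.spec_get _ _) le_rfl ?_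
        rintro _ rfl
        refine Spec.bind (Timed.spec_add (Timed.size_le_of_lt_two_pow
          (ha.trans_lt (mul_two_pow_lt hj.le))) (h.len_size e)) le_rfl ?_
        rintro _ rfl
        refine Timed.spec_keepMin (Q := fun eb : Fin I.m × ℕ => eb.2 ≤ (j + 1) * 2 ^ X) hbest ?_
          fun eb heb => Timed.size_le_of_lt_two_pow (heb.trans_lt (mul_two_pow_lt hj))
        rw [Nat.succ_mul]
        exact Nat.add_le_add ha (h.len_lt e).le
      · exact Spec.pure hbest
    · exact Spec.pure hbest
  refine Spec.bind hnear le_rfl fun x hx => ?_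
  match x with
  | none => exact Spec.pure hmono
  | some (e, b) =>
    refine Spec.bind (Timed.spec_insert h.card_m _ _) le_rfl fun A _ => ?_
    refine Spec.bind (Timed.spec_get _ _) le_rfl ?_
    rintro _ rfl
    refine Spec.bind (Spec.table (P := fun _ (o : Option ℕ) => ∀ a, o = some a →
      a ≤ (j + 1) * 2 ^ X) h.card_n le_rfl fun x => ?_) le_rfl fun dist hdist => ?_
    · refine Spec.bind (Timed.spec_eq h.n_le _ _) le_rfl fun _ _ => ?_
      split
      · refine Spec.pure fun a ha => ?_
        obtain rfl := Option.some.inj ha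
        exact hx _ rfl
      · refine (Timed.spec_get _ _).mono ?_ le_rfl
        rintro _ rfl
        exact hmono x
    · exact Spec.pure hdist

theorem shortestPathTree (h : InputBound I N X) (E : Finset (Fin I.m)) :
    Spec (I.shortestPathTree E) (fun _ => True) (X ^ 6) := by
  have hc := pow_chains h.large
  refine Spec.le (s := (1 + X * (1 + (1 + X + X))) + ((1 + X * (1 + X ^ 4)) + 0)) ?_ ?_
  swap
  · linarith [h.large]
  unfold SLProblem.shortestPathTree
  refine Spec.bind (Spec.table (P := fun _ (o : Option ℕ) => ∀ a, o = some a → a ≤ 0 * 2 ^ X)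
    h.card_n le_rfl fun x => ?_) le_rfl fun dist hdist => ?_
  · refine Spec.bind (t := 0) (Timed.spec_eq h.n_le _ _) le_rfl fun _ _ => ?_
    split
    · refine Spec.pure fun a ha => ?_
      obtain rfl := Option.some.inj ha
      exact Nat.zero_le _
    · exact Spec.pure (by simp)
  · refine Spec.bind (Spec.fold_index (Inv := SmallDist X) hdist (by simpa using h.n_le) le_rfl
      fun j hj s _ _ hs => h.growTree E hj hs) le_rfl fun s _ => Spec.pure trivial

theorem algorithm (h : InputBound I N X) {i : ℕ} (hi : i + 1 ≤ X) :
    Spec (I.algorithm (i + 1) N) (fun _ => True) (X ^ (19 + 12 * i)) := by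
  have hc := pow_chains h.large
  refine Spec.le (s := (1 + X * (1 + (1 + ((1 + X) * (1 + X) + 0)))) + ((1 + X) +
    (X ^ (18 + 12 * i) + (X ^ 6 + 0)))) ?_ ?_
  swap
  · have h1 : X ^ 6 ≤ X ^ (18 + 12 * i) := Nat.pow_le_pow_right (by linarith [h.large]) (by omega)
    have h2 := pow_chain h.large (18 + 12 * i)
    rw [show 19 + 12 * i = 18 + 12 * i + 1 by ring]
    linarith [h.large]
  unfold SLProblem.algorithm
  refine Spec.bind (Spec.table (P := fun _ (a : ℤ) => a.natAbs < 2 ^ (2 * X)) h.card_n le_rfl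
    fun u => ?_) le_rfl fun δ hδ => ?_
  · refine Spec.bind (Timed.spec_get _ _) le_rfl ?_
    rintro _ rfl
    have hd := Timed.size_le_of_lt_two_pow (h.d_lt u)
    refine Spec.bind (Timed.spec_mul h.N_succ_size hd) le_rfl ?_
    rintro _ rfl
    refine Spec.pure ?_
    rw [Int.natAbs_natCast]
    have := Timed.size_mul_le h.N_succ_size hd
    rw [← two_mul] at this
    exact Nat.size_le.1 this
  · refine Spec.bind (Timed.spec_card h.card_n _) le_rfl fun k hk => ?_
    refine Spec.bind (h.shallowLight i _ _ ?_ hδ hk) le_rfl fun S _ => ?_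
    -- The initial budgets `(N + 1) * d` have at most `2 * X` bits, and `i + 1 ≤ X` leaves room for
    -- all levels.
    · have h1 : 2 ^ (2 * X) ≤ 2 ^ (3 * X) := Nat.pow_le_pow_right (by norm_num) (by omega)
      have h2 : (i + 1) * 2 ^ (3 * X) ≤ 2 ^ X * 2 ^ (3 * X) :=
        Nat.mul_le_mul_right _ (hi.trans Nat.lt_two_pow_self.le)
      rw [← pow_add, show X + 3 * X = 4 * X by ring, Nat.succ_mul] at h2
      omega
    · match S with
      | none => exact Spec.pure trivial
      | some S =>
        exact Spec.bind (h.shortestPathTree S.edges) le_rfl fun T _ => Spec.pure trivial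

end InputBound

theorem inputBound (I : SLProblem) (N i : ℕ) : InputBound I N (I.size + N + i + 1000) := by
  have hle : ∀ {a : ℕ}, a.size ≤ I.size → a < 2 ^ (I.size + N + i + 1000) :=
    fun h => Nat.size_le.1 (h.trans (by omega))
  have hsum : ∀ e, (I.cost e).size + (I.len e).size ≤
      ∑ e, ((I.cost e).size + (I.len e).size) := fun e =>
    Finset.single_le_sum (f := fun e => (I.cost e).size + (I.len e).size)
      (fun _ _ => Nat.zero_le _) (Finset.mem_univ e)
  have hsum' : ∀ v, (I.d v).size ≤ ∑ v, (I.d v).size := fun v =>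
    Finset.single_le_sum (f := fun v => (I.d v).size) (fun _ _ => Nat.zero_le _)
      (Finset.mem_univ v)
  refine ⟨by omega, ?_, ?_, by omega, fun e => hle ?_, fun e => hle ?_, fun v => hle ?_⟩
  · unfold size; omega
  · unfold size; omega
  · have := hsum e; unfold size; omega
  · have := hsum e; unfold size; omega
  · have := hsum' v; unfold size; omega

/-- The running time. -/
theorem algorithm_time_le (i : ℕ) : ∃ A : ℕ, ∀ (I : SLProblem) (ε : ℝ), 0 < ε →
    ((I.algorithm (i + 1) ⌈1 / ε⌉₊).time : ℝ) ≤ A * ((I.size : ℝ) + 1 / ε) ^ A := by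
  -- The same number serves as factor and as exponent: `X ≤ (i + 1002) * Y` gives the factor, and as
  -- `Y ≥ 1` the exponent `19 + 12 * i` may be enlarged to it.
  refine ⟨(i + 1002) ^ (19 + 12 * i), fun I ε hε => ?_⟩
  set N := ⌈1 / ε⌉₊
  set Y : ℝ := (I.size : ℝ) + 1 / ε
  have hN : (N : ℝ) ≤ 1 / ε + 1 := (Nat.ceil_lt_add_one (by positivity)).le
  have hn : 1 ≤ I.size := by
    have : 0 < I.n := lt_of_le_of_lt (Nat.zero_le _) I.root.isLt
    unfold size
    omega
  have hY : 1 ≤ Y := by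
    have h1 : (1 : ℝ) ≤ I.size := by exact_mod_cast hn
    have h2 : 0 < 1 / ε := by positivity
    linarith
  have hX : ((I.size + N + i + 1000 : ℕ) : ℝ) ≤ (i + 1002 : ℕ) * Y := by
    push_cast
    have h0 : (0 : ℝ) ≤ i := Nat.cast_nonneg i
    nlinarith
  have ht := ((inputBound I N i).algorithm (i := i) (by omega)).2
  set a := 19 + 12 * i with ha
  have hpow : a ≤ (i + 1002) ^ a := (Nat.lt_pow_self (by omega)).le
  calc ((I.algorithm (i + 1) N).time : ℝ) ≤ ((I.size + N + i + 1000 : ℕ) : ℝ) ^ a := by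
        exact_mod_cast ht
    _ ≤ ((i + 1002 : ℕ) * Y) ^ a := pow_le_pow_left₀ (Nat.cast_nonneg _) hX a
    _ = ((i + 1002) ^ a : ℕ) * Y ^ a := by rw [mul_pow, Nat.cast_pow]
    _ ≤ ((i + 1002) ^ a : ℕ) * Y ^ ((i + 1002) ^ a) :=
      mul_le_mul_of_nonneg_left (pow_le_pow_right₀ hY hpow) (Nat.cast_nonneg _)

end SLProblem

/-! ### Choice of the number of levels -/

theorem theorem2 (ε₂ : ℝ) (hε₂ : 0 < ε₂) :
    ∃ (i : ℕ) (C : ℝ) (A : ℕ), 1 ≤ i ∧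
      ∀ (I : SLProblem) (ε₁ : ℝ), 0 < ε₁ →
        ((I.algorithm i ⌈1 / ε₁⌉₊).time : ℝ) ≤ A * ((I.size : ℝ) + 1 / ε₁) ^ A ∧
        ((∃ T, I.IsFeasible T) →
          ∃ T, (I.algorithm i ⌈1 / ε₁⌉₊).val = some T ∧
            I.IsSolution (1 + ε₁) T ∧
            ∀ T', I.IsFeasible T' →
              (I.totalCost T : ℝ) ≤ C * (I.R.card : ℝ) ^ ε₂ * I.totalCost T') := by
  -- With `i + 1` levels the exponent is `1 / (i + 1) < ε₂`.
  obtain ⟨i, hi⟩ := exists_nat_one_div_lt hε₂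
  obtain ⟨F, hF, happ⟩ := SLProblem.algorithm_approximates i
  obtain ⟨A, hA⟩ := SLProblem.algorithm_time_le i
  refine ⟨i + 1, F, A, by omega, fun I ε₁ hε₁ => ⟨hA I ε₁ hε₁, fun hfeas => ?_⟩⟩
  have hN : 0 < ⌈1 / ε₁⌉₊ := Nat.ceil_pos.2 (by positivity)
  obtain ⟨T, hT, ⟨htree, hdist⟩, hcost⟩ := happ I _ hN hfeas
  refine ⟨T, hT, ⟨htree, fun v hv => ?_⟩, fun T' hT' => (hcost T' hT').trans ?_⟩
  · obtain ⟨p, hp, hl⟩ := hdist v hv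
    refine ⟨p, hp, hl.trans (mul_le_mul_of_nonneg_right ?_ (Nat.cast_nonneg _))⟩
    have h1 : 1 / (⌈1 / ε₁⌉₊ : ℝ) ≤ ε₁ := by
      rw [div_le_iff₀ (by exact_mod_cast hN), mul_comm, ← div_le_iff₀ hε₁]
      exact Nat.le_ceil _
    linarith
  · refine mul_le_mul_of_nonneg_right (mul_le_mul_of_nonneg_left ?_ hF) (Nat.cast_nonneg _)
    -- Monotonicity in the exponent needs a base of at least 1; without terminals both powers are 0.
    rcases Nat.eq_zero_or_pos I.R.card with h0 | h0
    · rw [h0, Nat.cast_zero, Real.zero_rpow (by positivity), Real.zero_rpow hε₂.ne']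
    · exact Real.rpow_le_rpow_of_exponent_le (by exact_mod_cast h0) hi.le
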